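/- Let $k$ be a field of characteristic $0$ and $d\in\mathbb Z$. Complexes are cohomologically $\mathbb Z$-graded over $k$. A *$d$-algebra* is a complex $V$ with a dg commutative associative product and a bracket making $V[d-1]$ a dg Lie algebra, such that $\{ab,c\}=a\{b,c\}+(-1)^{|b|(|c|+d-1)}\{a,c\}b$. A *$d$-coalgebra with counit* is the dual notion: a complex $C$ with a dg cocommutative coassociative coproduct $\Delta$ with counit $\epsilon$, and a Lie cobracket $\delta$ of degree $1-d$ satisfying the dual axioms (in particular $(\epsilon\otimes 1)\delta=0$). The tensor product $C\otimes E$ of two such is again one, with $\Delta(v\otimes w)=\pm\Delta(v)\otimes\Delta(w)$ and $\delta(v\otimes w)=\pm\delta(v)\otimes\Delta(w)\pm(-1)^{(d-1)|v|}\Delta(v)\otimes\delta(w)$, where $\pm$ is the Koszul sign of interchanging the two middle tensor factors. $C$ is *coproartinian* if it has an exhaustive increasing filtration $F^0\subset F^1\subset\cdots$ by sub-$d$-coalgebras such that $F^0$ is one-dimensional, spanned by an element $1$ with $\epsilon(1)=1$; $\Delta x=1\otimes x+x\otimes 1$ for $x\in F^1$ with $\epsilon(x)=0$; $\delta x=0$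 for $x\in F^1$; and, for $x\in F^i$ with $i\ge2$, both $\Delta x-1\otimes x-x\otimes1$ and $\delta x$ lie in $F^{i-1}\otimes F^{i-1}$. The element $1$ is then the unique grouplike element of $C$. For a $d$-algebra $V$, let $V^\vee$ be the cofree coproartinian graded $d$-coalgebra cogenerated by $V[d]$, with the coderivation differential $D$ determined by the structure of $V$: if $p:V^\vee\to V$ (of degree $d$) is the projection onto cogenerators, then $(-1)^d pD(x)=d_V p(x)+\tfrac12\big(\sum(-1)^{|x'|}\{p(x'),p(x'')\}+\sum(-1)^{d|y'|}p(y')p(y'')\big)$, where $\Delta x=\sum x'\otimes x''$ and $\delta x=\sum y'\otimes y''$. For a morphism $\phi:V^\vee\to W^\vee$ of $d$-coalgebras and a coproartinian $d$-coalgebra $S$, let $F^\phi_{V,W}(S)$ be the set of morphisms $V^\vee\otimes S\to W^\vee$ of $d$-coalgebras with counit whose restriction along $v\mapsto v\otimes 1$ is $\phi$. Let $\mathrm{Hom}^\phi(V,W)$ be a coproartinian $d$-coalgebra representing the functor $F^\phi_{V,W}$. **Theorem.** The coalgebras $V^\vee$ and $\mathrm{Hom}^\phi(V,W)$ exist. For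 $U^\vee\xrightarrow{\phi}V^\vee\xrightarrow{\psi}W^\vee$ the tensor product $\mathrm{Hom}^\phi(U,V)\otimes\mathrm{Hom}^\psi(V,W)$ is coproartinian, and there is a unique morphism of $d$-coalgebras $$\circ:\ \mathrm{Hom}^\phi(U,V)\otimes\mathrm{Hom}^\psi(V,W)\to\mathrm{Hom}^{\psi\circ\phi}(U,W)$$ which classifies the composition $g\circ(f\otimes\mathrm{id})$ of the two universal families $f,g$. It is natural: for all coproartinian $S,T$ it induces the composition map $F^\phi_{U,V}(S)\times F^\psi_{V,W}(T)\to F^{\psi\circ\phi}_{U,W}(S\otimes T)$, $(f,g)\mapsto g\circ(f\otimes\mathrm{id}_T)$. It is associative: for a further morphism $\chi:W^\vee\to X^\vee$, the maps $\circ(\circ\otimes\mathrm{Id})$ and $\circ(\mathrm{Id}\otimes\circ)$ from $\mathrm{Hom}^\phi(U,V)\otimes\mathrm{Hom}^\psi(V,W)\otimes\mathrm{Hom}^\chi(W,X)$ to $\mathrm{Hom}^{\chi\circ\psi\circ\phi}(U,X)$ coincide. Consequently, for every $d$-algebra $V$, the composition map makes $\mathrm{Hom}^{\mathrm{Id}}(V,V)$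 a coproartinian $d$-bialgebra: a coproartinian $d$-coalgebra $H$ with a morphism of $d$-coalgebras $H\otimes H\to H$ which is an associative product whose unit is the unique grouplike element of $H$. -/

import Mathlib

open scoped TensorProduct DirectSum

universe u

noncomputable section

/-- A complex of `k`-vector spaces, cohomologically `ℤ`-graded: a vector space `M` that is the internal
direct sum of its homogeneous parts `gr n`, with a differential `D` of degree `+1`. -/
structure DGSpace (k : Type u) [Field k] where
  carrier : Type u
  [grp : AddCommGroup carrier]
  [mod : Module k carrier]
  gr : ℤ → Submodule k carrier
  internal : DirectSum.IsInternal gr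
  D : carrier →ₗ[k] carrier
  D_mem : ∀ (n : ℤ) (x : carrier), x ∈ gr n → D x ∈ gr (n + 1)
  D_D : ∀ x : carrier, D (D x) = 0

attribute [instance] DGSpace.grp DGSpace.mod

namespace DGSpace

variable {k : Type u} [Field k]

instance : CoeSort (DGSpace k) (Type u) := ⟨DGSpace.carrier⟩

/-- The decomposition of a complex into its homogeneous components. -/
def components (M : DGSpace k) : M ≃ₗ[k] ⨁ i, M.gr i :=
  (LinearEquiv.ofBijective (DirectSum.coeLinearMap M.gr) M.internal).symm

theorem components_coe (M : DGSpace k) (i : ℤ) (x : M.gr i) :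
    M.components (x : M) = DirectSum.lof k ℤ (fun i => M.gr i) i x := by
  rw [components, LinearEquiv.symm_apply_eq]
  exact (DirectSum.coeLinearMap_lof M.gr i x).symm

/-- The sign operator `x ↦ (-1)^(q * |x|) x`. The Koszul tensor product `f ⊗ g` of linear maps, where
`g` has degree `q`, is `TensorProduct.map (f ∘ₗ M.sgn q) g`. -/
def sgn (M : DGSpace k) (q : ℤ) : M →ₗ[k] M :=
  DirectSum.toModule k ℤ M (fun i => (q * i).negOnePow • (M.gr i).subtype) ∘ₗ
    M.components.toLinearMap

theorem sgn_apply (M : DGSpace k) (q i : ℤ) (x : M) (hx : x ∈ M.gr i) :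
    M.sgn q x = (q * i).negOnePow • x := by
  have := M.components_coe i ⟨x, hx⟩
  simp only at this
  simp [sgn, this]

theorem hom_ext (M : DGSpace k) {P : Type*} [AddCommGroup P] [Module k P] {f g : M →ₗ[k] P}
    (h : ∀ i, ∀ x ∈ M.gr i, f x = g x) : f = g := by
  have : f ∘ₗ M.components.symm.toLinearMap = g ∘ₗ M.components.symm.toLinearMap := by
    ext i x
    have e : M.components.symm (DirectSum.lof k ℤ (fun i => M.gr i) i x) = (x : M) := by
      rw [← M.components_coe i x, LinearEquiv.symm_apply_apply]
    simpa [e] using h i x x.2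
  ext x
  simpa using LinearMap.congr_fun this (M.components x)

/-- Total degree on a tensor product. -/
def tensorGr (M N : DGSpace k) (n : ℤ) : Submodule k (M ⊗[k] N) :=
  ⨆ (i : ℤ) (j : ℤ) (_ : i + j = n),
    LinearMap.range (TensorProduct.map (M.gr i).subtype (N.gr j).subtype)

theorem tmul_mem_tensorGr (M N : DGSpace k) {i j n : ℤ} (h : i + j = n) {x : M} {y : N}
    (hx : x ∈ M.gr i) (hy : y ∈ N.gr j) : x ⊗ₜ[k] y ∈ tensorGr M N n := by
  refine Submodule.mem_iSup_of_mem i (Submodule.mem_iSup_of_mem j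
    (Submodule.mem_iSup_of_mem h ⟨⟨x, hx⟩ ⊗ₜ ⟨y, hy⟩, by simp⟩))

theorem tensorGr_le (M N : DGSpace k) {n : ℤ} {P : Submodule k (M ⊗[k] N)}
    (h : ∀ i j, i + j = n → ∀ x ∈ M.gr i, ∀ y ∈ N.gr j, x ⊗ₜ[k] y ∈ P) :
    tensorGr M N n ≤ P := by
  refine iSup_le fun i => iSup_le fun j => iSup_le fun hij => ?_
  rintro _ ⟨t, rfl⟩
  induction t with
  | zero => simp
  | tmul x y => exact h i j hij x x.2 y y.2
  | add a b ha hb => rw [map_add]; exact P.add_mem ha hb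

theorem tensor_hom_ext (M N : DGSpace k) {P : Type*} [AddCommGroup P] [Module k P]
    {f g : M ⊗[k] N →ₗ[k] P}
    (h : ∀ i, ∀ x ∈ M.gr i, ∀ j, ∀ y ∈ N.gr j, f (x ⊗ₜ y) = g (x ⊗ₜ y)) : f = g := by
  refine TensorProduct.ext ?_
  refine M.hom_ext fun i x hx => N.hom_ext fun j y hy => ?_
  exact h i x hx j y hy

/-- The homogeneous components of an element of a tensor product. -/
def tensorDecompose (M N : DGSpace k) : M ⊗[k] N →ₗ[k] ⨁ n, tensorGr M N n :=
  DirectSum.toModule k (ℤ × ℤ) _ (fun p =>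
      DirectSum.lof k ℤ (fun n => tensorGr M N n) (p.1 + p.2) ∘ₗ
        LinearMap.codRestrict (tensorGr M N (p.1 + p.2))
          (TensorProduct.map (M.gr p.1).subtype (N.gr p.2).subtype)
          (fun t => Submodule.mem_iSup_of_mem p.1 (Submodule.mem_iSup_of_mem p.2
            (Submodule.mem_iSup_of_mem rfl ⟨t, rfl⟩)))) ∘ₗ
    (TensorProduct.directSum k k (fun i => M.gr i) (fun j => N.gr j)).toLinearMap ∘ₗ
    TensorProduct.map M.components.toLinearMap N.components.toLinearMap

theorem tensorDecompose_tmul (M N : DGSpace k) {i j : ℤ} {x : M} {y : N}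
    (hx : x ∈ M.gr i) (hy : y ∈ N.gr j) :
    tensorDecompose M N (x ⊗ₜ y) = DirectSum.lof k ℤ (fun n => tensorGr M N n) (i + j)
      ⟨x ⊗ₜ y, tmul_mem_tensorGr M N rfl hx hy⟩ := by
  have h1 := M.components_coe i ⟨x, hx⟩
  have h2 := N.components_coe j ⟨y, hy⟩
  simp only at h1 h2
  simp only [tensorDecompose, LinearMap.comp_apply, TensorProduct.map_tmul,
    LinearEquiv.coe_coe, h1, h2, TensorProduct.directSum_lof_tmul_lof, DirectSum.toModule_lof]
  rfl

theorem tensor_internal (M N : DGSpace k) : DirectSum.IsInternal (tensorGr M N) := by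
  have hl : ∀ t, DirectSum.coeLinearMap (tensorGr M N) (tensorDecompose M N t) = t := by
    intro t
    have : DirectSum.coeLinearMap (tensorGr M N) ∘ₗ tensorDecompose M N = LinearMap.id := by
      refine tensor_hom_ext M N fun i x hx j y hy => ?_
      simp only [LinearMap.comp_apply, tensorDecompose_tmul M N hx hy]
      simp
    exact LinearMap.congr_fun this t
  have hr : ∀ t, tensorDecompose M N (DirectSum.coeLinearMap (tensorGr M N) t) = t := by
    intro t
    have : tensorDecompose M N ∘ₗ DirectSum.coeLinearMap (tensorGr M N) = LinearMap.id := by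
      refine DirectSum.linearMap_ext _ fun n => ?_
      ext1 ⟨t, ht⟩
      have key : tensorGr M N n ≤ LinearMap.eqLocus (tensorDecompose M N)
          (DirectSum.lof k ℤ (fun n => tensorGr M N n) n ∘ₗ
            DirectSum.component k ℤ (fun n => tensorGr M N n) n ∘ₗ tensorDecompose M N) := by
        refine tensorGr_le M N fun i j hij x hx y hy => ?_
        subst hij
        simp [LinearMap.mem_eqLocus, tensorDecompose_tmul M N hx hy]
      have h1 : tensorDecompose M N t = DirectSum.lof k ℤ (fun n => tensorGr M N n) n
          (DirectSum.component k ℤ (fun n => tensorGr M N n) n (tensorDecompose M N t)) := key ht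
      have h2 := hl t
      rw [h1] at h2
      simp only [DirectSum.coeLinearMap_lof] at h2
      simp only [LinearMap.comp_apply, DirectSum.coeLinearMap_lof, LinearMap.id_apply]
      rw [h1]
      congr 1
      exact Subtype.ext h2
    exact LinearMap.congr_fun this t
  exact ⟨fun a b hab => by rw [← hr a, ← hr b]; exact congrArg _ hab, fun t => ⟨_, hl t⟩⟩

/-- The tensor product of complexes, with `D (x ⊗ y) = D x ⊗ y + (-1)^|x| x ⊗ D y`. -/
abbrev tensor (M N : DGSpace k) : DGSpace k where
  carrier := M ⊗[k] N
  gr := tensorGr M N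
  internal := tensor_internal M N
  D := TensorProduct.map M.D LinearMap.id + TensorProduct.map (M.sgn 1) N.D
  D_mem n t ht := by
    revert t
    refine tensorGr_le M N (P := (tensorGr M N (n + 1)).comap _) fun i j hij x hx y hy => ?_
    simp only [Submodule.mem_comap, LinearMap.add_apply, TensorProduct.map_tmul,
      LinearMap.id_apply, M.sgn_apply 1 i x hx]
    refine Submodule.add_mem _ (tmul_mem_tensorGr M N (by omega) (M.D_mem i x hx) hy)
      (tmul_mem_tensorGr M N (i := i) (j := j + 1) (by omega) ?_ (N.D_mem j y hy))
    rw [Units.smul_def]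
    exact zsmul_mem hx _
  D_D t := by
    suffices h : (TensorProduct.map M.D LinearMap.id + TensorProduct.map (M.sgn 1) N.D) ∘ₗ
        (TensorProduct.map M.D LinearMap.id + TensorProduct.map (M.sgn 1) N.D) = 0 from
      LinearMap.congr_fun h t
    refine tensor_hom_ext M N fun i x hx j y hy => ?_
    have e : M.sgn 1 (M.D x) = - M.D (M.sgn 1 x) := by
      rw [M.sgn_apply 1 _ _ (M.D_mem i x hx), M.sgn_apply 1 i x hx, one_mul, one_mul,
        Int.negOnePow_succ, Units.smul_def, Units.smul_def, map_zsmul]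
      simp
    simp [M.D_D, N.D_D, e, TensorProduct.neg_tmul]

/-- The symmetry `x ⊗ y ↦ (-1)^(|x| |y|) y ⊗ x` of graded vector spaces. -/
def swap (M N : DGSpace k) : M ⊗[k] N →ₗ[k] N ⊗[k] M :=
  TensorProduct.map N.components.symm.toLinearMap M.components.symm.toLinearMap ∘ₗ
    (TensorProduct.gradedComm k (fun i => M.gr i) (fun j => N.gr j)).toLinearMap ∘ₗ
    TensorProduct.map M.components.toLinearMap N.components.toLinearMap

/-- The signed cyclic permutation `(x ⊗ y) ⊗ z ↦ ± (z ⊗ x) ⊗ y`. -/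
def cyc (M : DGSpace k) : (M ⊗[k] M) ⊗[k] M →ₗ[k] (M ⊗[k] M) ⊗[k] M :=
  (TensorProduct.assoc k M M M).symm.toLinearMap ∘ₗ swap (M.tensor M) M

/-- The signed interchange `(x ⊗ x') ⊗ (y ⊗ y') ↦ (-1)^(|x'| |y|) (x ⊗ y) ⊗ (x' ⊗ y')`. -/
def interchange (M N : DGSpace k) :
    (M ⊗[k] M) ⊗[k] (N ⊗[k] N) →ₗ[k] (M ⊗[k] N) ⊗[k] (M ⊗[k] N) :=
  (TensorProduct.assoc k M N (M ⊗[k] N)).symm.toLinearMap ∘ₗ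
    TensorProduct.map LinearMap.id
      ((TensorProduct.assoc k N M N).toLinearMap ∘ₗ
        TensorProduct.map (swap M N) LinearMap.id ∘ₗ
        (TensorProduct.assoc k M N N).symm.toLinearMap) ∘ₗ
    (TensorProduct.assoc k M M (N ⊗[k] N)).toLinearMap

end DGSpace

/-- A `d`-algebra (without unit): a complex `V` with a graded commutative associative dg product, and
a bracket which makes the shifted complex `V[d-1]` a dg Lie algebra, subject to the Leibniz identity.
An element of degree `m` in `V` has degree `m - (d - 1)` in `V[d-1]`; the signs in the Lie
algebra axioms are those of `V[d-1]`. -/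
structure DAlgebra (k : Type u) [Field k] (d : ℤ) extends DGSpace k where
  mul : carrier →ₗ[k] carrier →ₗ[k] carrier
  bracket : carrier →ₗ[k] carrier →ₗ[k] carrier
  mul_mem : ∀ {m n : ℤ} {x y : carrier}, x ∈ gr m → y ∈ gr n → mul x y ∈ gr (m + n)
  mul_assoc : ∀ x y z : carrier, mul (mul x y) z = mul x (mul y z)
  mul_comm : ∀ {m n : ℤ} {x y : carrier}, x ∈ gr m → y ∈ gr n →
    mul x y = (m * n).negOnePow • mul y x
  D_mul : ∀ {m : ℤ} {x : carrier} (y : carrier), x ∈ gr m →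
    D (mul x y) = mul (D x) y + m.negOnePow • mul x (D y)
  bracket_mem : ∀ {m n : ℤ} {x y : carrier}, x ∈ gr m → y ∈ gr n →
    bracket x y ∈ gr (m + n + (1 - d))
  bracket_skew : ∀ {m n : ℤ} {x y : carrier}, x ∈ gr m → y ∈ gr n →
    bracket x y = -(((m - (d - 1)) * (n - (d - 1))).negOnePow • bracket y x)
  jacobi : ∀ {m n : ℤ} {x y : carrier} (z : carrier), x ∈ gr m → y ∈ gr n →
    bracket x (bracket y z) = bracket (bracket x y) z +
      ((m - (d - 1)) * (n - (d - 1))).negOnePow • bracket y (bracket x z)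
  D_bracket : ∀ {m : ℤ} {x : carrier} (y : carrier), x ∈ gr m →
    D (bracket x y) = bracket (D x) y + (m - (d - 1)).negOnePow • bracket x (D y)
  leibniz : ∀ {n l : ℤ} (x : carrier) {y z : carrier}, y ∈ gr n → z ∈ gr l →
    bracket (mul x y) z =
      mul x (bracket y z) + (n * (l + d - 1)).negOnePow • mul (bracket x z) y

/-- A complex with operations of the shape of those of a `d`-coalgebra with counit (the axioms are in
`IsDCoalgebra`). -/
structure DCoalgebraOps (k : Type u) [Field k] (d : ℤ) extends DGSpace k where
  comul : carrier →ₗ[k] carrier ⊗[k] carrier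
  counit : carrier →ₗ[k] k
  cobracket : carrier →ₗ[k] carrier ⊗[k] carrier

namespace DCoalgebraOps

variable {k : Type u} [Field k] {d : ℤ}

instance : CoeSort (DCoalgebraOps k d) (Type u) := ⟨fun C => C.carrier⟩

/-- The axioms of a `d`-coalgebra with counit, dual to those of a `d`-algebra with unit. The cobracket
is treated as an operator `C → C ⊗ C` of degree `1 - d` with the Koszul rule for signs: so
a Lie cobracket on `C[1-d]` is an operator `δ` with `swap ∘ δ = (-1)^d δ` and
the co-Jacobi identity `(1 + cyc + cyc²) ∘ (δ ⊗ 1) ∘ δ = 0`. -/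
structure IsDCoalgebra (C : DCoalgebraOps k d) : Prop where
  comul_mem : ∀ (n : ℤ) (x : C), x ∈ C.gr n → C.comul x ∈ (C.tensor C.toDGSpace).gr n
  counit_eq_zero : ∀ (n : ℤ) (x : C), n ≠ 0 → x ∈ C.gr n → C.counit x = 0
  cobracket_mem : ∀ (n : ℤ) (x : C), x ∈ C.gr n →
    C.cobracket x ∈ (C.tensor C.toDGSpace).gr (n + (1 - d))
  comul_D : ∀ x : C, C.comul (C.D x) = (C.tensor C.toDGSpace).D (C.comul x)
  counit_D : ∀ x : C, C.counit (C.D x) = 0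
  cobracket_D : ∀ x : C, C.cobracket (C.D x) =
    (d - 1).negOnePow • (C.tensor C.toDGSpace).D (C.cobracket x)
  coassoc : (TensorProduct.assoc k C C C).toLinearMap ∘ₗ
      TensorProduct.map C.comul LinearMap.id ∘ₗ C.comul =
    TensorProduct.map LinearMap.id C.comul ∘ₗ C.comul
  cocomm : DGSpace.swap C.toDGSpace C.toDGSpace ∘ₗ C.comul = C.comul
  counit_comul : (TensorProduct.lid k C).toLinearMap ∘ₗ
      TensorProduct.map C.counit LinearMap.id ∘ₗ C.comul = LinearMap.id
  cobracket_swap : DGSpace.swap C.toDGSpace C.toDGSpace ∘ₗ C.cobracket =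
    d.negOnePow • C.cobracket
  cojacobi :
    (LinearMap.id + C.cyc + C.cyc ∘ₗ C.cyc) ∘ₗ
      TensorProduct.map C.cobracket LinearMap.id ∘ₗ C.cobracket = 0
  coleibniz : (TensorProduct.assoc k C C C).toLinearMap ∘ₗ
      TensorProduct.map C.comul LinearMap.id ∘ₗ C.cobracket =
    TensorProduct.map (C.sgn (1 - d)) C.cobracket ∘ₗ C.comul +
      TensorProduct.map LinearMap.id (DGSpace.swap C.toDGSpace C.toDGSpace) ∘ₗ
        (TensorProduct.assoc k C C C).toLinearMap ∘ₗ
        TensorProduct.map C.cobracket LinearMap.id ∘ₗ C.comul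
  counit_cobracket : TensorProduct.map C.counit LinearMap.id ∘ₗ C.cobracket =
    (0 : C →ₗ[k] k ⊗[k] C)

/-- The subspace `F ⊗ F` of `C ⊗ C`. -/
def square (C : DCoalgebraOps k d) (F : Submodule k C) : Submodule k (C ⊗[k] C) :=
  LinearMap.range (TensorProduct.map F.subtype F.subtype)

/-- `F` is a sub-`d`-coalgebra: a graded subcomplex stable under the operations. -/
structure IsSubcoalgebra (C : DCoalgebraOps k d) (F : Submodule k C) : Prop where
  homogeneous : F ≤ ⨆ n, F ⊓ C.gr n
  D_mem : ∀ x ∈ F, C.D x ∈ F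
  comul_mem : ∀ x ∈ F, C.comul x ∈ C.square F
  cobracket_mem : ∀ x ∈ F, C.cobracket x ∈ C.square F

/-- `F` is an exhaustive increasing filtration by sub-`d`-coalgebras which exhibits `C` as
coproartinian; `e` is the element `1` of the one-dimensional `F 0` with `ε(1) = 1`. -/
structure IsCoartFiltration (C : DCoalgebraOps k d) (F : ℕ → Submodule k C) (e : C) : Prop where
  mono : Monotone F
  exhaustive : ∀ x : C, ∃ i, x ∈ F i
  subcoalgebra : ∀ i, C.IsSubcoalgebra (F i)
  zero_eq : F 0 = Submodule.span k {e}
  counit_one : C.counit e = 1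
  comul_one : ∀ x ∈ F 1, C.counit x = 0 → C.comul x = e ⊗ₜ x + x ⊗ₜ e
  cobracket_one : ∀ x ∈ F 1, C.cobracket x = 0
  comul_mem : ∀ i, 2 ≤ i → ∀ x ∈ F i,
    C.comul x - e ⊗ₜ x - x ⊗ₜ e ∈ C.square (F (i - 1))
  cobracket_mem : ∀ i, 2 ≤ i → ∀ x ∈ F i, C.cobracket x ∈ C.square (F (i - 1))

/-- `C` is a coproartinian `d`-coalgebra. -/
structure IsCoproartinian (C : DCoalgebraOps k d) : Prop where
  isDCoalgebra : C.IsDCoalgebra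
  exists_filtration : ∃ F e, C.IsCoartFiltration F e

/-- Grouplike elements. -/
def IsGrouplike (C : DCoalgebraOps k d) (e : C) : Prop :=
  C.comul e = e ⊗ₜ e ∧ C.counit e = 1

/-- Morphisms of graded `d`-coalgebras with counit (the differentials are ignored). -/
structure IsGradedHom (C E : DCoalgebraOps k d) (f : C →ₗ[k] E) : Prop where
  map_mem : ∀ (n : ℤ) (x : C), x ∈ C.gr n → f x ∈ E.gr n
  map_counit : ∀ x, E.counit (f x) = C.counit x
  map_comul : ∀ x, E.comul (f x) = TensorProduct.map f f (C.comul x)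
  map_cobracket : ∀ x, E.cobracket (f x) = TensorProduct.map f f (C.cobracket x)

/-- Morphisms of (differential graded) `d`-coalgebras with counit. -/
structure IsHom (C E : DCoalgebraOps k d) (f : C →ₗ[k] E) : Prop extends
    IsGradedHom C E f where
  map_D : ∀ x, f (C.D x) = E.D (f x)

/-- The tensor product of `d`-coalgebras with counit:
`Δ(v ⊗ w) = ± Δ(v) ⊗ Δ(w)` and `δ(v ⊗ w) = ± δ(v) ⊗ Δ(w) ± (-1)^((d-1)|v|) Δ(v) ⊗ δ(w)`, where
`±` is the sign of the interchange of the two middle tensor factors. -/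
abbrev tensor (C E : DCoalgebraOps k d) : DCoalgebraOps k d where
  toDGSpace := C.toDGSpace.tensor E.toDGSpace
  comul := DGSpace.interchange C.toDGSpace E.toDGSpace ∘ₗ TensorProduct.map C.comul E.comul
  counit := LinearMap.mul' k k ∘ₗ TensorProduct.map C.counit E.counit
  cobracket := DGSpace.interchange C.toDGSpace E.toDGSpace ∘ₗ
    (TensorProduct.map C.cobracket E.comul +
      TensorProduct.map (C.comul ∘ₗ C.sgn (d - 1)) E.cobracket)

end DCoalgebraOps

variable {k : Type u} [Field k] {d : ℤ}

/-- A linear map `f : C → M` of degree `d` which factors through the quotient of `C` by the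
line `F⁰C` spanned by its grouplike element. -/
structure IsCogenerator (C : DCoalgebraOps k d) (M : DGSpace k) (f : C →ₗ[k] M) : Prop where
  map_mem : ∀ (n : ℤ) (x : C), x ∈ C.gr n → f x ∈ M.gr (n + d)
  map_grouplike : ∀ e : C, C.IsGrouplike e → f e = 0

/-- A model of the `d`-coalgebra `V^∨`. As a graded coalgebra it is
the cofree coproartinian `d`-coalgebra cogenerated by `V[d]`: `proj` is the projection
onto cogenerators, regarded as a map to `V` of degree `d`. Its differential is the coderivation whose
corestriction `proj ∘ D` is given by the differential, the bracket and the product of `V`: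
`(-1)^d p(D x) = d_V(p(x)) + 1/2 (∑ (-1)^|x'| {p(x'), p(x'')} + ∑ (-1)^(d|y'|) p(y') p(y''))`
with `Δ x = ∑ x' ⊗ x''` and `δ x = ∑ y' ⊗ y''`. -/
structure BarCoalgebra (V : DAlgebra k d) where
  coalg : DCoalgebraOps k d
  coart : coalg.IsCoproartinian
  proj : coalg →ₗ[k] V.carrier
  isCogenerator : IsCogenerator coalg V.toDGSpace proj
  cofree : ∀ (W : DCoalgebraOps k d), W.IsCoproartinian →
    ∀ f : W →ₗ[k] V.carrier, IsCogenerator W V.toDGSpace f →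
      ∃! F : W →ₗ[k] coalg, W.IsGradedHom coalg F ∧ proj ∘ₗ F = f
  proj_D : d.negOnePow • (proj ∘ₗ coalg.D) = V.D ∘ₗ proj + (2⁻¹ : k) •
    (TensorProduct.lift V.bracket ∘ₗ
        TensorProduct.map (proj ∘ₗ coalg.sgn 1) proj ∘ₗ coalg.comul +
      TensorProduct.lift V.mul ∘ₗ
        TensorProduct.map (proj ∘ₗ coalg.sgn d) proj ∘ₗ coalg.cobracket)

/-- `f` belongs to `F^φ(S)`: it is a morphism `X ⊗ S → Y` of `d`-coalgebras
whose restriction along `X = X ⊗ k → X ⊗ S` is `φ`. -/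
structure IsFamily {X Y : DCoalgebraOps k d} (φ : X →ₗ[k] Y) (S : DCoalgebraOps k d)
    (f : X ⊗[k] S →ₗ[k] Y) : Prop where
  isHom : (X.tensor S).IsHom Y f
  restrict : ∀ e : S, S.IsGrouplike e → ∀ x : X, f (x ⊗ₜ e) = φ x

/-- A coproartinian `d`-coalgebra `hom^φ(X, Y)` representing the functor `F^φ` on coproartinian
`d`-coalgebras, with its universal element `ev`. -/
structure InternalHom {X Y : DCoalgebraOps k d} (φ : X →ₗ[k] Y) where
  obj : DCoalgebraOps k d
  coart : obj.IsCoproartinian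
  ev : X ⊗[k] obj →ₗ[k] Y
  ev_mem : IsFamily φ obj ev
  represents : ∀ (S : DCoalgebraOps k d), S.IsCoproartinian →
    ∀ f : X ⊗[k] S →ₗ[k] Y, IsFamily φ S f →
      ∃! g : S →ₗ[k] obj, S.IsHom obj g ∧ ev ∘ₗ TensorProduct.map LinearMap.id g = f

/-- The composition `X ⊗ (S ⊗ T) = (X ⊗ S) ⊗ T → Y ⊗ T → Z` of `f : X ⊗ S → Y` and
`g : Y ⊗ T → Z`. -/
def compFamily {X Y Z S T : DCoalgebraOps k d} (f : X ⊗[k] S →ₗ[k] Y) (g : Y ⊗[k] T →ₗ[k] Z) :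
    X ⊗[k] (S ⊗[k] T) →ₗ[k] Z :=
  g ∘ₗ TensorProduct.map f LinearMap.id ∘ₗ (TensorProduct.assoc k X S T).symm.toLinearMap

/-- `c : hom^φ(X, Y) ⊗ hom^ψ(Y, Z) → hom^χ(X, Z)` is the composition map: the morphism of
`d`-coalgebras which classifies the composition of the two universal elements. -/
structure IsComposition {X Y Z : DCoalgebraOps k d} {φ : X →ₗ[k] Y} {ψ : Y →ₗ[k] Z}
    {χ : X →ₗ[k] Z} (H₁ : InternalHom φ) (H₂ : InternalHom ψ) (H₃ : InternalHom χ)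
    (c : H₁.obj ⊗[k] H₂.obj →ₗ[k] H₃.obj) : Prop where
  isHom : (H₁.obj.tensor H₂.obj).IsHom H₃.obj c
  classifies : H₃.ev ∘ₗ TensorProduct.map LinearMap.id c = compFamily H₁.ev H₂.ev

/-- `H` with the product `m` is a coproartinian `d`-bialgebra. -/
structure IsDBialgebra (H : DCoalgebraOps k d) (m : H ⊗[k] H →ₗ[k] H) : Prop where
  coart : H.IsCoproartinian
  isHom : (H.tensor H).IsHom H m
  assoc : ∀ x y z : H, m (m (x ⊗ₜ y) ⊗ₜ z) = m (x ⊗ₜ m (y ⊗ₜ z))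
  unit : ∃ e : H, H.IsGrouplike e ∧ (∀ e', H.IsGrouplike e' → e' = e) ∧
    ∀ x, m (e ⊗ₜ x) = x ∧ m (x ⊗ₜ e) = x

end

/-! Everything rests on one representability principle, `IsLocal.exists_universal`. Consider a
condition on linear maps `f : S → M` from coproartinian `d`-coalgebras to a fixed vector space which
is local in `S`. Induction along a filtration shows that every element of a coproartinian coalgebra
lies in a finite-dimensional sub-`d`-coalgebra (`IsCoproartinian.exists_isFiniteSub`), so a small
set of structures on the spaces `k^n` suffices to build all objects. Take the direct sum over this
set and divide by the largest coideal on which the induced map to `M` vanishes. The quotient `H`,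
with its map `ev` to `M`, is simple: no nonzero coideal lies in the kernel of `ev`. Differences of
morphisms have coideals as ranges and morphisms have coideals as kernels, so morphisms into `H` are
determined by their composite with `ev`, and morphisms out of `H` over `M` are injective. To
classify an object `T`, amalgamate `H` and `T` into a simple object `K`. The map `H → K` is
injective; it is surjective because every finite-dimensional piece of `T` is isomorphic to a member
of the chosen set and hence maps to `H` over `M`. Thus `T → K ≅ H`.

There are two applications. A family `X ⊗ S → Y` is a map from `S` to the space of linear maps `X →
Y`, and being a family is a local condition (`IsFamily.isLocal`); this gives the internal hom. Maps
`S → V` of degree `d` killing the grouplike element, with `S` of zero differential, give the cofree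
coalgebra (`exists_isCofree`).

The differential of the bar coalgebra comes from an infinitesimal argument. Let `K` be spanned by a
grouplike element and a primitive element of degree `n`. Coderivations of degree `n` of `C` are the
morphisms `K ⊗ C → C` extending the identity (`isCoderivation_iff`), so cofreeness yields
coderivations with prescribed corestriction, and their uniqueness. The square of the resulting `Q`
of degree `1` is a coderivation, and vanishes as soon as `p Q Q = 0`. Write `B` for the quadratic
part of the bar differential and `L(r)` for the same expression with `r` in place of `p` in the
first slot. Then `d B = 2 L(d p)` and `B Q = -2 L(p Q)`, and what remains is `L(B) = 0`. This is
`barLinear_barQuadratic`, the only substantial use of the axioms of `V` and `C` together: Jacobi is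
paired with the iterated coproduct, associativity with co-Jacobi, and Leibniz with co-Leibniz.

Composition needs tensor products to be coproartinian `d`-coalgebras (`IsDCoalgebra.tensor`,
`IsCoartFiltration.tensor`). The delicate axiom is co-Jacobi: by co-Leibniz the mixed terms become
rotations of one another with opposite signs and cancel in the cyclic sum. The composite of the two
universal families is then a family over the tensor product and so is classified by a unique
morphism. Associativity and the unit laws follow by checking that the two morphisms in question
classify the same family. -/

noncomputable section

/-! ### Signs and their reduction modulo 2 -/

section KoszulSign

/-- The sign `(-1)^n` as a scalar of `k`. -/
def koszulSign (k : Type u) [Field k] (n : ℤ) : k := ((n.negOnePow : ℤ) : k)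

variable {k : Type u} [Field k]

theorem negOnePow_smul_eq {M : Type*} [AddCommGroup M] [Module k M] (n : ℤ) (x : M) :
    n.negOnePow • x = koszulSign k n • x := by
  rw [koszulSign, Units.smul_def, Int.cast_smul_eq_zsmul]

theorem koszulSign_add (m n : ℤ) : koszulSign k (m + n) = koszulSign k m * koszulSign k n := by
  simp [koszulSign, Int.negOnePow_add]

theorem koszulSign_zero : koszulSign k 0 = 1 := by simp [koszulSign]

theorem koszulSign_one : koszulSign k 1 = -1 := by simp [koszulSign]

/-- Sign comparisons below are turned by this lemma into identities of exponents in `ZMod 2`, where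
they are elementary algebra. -/
theorem koszulSign_congr {m n : ℤ} (h : (m : ZMod 2) = n) : koszulSign k m = koszulSign k n := by
  have h2 : (2 : ℤ) ∣ n - m := (ZMod.intCast_eq_intCast_iff_dvd_sub m n 2).1 h
  rw [koszulSign, koszulSign, (Int.negOnePow_eq_iff m n).2]
  obtain ⟨c, hc⟩ := h2
  exact ⟨-c, by omega⟩

theorem koszulSign_mul_self (n : ℤ) : koszulSign k n * koszulSign k n = 1 := by
  rw [← koszulSign_add, ← koszulSign_zero]
  exact koszulSign_congr (by push_cast; grind)

theorem koszulSign_smul_congr {M : Type*} [AddCommGroup M] [Module k M] {m n : ℤ} (x : M)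
    (h : (m : ZMod 2) = n) : koszulSign k m • x = koszulSign k n • x := by
  rw [koszulSign_congr h]

/-- Needed when an exponent contains the square of a degree or of `d`: such identities hold for the
values in `ZMod 2`, not as polynomial identities of characteristic 2. -/
theorem ZMod.two_mul_self_eq (x : ZMod 2) : x * x = x := by revert x; decide

end KoszulSign

/-! ### Graded linear algebra: projections, homogeneous maps, symmetry and interchange -/

namespace DGSpace

variable {k : Type u} [Field k]

/-- The projection of a complex onto its part of degree `n`. -/
def proj (M : DGSpace k) (n : ℤ) : M →ₗ[k] M :=
  (M.gr n).subtype ∘ₗ DirectSum.component k ℤ (fun i => M.gr i) n ∘ₗ M.components.toLinearMap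

theorem proj_mem (M : DGSpace k) (n : ℤ) (x : M) : M.proj n x ∈ M.gr n :=
  Submodule.coe_mem _

theorem proj_of_mem (M : DGSpace k) {n : ℤ} {x : M} (hx : x ∈ M.gr n) : M.proj n x = x := by
  have := M.components_coe n ⟨x, hx⟩
  simp only at this
  simp [proj, this]

theorem proj_of_mem_ne (M : DGSpace k) {m n : ℤ} {x : M} (hx : x ∈ M.gr m) (h : m ≠ n) :
    M.proj n x = 0 := by
  have := M.components_coe m ⟨x, hx⟩
  simp only at this
  simp [proj, this, DirectSum.component.of, h]

theorem mem_gr_iff (M : DGSpace k) {n : ℤ} {x : M} : x ∈ M.gr n ↔ M.proj n x = x :=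
  ⟨M.proj_of_mem, fun h => h ▸ M.proj_mem n x⟩

theorem iSup_gr (M : DGSpace k) : ⨆ n, M.gr n = ⊤ :=
  M.internal.submodule_iSup_eq_top

theorem mem_of_proj_mem (M : DGSpace k) (P : Submodule k M) {x : M} (h : ∀ n, M.proj n x ∈ P) :
    x ∈ P := by
  classical
  have e : (DirectSum.coeLinearMap M.gr) (M.components x) = x :=
    M.components.symm_apply_apply x
  rw [← e, DirectSum.coeLinearMap_eq_dfinsuppSum, DFinsupp.sum]
  exact P.sum_mem fun n _ => h n

/-- Independence comes for free from the operators: `P n` kills all the other pieces and is the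
identity on `gr n`. Used to grade subspaces, quotients, direct sums and transported spaces. -/
theorem isInternal_of_proj {A : Type*} [AddCommGroup A] [Module k A] (gr : ℤ → Submodule k A)
    (P : ℤ → A →ₗ[k] A) (h₁ : ∀ n, ∀ x ∈ gr n, P n x = x)
    (h₂ : ∀ m n, m ≠ n → ∀ x ∈ gr m, P n x = 0) (h₃ : ⨆ n, gr n = ⊤) :
    DirectSum.IsInternal gr := by
  rw [DirectSum.isInternal_submodule_iff_iSupIndep_and_iSup_eq_top]
  refine ⟨fun n => ?_, h₃⟩
  rw [Submodule.disjoint_def]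
  intro x hx hx'
  have : ⨆ m, ⨆ (_ : m ≠ n), gr m ≤ LinearMap.ker (P n) :=
    iSup_le fun m => iSup_le fun hm x hx => h₂ m n hm x hx
  rw [← h₁ n x hx]
  exact this hx'

/-- Linear maps homogeneous of degree `q`. -/
def HasDegree (M N : DGSpace k) (q : ℤ) (f : M →ₗ[k] N) : Prop :=
  ∀ n x, x ∈ M.gr n → f x ∈ N.gr (n + q)

theorem hasDegree_zero_iff {M N : DGSpace k} {f : M →ₗ[k] N} :
    HasDegree M N 0 f ↔ ∀ n x, x ∈ M.gr n → f x ∈ N.gr n := by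
  simp [HasDegree]

theorem hasDegree_id (M : DGSpace k) : HasDegree M M 0 LinearMap.id := by simp [HasDegree]

theorem hasDegree_D (M : DGSpace k) : HasDegree M M 1 M.D := M.D_mem

theorem HasDegree.comp {M N P : DGSpace k} {q r s : ℤ} {f : M →ₗ[k] N} {g : N →ₗ[k] P}
    (hg : HasDegree N P r g) (hf : HasDegree M N q f) (h : q + r = s) :
    HasDegree M P s (g ∘ₗ f) := fun n x hx => by
  have := hg _ _ (hf n x hx)
  rwa [add_assoc, h] at this

theorem HasDegree.proj_comp {M N : DGSpace k} {q : ℤ} {f : M →ₗ[k] N} (hf : HasDegree M N q f)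
    (n : ℤ) : N.proj (n + q) ∘ₗ f = f ∘ₗ M.proj n := by
  refine M.hom_ext fun i x hx => ?_
  rcases eq_or_ne i n with rfl | h
  · simp [M.proj_of_mem hx, N.proj_of_mem (hf _ _ hx)]
  · simp [M.proj_of_mem_ne hx h, N.proj_of_mem_ne (hf _ _ hx) (by omega : i + q ≠ n + q)]

/-- The right-hand side is a family of equations between linear maps, so homogeneity can be tested
on pure tensors or on a jointly surjective family, and reflected along injections. -/
theorem hasDegree_iff_proj_comp {M N : DGSpace k} {q : ℤ} {f : M →ₗ[k] N} :
    HasDegree M N q f ↔ ∀ n, N.proj (n + q) ∘ₗ f = f ∘ₗ M.proj n := by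
  refine ⟨fun h n => h.proj_comp n, fun h n x hx => ?_⟩
  have := LinearMap.congr_fun (h n) x
  simp only [LinearMap.comp_apply, M.proj_of_mem hx] at this
  exact N.mem_gr_iff.2 this

theorem HasDegree.mem_of_injective {M N : DGSpace k} {f : M →ₗ[k] N} (hf : HasDegree M N 0 f)
    (hi : Function.Injective f) {n : ℤ} {x : M} (hx : f x ∈ N.gr n) : x ∈ M.gr n := by
  refine M.mem_gr_iff.2 (hi ?_)
  have := LinearMap.congr_fun (hf.proj_comp n) x
  simp only [LinearMap.comp_apply, add_zero, N.proj_of_mem hx] at this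
  exact this.symm

theorem HasDegree.add {M N : DGSpace k} {q : ℤ} {f g : M →ₗ[k] N} (hf : HasDegree M N q f)
    (hg : HasDegree M N q g) : HasDegree M N q (f + g) := fun n x hx =>
  Submodule.add_mem _ (hf n x hx) (hg n x hx)

theorem sgn_apply' (M : DGSpace k) (q : ℤ) {i : ℤ} {x : M} (hx : x ∈ M.gr i) :
    M.sgn q x = koszulSign k (q * i) • x := by
  rw [M.sgn_apply q i x hx, negOnePow_smul_eq (k := k)]

theorem hasDegree_sgn (M : DGSpace k) (q : ℤ) : HasDegree M M 0 (M.sgn q) := fun n x hx => by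
  rw [M.sgn_apply' q hx, add_zero]
  exact Submodule.smul_mem _ _ hx

theorem sgn_congr (M : DGSpace k) {q r : ℤ} (h : (q : ZMod 2) = r) : M.sgn q = M.sgn r :=
  M.hom_ext fun i x hx => by
    rw [M.sgn_apply' q hx, M.sgn_apply' r hx]
    exact koszulSign_smul_congr x (by push_cast; rw [h])

theorem sgn_sgn (M : DGSpace k) (q : ℤ) : M.sgn q ∘ₗ M.sgn q = LinearMap.id :=
  M.hom_ext fun i x hx => by
    simp [M.sgn_apply' q hx, smul_smul, koszulSign_mul_self]

theorem HasDegree.sgn_comp {M N : DGSpace k} {q : ℤ} {f : M →ₗ[k] N} (hf : HasDegree M N q f)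
    (r : ℤ) : N.sgn r ∘ₗ f = koszulSign k (r * q) • (f ∘ₗ M.sgn r) :=
  M.hom_ext fun i x hx => by
    simp only [LinearMap.comp_apply, LinearMap.smul_apply, N.sgn_apply' r (hf i x hx),
      M.sgn_apply' r hx, map_smul, smul_smul, ← koszulSign_add]
    exact koszulSign_smul_congr _ (by push_cast; grind)

theorem HasDegree.sgn_comp_zero {M N : DGSpace k} {f : M →ₗ[k] N} (hf : HasDegree M N 0 f)
    (r : ℤ) : N.sgn r ∘ₗ f = f ∘ₗ M.sgn r := by
  simp [hf.sgn_comp r, koszulSign_zero]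

theorem tmul_mem (M N : DGSpace k) {i j : ℤ} {x : M} {y : N} (hx : x ∈ M.gr i)
    (hy : y ∈ N.gr j) : x ⊗ₜ[k] y ∈ (M.tensor N).gr (i + j) :=
  tmul_mem_tensorGr M N rfl hx hy

theorem sgn_tensor (M N : DGSpace k) (q : ℤ) :
    (M.tensor N).sgn q = TensorProduct.map (M.sgn q) (N.sgn q) := by
  refine tensor_hom_ext M N fun i x hx j y hy => ?_
  rw [(M.tensor N).sgn_apply' q (tmul_mem M N hx hy), TensorProduct.map_tmul, M.sgn_apply' q hx,
    N.sgn_apply' q hy, TensorProduct.smul_tmul_smul, ← koszulSign_add]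
  exact koszulSign_smul_congr _ (by push_cast; grind)

theorem hasDegree_map {M N M' N' : DGSpace k} {q r s : ℤ} {f : M →ₗ[k] M'} {g : N →ₗ[k] N'}
    (hf : HasDegree M M' q f) (hg : HasDegree N N' r g) (h : q + r = s) :
    HasDegree (M.tensor N) (M'.tensor N') s (TensorProduct.map f g) := fun n t ht => by
  revert t
  refine tensorGr_le M N (P := (tensorGr M' N' (n + s)).comap (TensorProduct.map f g))
    fun i j hij x hx y hy => ?_
  exact tmul_mem_tensorGr M' N' (by omega) (hf i x hx) (hg j y hy)

theorem swap_tmul (M N : DGSpace k) {i j : ℤ} {x : M} {y : N} (hx : x ∈ M.gr i)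
    (hy : y ∈ N.gr j) : swap M N (x ⊗ₜ y) = koszulSign k (i * j) • (y ⊗ₜ[k] x) := by
  have h1 := M.components_coe i ⟨x, hx⟩
  have h2 := N.components_coe j ⟨y, hy⟩
  simp only at h1 h2
  have h3 : M.components.symm (DirectSum.lof k ℤ (fun i => M.gr i) i ⟨x, hx⟩) = x := by
    rw [← h1, LinearEquiv.symm_apply_apply]
  have h4 : N.components.symm (DirectSum.lof k ℤ (fun i => N.gr i) j ⟨y, hy⟩) = y := by
    rw [← h2, LinearEquiv.symm_apply_apply]
  rw [← negOnePow_smul_eq, mul_comm i j]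
  simp only [swap, LinearMap.comp_apply, TensorProduct.map_tmul, LinearEquiv.coe_coe, h1, h2,
    TensorProduct.gradedComm_of_tmul_of]
  have e : ((-1 : ℤˣ) ^ (j * i)) • (DirectSum.lof k ℤ (fun i => N.gr i) j ⟨y, hy⟩ ⊗ₜ[k]
      DirectSum.lof k ℤ (fun i => M.gr i) i ⟨x, hx⟩) = koszulSign k (j * i) •
      (DirectSum.lof k ℤ (fun i => N.gr i) j ⟨y, hy⟩ ⊗ₜ[k]
      DirectSum.lof k ℤ (fun i => M.gr i) i ⟨x, hx⟩) := negOnePow_smul_eq _ _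
  rw [e, map_smul, negOnePow_smul_eq (k := k), TensorProduct.map_tmul, LinearEquiv.coe_coe,
    LinearEquiv.coe_coe, h3, h4]

theorem tensor_hom_ext₃ (M N L : DGSpace k) {P : Type*} [AddCommGroup P] [Module k P]
    {f g : (M ⊗[k] N) ⊗[k] L →ₗ[k] P}
    (h : ∀ i, ∀ x ∈ M.gr i, ∀ j, ∀ y ∈ N.gr j, ∀ l, ∀ z ∈ L.gr l,
      f ((x ⊗ₜ y) ⊗ₜ z) = g ((x ⊗ₜ y) ⊗ₜ z)) : f = g :=
  TensorProduct.ext <| tensor_hom_ext M N fun i x hx j y hy => L.hom_ext fun l z hz =>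
    h i x hx j y hy l z hz

theorem tensor_hom_ext₄ (M N M' N' : DGSpace k) {P : Type*} [AddCommGroup P] [Module k P]
    {f g : (M ⊗[k] N) ⊗[k] (M' ⊗[k] N') →ₗ[k] P}
    (h : ∀ i, ∀ x ∈ M.gr i, ∀ j, ∀ y ∈ N.gr j, ∀ i', ∀ x' ∈ M'.gr i', ∀ j', ∀ y' ∈ N'.gr j',
      f ((x ⊗ₜ y) ⊗ₜ (x' ⊗ₜ y')) = g ((x ⊗ₜ y) ⊗ₜ (x' ⊗ₜ y'))) : f = g :=
  TensorProduct.ext <| tensor_hom_ext M N fun i x hx j y hy => tensor_hom_ext M' N'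
    fun i' x' hx' j' y' hy' => h i x hx j y hy i' x' hx' j' y' hy'

theorem tensor_hom_ext₆ (M N L M' N' L' : DGSpace k) {P : Type*} [AddCommGroup P] [Module k P]
    {f g : ((M ⊗[k] N) ⊗[k] L) ⊗[k] ((M' ⊗[k] N') ⊗[k] L') →ₗ[k] P}
    (h : ∀ i, ∀ x ∈ M.gr i, ∀ j, ∀ y ∈ N.gr j, ∀ l, ∀ z ∈ L.gr l,
      ∀ i', ∀ x' ∈ M'.gr i', ∀ j', ∀ y' ∈ N'.gr j', ∀ l', ∀ z' ∈ L'.gr l',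
      f (((x ⊗ₜ y) ⊗ₜ z) ⊗ₜ ((x' ⊗ₜ y') ⊗ₜ z')) = g (((x ⊗ₜ y) ⊗ₜ z) ⊗ₜ ((x' ⊗ₜ y') ⊗ₜ z'))) :
    f = g :=
  TensorProduct.ext <| tensor_hom_ext₃ M N L fun i x hx j y hy l z hz =>
    tensor_hom_ext₃ M' N' L' fun i' x' hx' j' y' hy' l' z' hz' =>
      h i x hx j y hy l z hz i' x' hx' j' y' hy' l' z' hz'

theorem hasDegree_swap (M N : DGSpace k) :
    HasDegree (M.tensor N) (N.tensor M) 0 (swap M N) := fun n t ht => by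
  revert t
  refine tensorGr_le M N (P := (tensorGr N M (n + 0)).comap (swap M N))
    fun i j hij x hx y hy => ?_
  rw [Submodule.mem_comap, swap_tmul M N hx hy]
  exact Submodule.smul_mem _ _ (tmul_mem_tensorGr N M (by omega) hy hx)

theorem swap_comp_map {M N M' N' : DGSpace k} {f : M →ₗ[k] M'} {g : N →ₗ[k] N'}
    (hf : HasDegree M M' 0 f) (hg : HasDegree N N' 0 g) :
    swap M' N' ∘ₗ TensorProduct.map f g = TensorProduct.map g f ∘ₗ swap M N :=
  tensor_hom_ext M N fun i x hx j y hy => by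
    simp only [LinearMap.comp_apply, swap_tmul M N hx hy, map_smul, TensorProduct.map_tmul]
    rw [swap_tmul M' N' (hf i x hx) (hg j y hy), add_zero, add_zero]

/-- The symmetry applied to `f x ⊗ y` has exponent `(i + q) * j`; the surplus `q * j` is what `N.sgn
q` records. -/
theorem swap_comp_map_left {M N M' : DGSpace k} {q : ℤ} {f : M →ₗ[k] M'}
    (hf : HasDegree M M' q f) :
    swap M' N ∘ₗ TensorProduct.map f LinearMap.id =
      TensorProduct.map (N.sgn q) f ∘ₗ swap M N :=
  tensor_hom_ext M N fun i x hx j y hy => by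
    simp only [LinearMap.comp_apply, swap_tmul M N hx hy, map_smul, TensorProduct.map_tmul,
      LinearMap.id_apply, swap_tmul M' N (hf i x hx) hy, N.sgn_apply' q hy, smul_smul,
      ← TensorProduct.smul_tmul', ← koszulSign_add]
    exact koszulSign_smul_congr _ (by push_cast; grind)

/-- The signed interchange `(a ⊗ b) ⊗ (a' ⊗ b') ↦ (-1)^(|b| |a'|) (a ⊗ a') ⊗ (b ⊗ b')`. -/
def interchange₄ (A B A' B' : DGSpace k) :
    (A ⊗[k] B) ⊗[k] (A' ⊗[k] B') →ₗ[k] (A ⊗[k] A') ⊗[k] (B ⊗[k] B') :=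
  (TensorProduct.assoc k A A' (B ⊗[k] B')).symm.toLinearMap ∘ₗ
    TensorProduct.map LinearMap.id
      ((TensorProduct.assoc k A' B B').toLinearMap ∘ₗ
        TensorProduct.map (swap B A') LinearMap.id ∘ₗ
        (TensorProduct.assoc k B A' B').symm.toLinearMap) ∘ₗ
    (TensorProduct.assoc k A B (A' ⊗[k] B')).toLinearMap

theorem interchange_eq (M N : DGSpace k) : interchange M N = interchange₄ M M N N := rfl

theorem interchange₄_tmul (A B A' B' : DGSpace k) {i j : ℤ} (a : A) {b : B} {a' : A'} (b' : B')
    (hb : b ∈ B.gr i) (ha' : a' ∈ A'.gr j) :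
    interchange₄ A B A' B' ((a ⊗ₜ b) ⊗ₜ (a' ⊗ₜ b')) =
      koszulSign k (i * j) • ((a ⊗ₜ[k] a') ⊗ₜ[k] (b ⊗ₜ[k] b')) := by
  simp only [interchange₄, LinearMap.comp_apply, LinearEquiv.coe_coe, TensorProduct.assoc_tmul,
    TensorProduct.map_tmul, TensorProduct.assoc_symm_tmul, swap_tmul B A' hb ha',
    LinearMap.id_apply, ← TensorProduct.smul_tmul', TensorProduct.tmul_smul, map_smul]

theorem hasDegree_interchange₄ (A B A' B' : DGSpace k) :
    HasDegree ((A.tensor B).tensor (A'.tensor B')) ((A.tensor A').tensor (B.tensor B')) 0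
      (interchange₄ A B A' B') := by
  rw [hasDegree_iff_proj_comp]
  intro n
  refine tensor_hom_ext₄ A B A' B' fun i a ha j b hb i' a' ha' j' b' hb' => ?_
  have h1 := tmul_mem (A.tensor B) (A'.tensor B') (tmul_mem A B ha hb) (tmul_mem A' B' ha' hb')
  have h2 := tmul_mem (A.tensor A') (B.tensor B') (tmul_mem A A' ha ha') (tmul_mem B B' hb hb')
  rw [LinearMap.comp_apply, LinearMap.comp_apply, interchange₄_tmul A B A' B' a b' hb ha', map_smul]
  rcases eq_or_ne (i + j + (i' + j')) n with h | h
  · subst h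
    rw [proj_of_mem _ h1, interchange₄_tmul A B A' B' a b' hb ha', proj_of_mem]
    rw [add_zero, add_add_add_comm]
    exact h2
  · rw [proj_of_mem_ne _ h1 h, proj_of_mem_ne _ h2 (by omega), map_zero, smul_zero]

theorem interchange₄_comp_map {A B A' B' A₁ B₁ A₁' B₁' : DGSpace k} (f : A →ₗ[k] A₁)
    {g : B →ₗ[k] B₁} {f' : A' →ₗ[k] A₁'} (g' : B' →ₗ[k] B₁') (hg : HasDegree B B₁ 0 g)
    (hf' : HasDegree A' A₁' 0 f') :
    interchange₄ A₁ B₁ A₁' B₁' ∘ₗ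
        TensorProduct.map (TensorProduct.map f g) (TensorProduct.map f' g') =
      TensorProduct.map (TensorProduct.map f f') (TensorProduct.map g g') ∘ₗ
        interchange₄ A B A' B' := by
  refine tensor_hom_ext₄ A B A' B' fun i a ha j b hb i' a' ha' j' b' hb' => ?_
  simp only [LinearMap.comp_apply, TensorProduct.map_tmul, interchange₄_tmul A B A' B' a b' hb ha',
    map_smul]
  rw [interchange₄_tmul A₁ B₁ A₁' B₁' _ _ (hg _ _ hb) (hf' _ _ ha'), add_zero, add_zero]

/-- Moving operators out of the left half of an interchange. -/
theorem map_left_comp_interchange₄ {A B A' B' A₁ A₁' : DGSpace k} {q : ℤ} (f : A →ₗ[k] A₁)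
    {f' : A' →ₗ[k] A₁'} (hf' : HasDegree A' A₁' q f') :
    TensorProduct.map (TensorProduct.map f f') LinearMap.id ∘ₗ interchange₄ A B A' B' =
      interchange₄ A₁ B A₁' B' ∘ₗ TensorProduct.map (TensorProduct.map f (B.sgn q))
        (TensorProduct.map f' LinearMap.id) := by
  refine tensor_hom_ext₄ A B A' B' fun i a ha j b hb i' a' ha' j' b' hb' => ?_
  simp only [LinearMap.comp_apply, TensorProduct.map_tmul, interchange₄_tmul A B A' B' a b' hb ha',
    map_smul, LinearMap.id_apply, B.sgn_apply' q hb, TensorProduct.tmul_smul,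
    ← TensorProduct.smul_tmul',
    interchange₄_tmul A₁ B A₁' B' _ _ hb (hf' _ _ ha'), smul_smul, ← koszulSign_add]
  congr 1
  exact koszulSign_congr (by push_cast; grind)

/-- Moving operators out of the right half of an interchange. -/
theorem map_right_comp_interchange₄ {A B A' B' B₁ B₁' : DGSpace k} {q r : ℤ}
    {f : B →ₗ[k] B₁} (f' : B' →ₗ[k] B₁') (hf : HasDegree B B₁ q f) :
    TensorProduct.map ((A.tensor A').sgn r) (TensorProduct.map f f') ∘ₗ interchange₄ A B A' B' =
      interchange₄ A B₁ A' B₁' ∘ₗ TensorProduct.map (TensorProduct.map (A.sgn r) f)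
        (TensorProduct.map (A'.sgn (r - q)) f') := by
  refine tensor_hom_ext₄ A B A' B' fun i a ha j b hb i' a' ha' j' b' hb' => ?_
  simp only [LinearMap.comp_apply, TensorProduct.map_tmul, interchange₄_tmul A B A' B' a b' hb ha',
    map_smul, sgn_tensor, A.sgn_apply' r ha, A'.sgn_apply' _ ha', TensorProduct.tmul_smul,
    ← TensorProduct.smul_tmul',
    interchange₄_tmul A B₁ A' B₁' _ _ (hf _ _ hb) ha', smul_smul, ← koszulSign_add]
  exact koszulSign_smul_congr _ (by push_cast; grind)

theorem swap_comp_interchange₄ (A B A' B' : DGSpace k) :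
    swap (A.tensor A') (B.tensor B') ∘ₗ interchange₄ A B A' B' =
      interchange₄ B A B' A' ∘ₗ TensorProduct.map (swap A B) (swap A' B') := by
  refine tensor_hom_ext₄ A B A' B' fun i a ha j b hb i' a' ha' j' b' hb' => ?_
  simp only [LinearMap.comp_apply, TensorProduct.map_tmul, interchange₄_tmul A B A' B' a b' hb ha',
    map_smul, swap_tmul A B ha hb, swap_tmul A' B' ha' hb', TensorProduct.tmul_smul,
    ← TensorProduct.smul_tmul', interchange₄_tmul B A B' A' _ _ ha hb',
    swap_tmul (A.tensor A') (B.tensor B') (tmul_mem _ _ ha ha') (tmul_mem _ _ hb hb'),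
    smul_smul, ← koszulSign_add]
  exact koszulSign_smul_congr _ (by push_cast; grind)

theorem interchange₄_comp_D (A B A' B' : DGSpace k) :
    ((A.tensor A').tensor (B.tensor B')).D ∘ₗ interchange₄ A B A' B' =
      interchange₄ A B A' B' ∘ₗ ((A.tensor B).tensor (A'.tensor B')).D := by
  refine tensor_hom_ext₄ A B A' B' fun i a ha j b hb i' a' ha' j' b' hb' => ?_
  simp only [LinearMap.comp_apply, TensorProduct.map_tmul, interchange₄_tmul A B A' B' a b' hb ha',
    map_smul, LinearMap.add_apply, sgn_tensor, A.sgn_apply' _ ha, A'.sgn_apply' _ ha',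
    B.sgn_apply' _ hb, LinearMap.id_apply,
    TensorProduct.tmul_smul, TensorProduct.tmul_add, TensorProduct.add_tmul, map_add,
    ← TensorProduct.smul_tmul', interchange₄_tmul A B A' B' _ _ (B.D_mem _ _ hb) ha',
    interchange₄_tmul A B A' B' _ _ hb ha', interchange₄_tmul A B A' B' _ _ hb (A'.D_mem _ _ ha'),
    smul_smul, ← koszulSign_add, smul_add]
  -- Each side has four summands, one for each factor hit by the differential. The signs for `a`
  -- agree already; the three rewrites treat `a'`, `b` and `b'`.
  rw [koszulSign_congr (k := k) (m := j * i' + 1 * i) (n := 1 * j + 1 * i + j * (i' + 1))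
      (by push_cast; grind),
    koszulSign_congr (k := k) (m := j * i' + (1 * i' + 1 * i)) (n := 1 * i + (j + 1) * i')
      (by push_cast; grind),
    koszulSign_congr (k := k) (m := j * i' + (1 * j + (1 * i' + 1 * i)))
      (n := 1 * i' + (1 * j + 1 * i) + j * i') (by push_cast; grind)]
  abel

end DGSpace

/-! ### Naturality of the operations and the axioms at a single element -/

namespace DCoalgebraOps

variable {k : Type u} [Field k] {d : ℤ}

namespace IsGradedHom

variable {C E G : DCoalgebraOps k d} {f : C →ₗ[k] E}

theorem hasDegree (h : C.IsGradedHom E f) : DGSpace.HasDegree C.toDGSpace E.toDGSpace 0 f :=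
  DGSpace.hasDegree_zero_iff.2 h.map_mem

theorem counit_comp (h : C.IsGradedHom E f) : E.counit ∘ₗ f = C.counit :=
  LinearMap.ext h.map_counit

theorem comul_comp (h : C.IsGradedHom E f) :
    E.comul ∘ₗ f = TensorProduct.map f f ∘ₗ C.comul :=
  LinearMap.ext h.map_comul

theorem cobracket_comp (h : C.IsGradedHom E f) :
    E.cobracket ∘ₗ f = TensorProduct.map f f ∘ₗ C.cobracket :=
  LinearMap.ext h.map_cobracket

theorem id (C : DCoalgebraOps k d) : C.IsGradedHom C LinearMap.id :=
  ⟨fun _ _ h => h, fun _ => rfl, fun _ => by simp, fun _ => by simp⟩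

theorem comp {g : E →ₗ[k] G} (hg : E.IsGradedHom G g) (hf : C.IsGradedHom E f) :
    C.IsGradedHom G (g ∘ₗ f) :=
  ⟨fun n x hx => hg.map_mem n _ (hf.map_mem n x hx),
   fun x => by simp [hg.map_counit, hf.map_counit],
   fun x => by simp [hg.map_comul, hf.map_comul, TensorProduct.map_map],
   fun x => by simp [hg.map_cobracket, hf.map_cobracket, TensorProduct.map_map]⟩

theorem swap_nat (h : C.IsGradedHom E f) (t : C ⊗[k] C) :
    DGSpace.swap E.toDGSpace E.toDGSpace (TensorProduct.map f f t) =
      TensorProduct.map f f (DGSpace.swap C.toDGSpace C.toDGSpace t) :=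
  LinearMap.congr_fun (DGSpace.swap_comp_map h.hasDegree h.hasDegree) t

theorem hasDegree_map (h : C.IsGradedHom E f) :
    DGSpace.HasDegree (C.toDGSpace.tensor C.toDGSpace) (E.toDGSpace.tensor E.toDGSpace) 0
      (TensorProduct.map f f) :=
  DGSpace.hasDegree_map h.hasDegree h.hasDegree (by simp)

theorem cyc_nat (h : C.IsGradedHom E f) (t : (C ⊗[k] C) ⊗[k] C) :
    E.cyc (TensorProduct.map (TensorProduct.map f f) f t) =
      TensorProduct.map (TensorProduct.map f f) f (C.cyc t) := by
  have := LinearMap.congr_fun (DGSpace.swap_comp_map h.hasDegree_map h.hasDegree) t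
  simp only [LinearMap.comp_apply] at this
  simp only [DGSpace.cyc, LinearMap.comp_apply, LinearEquiv.coe_coe, this]
  exact LinearMap.congr_fun (TensorProduct.map_map_comp_assoc_symm_eq f f f).symm _

theorem assoc_nat (f : C →ₗ[k] E) (t : (C ⊗[k] C) ⊗[k] C) :
    TensorProduct.assoc k E E E (TensorProduct.map (TensorProduct.map f f) f t) =
      TensorProduct.map f (TensorProduct.map f f) (TensorProduct.assoc k C C C t) :=
  LinearMap.congr_fun (TensorProduct.map_map_comp_assoc_eq f f f).symm _

theorem comul_id_nat (h : C.IsGradedHom E f) (t : C ⊗[k] C) :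
    TensorProduct.map E.comul LinearMap.id (TensorProduct.map f f t) =
      TensorProduct.map (TensorProduct.map f f) f (TensorProduct.map C.comul LinearMap.id t) := by
  rw [TensorProduct.map_map, TensorProduct.map_map, h.comul_comp]; rfl

theorem cobracket_id_nat (h : C.IsGradedHom E f) (t : C ⊗[k] C) :
    TensorProduct.map E.cobracket LinearMap.id (TensorProduct.map f f t) =
      TensorProduct.map (TensorProduct.map f f) f
        (TensorProduct.map C.cobracket LinearMap.id t) := by
  rw [TensorProduct.map_map, TensorProduct.map_map, h.cobracket_comp]; rfl

theorem id_comul_nat (h : C.IsGradedHom E f) (t : C ⊗[k] C) :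
    TensorProduct.map LinearMap.id E.comul (TensorProduct.map f f t) =
      TensorProduct.map f (TensorProduct.map f f) (TensorProduct.map LinearMap.id C.comul t) := by
  rw [TensorProduct.map_map, TensorProduct.map_map, h.comul_comp]; rfl

theorem sgn_cobracket_nat (h : C.IsGradedHom E f) (q : ℤ) (t : C ⊗[k] C) :
    TensorProduct.map (E.sgn q) E.cobracket (TensorProduct.map f f t) =
      TensorProduct.map f (TensorProduct.map f f)
        (TensorProduct.map (C.sgn q) C.cobracket t) := by
  rw [TensorProduct.map_map, TensorProduct.map_map, h.cobracket_comp, h.hasDegree.sgn_comp_zero]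

theorem id_swap_nat (h : C.IsGradedHom E f) (t : C ⊗[k] (C ⊗[k] C)) :
    TensorProduct.map LinearMap.id (DGSpace.swap E.toDGSpace E.toDGSpace)
        (TensorProduct.map f (TensorProduct.map f f) t) =
      TensorProduct.map f (TensorProduct.map f f)
        (TensorProduct.map LinearMap.id (DGSpace.swap C.toDGSpace C.toDGSpace) t) := by
  rw [TensorProduct.map_map, TensorProduct.map_map,
    DGSpace.swap_comp_map h.hasDegree h.hasDegree]; rfl

theorem counit_id_nat (h : C.IsGradedHom E f) (t : C ⊗[k] C) :
    TensorProduct.map E.counit LinearMap.id (TensorProduct.map f f t) =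
      TensorProduct.map LinearMap.id f (TensorProduct.map C.counit LinearMap.id t) := by
  rw [TensorProduct.map_map, TensorProduct.map_map, h.counit_comp]; rfl

theorem lid_nat (f : C →ₗ[k] E) (t : k ⊗[k] C) :
    TensorProduct.lid k E (TensorProduct.map LinearMap.id f t) =
      f (TensorProduct.lid k C t) := by
  induction t with
  | zero => simp
  | tmul a x => simp
  | add a b ha hb => simp only [map_add, ha, hb]

end IsGradedHom

namespace IsHom

variable {C E G : DCoalgebraOps k d} {f : C →ₗ[k] E}

theorem id (C : DCoalgebraOps k d) : C.IsHom C LinearMap.id :=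
  ⟨IsGradedHom.id C, fun _ => rfl⟩

theorem comp {g : E →ₗ[k] G} (hg : E.IsHom G g) (hf : C.IsHom E f) : C.IsHom G (g ∘ₗ f) :=
  ⟨hg.toIsGradedHom.comp hf.toIsGradedHom, fun x => by simp [hg.map_D, hf.map_D]⟩

theorem tensor_D_nat (h : C.IsHom E f) (t : C ⊗[k] C) :
    (E.toDGSpace.tensor E.toDGSpace).D (TensorProduct.map f f t) =
      TensorProduct.map f f ((C.toDGSpace.tensor C.toDGSpace).D t) := by
  have e : E.D ∘ₗ f = f ∘ₗ C.D := LinearMap.ext fun x => (h.map_D x).symm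
  simp only [LinearMap.add_apply, map_add, TensorProduct.map_map, e,
    h.hasDegree.sgn_comp_zero, LinearMap.id_comp, LinearMap.comp_id]

end IsHom

/-- The axioms of a `d`-coalgebra in terms of elements `x`: those equations which are preserved by
homomorphisms and reflected by injective ones. -/
structure AxiomsAt (C : DCoalgebraOps k d) (x : C) : Prop where
  comul_proj : ∀ n, (C.toDGSpace.tensor C.toDGSpace).proj n (C.comul x) = C.comul (C.proj n x)
  cobracket_proj : ∀ n, (C.toDGSpace.tensor C.toDGSpace).proj (n + (1 - d)) (C.cobracket x) =
    C.cobracket (C.proj n x)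
  counit_proj : ∀ n, n ≠ 0 → C.counit (C.proj n x) = 0
  comul_D : C.comul (C.D x) = (C.toDGSpace.tensor C.toDGSpace).D (C.comul x)
  counit_D : C.counit (C.D x) = 0
  cobracket_D : C.cobracket (C.D x) =
    koszulSign k (d - 1) • (C.toDGSpace.tensor C.toDGSpace).D (C.cobracket x)
  coassoc : TensorProduct.assoc k C C C (TensorProduct.map C.comul LinearMap.id (C.comul x)) =
    TensorProduct.map LinearMap.id C.comul (C.comul x)
  cocomm : DGSpace.swap C.toDGSpace C.toDGSpace (C.comul x) = C.comul x
  counit_comul : TensorProduct.lid k C (TensorProduct.map C.counit LinearMap.id (C.comul x)) = x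
  cobracket_swap : DGSpace.swap C.toDGSpace C.toDGSpace (C.cobracket x) =
    koszulSign k d • C.cobracket x
  cojacobi : TensorProduct.map C.cobracket LinearMap.id (C.cobracket x) +
    C.cyc (TensorProduct.map C.cobracket LinearMap.id (C.cobracket x)) +
    C.cyc (C.cyc (TensorProduct.map C.cobracket LinearMap.id (C.cobracket x))) = 0
  coleibniz : TensorProduct.assoc k C C C
      (TensorProduct.map C.comul LinearMap.id (C.cobracket x)) =
    TensorProduct.map (C.sgn (1 - d)) C.cobracket (C.comul x) +
      TensorProduct.map LinearMap.id (DGSpace.swap C.toDGSpace C.toDGSpace)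
        (TensorProduct.assoc k C C C (TensorProduct.map C.cobracket LinearMap.id (C.comul x)))
  counit_cobracket : TensorProduct.map C.counit LinearMap.id (C.cobracket x) = (0 : k ⊗[k] C)

/-- Degree conditions are expressed as commutation with the projections, so that every axiom becomes
a linear equation at an arbitrary, possibly inhomogeneous, element. -/
theorem isDCoalgebra_iff {C : DCoalgebraOps k d} :
    C.IsDCoalgebra ↔ ∀ x, C.AxiomsAt x := by
  constructor
  · intro h x
    refine ⟨fun n => ?_, fun n => ?_, fun n hn => h.counit_eq_zero n _ hn (C.proj_mem n x),
      h.comul_D x, h.counit_D x, ?_, LinearMap.congr_fun h.coassoc x,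
      LinearMap.congr_fun h.cocomm x, LinearMap.congr_fun h.counit_comul x, ?_,
      LinearMap.congr_fun h.cojacobi x, LinearMap.congr_fun h.coleibniz x,
      LinearMap.congr_fun h.counit_cobracket x⟩
    · have h0 : DGSpace.HasDegree C.toDGSpace (C.toDGSpace.tensor C.toDGSpace) 0 C.comul :=
        DGSpace.hasDegree_zero_iff.2 h.comul_mem
      simpa using LinearMap.congr_fun (h0.proj_comp n) x
    · have h0 : DGSpace.HasDegree C.toDGSpace (C.toDGSpace.tensor C.toDGSpace) (1 - d) C.cobracket :=
        h.cobracket_mem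
      exact LinearMap.congr_fun (h0.proj_comp n) x
    · rw [h.cobracket_D, negOnePow_smul_eq (k := k)]
    · rw [← negOnePow_smul_eq (k := k)]
      exact LinearMap.congr_fun h.cobracket_swap x
  · intro h
    refine ⟨?_, fun n x hn hx => ?_, ?_, fun x => (h x).comul_D, fun x => (h x).counit_D,
      fun x => ?_, LinearMap.ext fun x => (h x).coassoc, LinearMap.ext fun x => (h x).cocomm,
      LinearMap.ext fun x => (h x).counit_comul, LinearMap.ext fun x => ?_,
      LinearMap.ext fun x => (h x).cojacobi, LinearMap.ext fun x => (h x).coleibniz,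
      LinearMap.ext fun x => (h x).counit_cobracket⟩
    · refine (DGSpace.hasDegree_zero_iff (M := C.toDGSpace) (N := C.toDGSpace.tensor C.toDGSpace)).1
        (DGSpace.hasDegree_iff_proj_comp.2 fun n => LinearMap.ext fun x => ?_)
      rw [add_zero]
      exact (h x).comul_proj n
    · rw [← C.proj_of_mem hx]
      exact (h x).counit_proj n hn
    · exact (DGSpace.hasDegree_iff_proj_comp (M := C.toDGSpace) (N := C.toDGSpace.tensor C.toDGSpace)).2
        fun n => LinearMap.ext fun x => (h x).cobracket_proj n
    · rw [(h x).cobracket_D, negOnePow_smul_eq (k := k)]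
    · rw [LinearMap.smul_apply, negOnePow_smul_eq (k := k)]
      exact (h x).cobracket_swap

theorem IsGradedHom.proj_nat {C E : DCoalgebraOps k d} {f : C →ₗ[k] E} (h : C.IsGradedHom E f)
    (n : ℤ) (x : C) : E.proj n (f x) = f (C.proj n x) := by
  simpa using LinearMap.congr_fun (h.hasDegree.proj_comp n) x

theorem IsGradedHom.tensor_proj_nat {C E : DCoalgebraOps k d} {f : C →ₗ[k] E}
    (h : C.IsGradedHom E f) (n : ℤ) (t : C ⊗[k] C) :
    (E.toDGSpace.tensor E.toDGSpace).proj n (TensorProduct.map f f t) =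
      TensorProduct.map f f ((C.toDGSpace.tensor C.toDGSpace).proj n t) := by
  simpa using LinearMap.congr_fun (h.hasDegree_map.proj_comp n) t

/-- Both sides of each axiom are natural for morphisms, so the equation at `f x` is the image of the
equation at `x` under tensor powers of `f`. -/
theorem AxiomsAt.map {C E : DCoalgebraOps k d} {f : C →ₗ[k] E} (h : C.IsHom E f) {x : C}
    (a : C.AxiomsAt x) : E.AxiomsAt (f x) where
  comul_proj n := by
    rw [h.map_comul, h.tensor_proj_nat, a.comul_proj, h.proj_nat, h.map_comul]
  cobracket_proj n := by
    rw [h.map_cobracket, h.tensor_proj_nat, a.cobracket_proj, h.proj_nat, h.map_cobracket]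
  counit_proj n hn := by rw [h.proj_nat, h.map_counit, a.counit_proj n hn]
  comul_D := by rw [← h.map_D, h.map_comul, h.map_comul, a.comul_D, h.tensor_D_nat]
  counit_D := by rw [← h.map_D, h.map_counit, a.counit_D]
  cobracket_D := by
    rw [← h.map_D, h.map_cobracket, h.map_cobracket, a.cobracket_D, h.tensor_D_nat, map_smul]
  coassoc := by
    rw [h.map_comul, h.comul_id_nat, IsGradedHom.assoc_nat, a.coassoc, h.id_comul_nat]
  cocomm := by rw [h.map_comul, h.swap_nat, a.cocomm]
  counit_comul := by rw [h.map_comul, h.counit_id_nat, IsGradedHom.lid_nat, a.counit_comul]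
  cobracket_swap := by rw [h.map_cobracket, h.swap_nat, a.cobracket_swap, map_smul]
  cojacobi := by
    rw [h.map_cobracket, h.cobracket_id_nat, h.cyc_nat, h.cyc_nat, ← map_add, ← map_add,
      a.cojacobi, map_zero]
  coleibniz := by
    rw [h.map_comul, h.map_cobracket, h.comul_id_nat, IsGradedHom.assoc_nat, a.coleibniz,
      h.cobracket_id_nat, IsGradedHom.assoc_nat, h.id_swap_nat, h.sgn_cobracket_nat, map_add]
  counit_cobracket := by rw [h.map_cobracket, h.counit_id_nat, a.counit_cobracket, map_zero]

/-- Over a field the tensor powers of an injective map are injective, so each equation at `x` may be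
tested after applying them. -/
theorem AxiomsAt.of_injective {C E : DCoalgebraOps k d} {f : C →ₗ[k] E} (h : C.IsHom E f)
    (hf : Function.Injective f) {x : C} (a : E.AxiomsAt (f x)) : C.AxiomsAt x := by
  have hf₂ : Function.Injective (TensorProduct.map f f) :=
    TensorProduct.map_injective_of_flat_flat f f hf hf
  have hf₃ : Function.Injective (TensorProduct.map (TensorProduct.map f f) f) :=
    TensorProduct.map_injective_of_flat_flat _ f hf₂ hf
  have hf₃' : Function.Injective (TensorProduct.map f (TensorProduct.map f f)) :=
    TensorProduct.map_injective_of_flat_flat f _ hf hf₂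
  have hf₁ : Function.Injective (TensorProduct.map (LinearMap.id : k →ₗ[k] k) f) :=
    TensorProduct.map_injective_of_flat_flat _ f (fun _ _ h => h) hf
  refine ⟨fun n => hf₂ ?_, fun n => hf₂ ?_, fun n hn => ?_, hf₂ ?_, ?_, hf₂ ?_, hf₃' ?_, hf₂ ?_,
    hf ?_, hf₂ ?_, hf₃ ?_, hf₃' ?_, hf₁ ?_⟩
  · rw [← h.tensor_proj_nat, ← h.map_comul, ← h.map_comul, a.comul_proj, h.proj_nat]
  · rw [← h.tensor_proj_nat, ← h.map_cobracket, ← h.map_cobracket, a.cobracket_proj, h.proj_nat]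
  · rw [← h.map_counit, ← h.proj_nat, a.counit_proj n hn]
  · rw [← h.map_comul, ← h.tensor_D_nat, ← h.map_comul, h.map_D, a.comul_D]
  · rw [← h.map_counit, h.map_D, a.counit_D]
  · rw [← h.map_cobracket, map_smul, ← h.tensor_D_nat, ← h.map_cobracket, h.map_D, a.cobracket_D]
  · rw [← IsGradedHom.assoc_nat, ← h.comul_id_nat, ← h.id_comul_nat, ← h.map_comul, a.coassoc]
  · rw [← h.swap_nat, ← h.map_comul, a.cocomm]
  · rw [← IsGradedHom.lid_nat, ← h.counit_id_nat, ← h.map_comul, a.counit_comul]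
  · rw [← h.swap_nat, ← h.map_cobracket, a.cobracket_swap, map_smul, ← h.map_cobracket]
  · rw [map_add, map_add, ← h.cyc_nat, ← h.cyc_nat, ← h.cyc_nat, ← h.cobracket_id_nat, ← h.map_cobracket,
      a.cojacobi, map_zero]
  · rw [map_add, ← IsGradedHom.assoc_nat, ← h.comul_id_nat, ← h.map_cobracket, a.coleibniz,
      ← h.id_swap_nat, ← IsGradedHom.assoc_nat, ← h.cobracket_id_nat, ← h.sgn_cobracket_nat,
      ← h.map_comul]
  · rw [← h.counit_id_nat, ← h.map_cobracket, a.counit_cobracket, map_zero]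

/-- The elements at which the axioms of a `d`-coalgebra hold form a subspace. -/
def axiomsSubmodule (C : DCoalgebraOps k d) : Submodule k C where
  carrier := {x | C.AxiomsAt x}
  zero_mem' := by constructor <;> simp
  add_mem' {x y} a b := by
    constructor
    · intro n; simp only [map_add, a.comul_proj, b.comul_proj]
    · intro n; simp only [map_add, a.cobracket_proj, b.cobracket_proj]
    · intro n hn; simp only [map_add, a.counit_proj n hn, b.counit_proj n hn, add_zero]
    · rw [map_add, map_add, map_add, map_add, a.comul_D, b.comul_D]
    · simp only [map_add, a.counit_D, b.counit_D, add_zero]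
    · rw [map_add, map_add, map_add, map_add, a.cobracket_D, b.cobracket_D, smul_add]
    · simp only [map_add, a.coassoc, b.coassoc]
    · simp only [map_add, a.cocomm, b.cocomm]
    · simp only [map_add, a.counit_comul, b.counit_comul]
    · simp only [map_add, a.cobracket_swap, b.cobracket_swap, smul_add]
    · have := congrArg₂ (· + ·) a.cojacobi b.cojacobi
      simp only [add_zero] at this
      rw [← this]
      simp only [map_add]
      abel
    · simp only [map_add, a.coleibniz, b.coleibniz]
      abel
    · simp only [map_add, a.counit_cobracket, b.counit_cobracket, add_zero]
  smul_mem' c x a := by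
    constructor
    · intro n; simp only [map_smul, a.comul_proj]
    · intro n; simp only [map_smul, a.cobracket_proj]
    · intro n hn; simp only [map_smul, a.counit_proj n hn, smul_zero]
    · rw [map_smul, map_smul, map_smul, map_smul, a.comul_D]
    · simp only [map_smul, a.counit_D, smul_zero]
    · rw [map_smul, map_smul, map_smul, map_smul, a.cobracket_D, smul_comm]
    · simp only [map_smul, a.coassoc]
    · simp only [map_smul, a.cocomm]
    · simp only [map_smul, a.counit_comul]
    · simp only [map_smul, a.cobracket_swap, smul_comm c]
    · simp only [map_smul, ← smul_add, a.cojacobi, smul_zero]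
    · simp only [map_smul, a.coleibniz, smul_add]
    · simp only [map_smul, a.counit_cobracket, smul_zero]

/-- The subspace `axiomsSubmodule` contains the range of every `g i`, hence is everything. -/
theorem isDCoalgebra_of_jointly_surjective {ι : Type*} {S : ι → DCoalgebraOps k d}
    {C : DCoalgebraOps k d} {g : ∀ i, S i →ₗ[k] C} (hS : ∀ i, (S i).IsDCoalgebra)
    (hg : ∀ i, (S i).IsHom C (g i)) (hs : ⨆ i, LinearMap.range (g i) = ⊤) : C.IsDCoalgebra := by
  rw [isDCoalgebra_iff]
  have : ⨆ i, LinearMap.range (g i) ≤ C.axiomsSubmodule := by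
    refine iSup_le fun i => ?_
    rintro _ ⟨x, rfl⟩
    exact (isDCoalgebra_iff.1 (hS i) x).map (hg i)
  exact fun x => this (x := x) (hs ▸ Submodule.mem_top)

theorem isDCoalgebra_of_injective {C E : DCoalgebraOps k d} {f : C →ₗ[k] E} (h : C.IsHom E f)
    (hf : Function.Injective f) (hE : E.IsDCoalgebra) : C.IsDCoalgebra :=
  isDCoalgebra_iff.2 fun _ => (isDCoalgebra_iff.1 hE _).of_injective h hf

end DCoalgebraOps

/-! ### Homogeneous subspaces, their tensor squares, and coproartinian filtrations -/

namespace DGSpace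

variable {k : Type u} [Field k]

theorem proj_mem_of_homogeneous (M : DGSpace k) {F : Submodule k M}
    (h : F ≤ ⨆ n, F ⊓ M.gr n) (n : ℤ) {x : M} (hx : x ∈ F) : M.proj n x ∈ F := by
  have : ⨆ n, F ⊓ M.gr n ≤ F.comap (M.proj n) := by
    refine iSup_le fun m y hy => ?_
    rcases eq_or_ne m n with rfl | hmn
    · rw [Submodule.mem_comap, M.proj_of_mem hy.2]
      exact hy.1
    · rw [Submodule.mem_comap, M.proj_of_mem_ne hy.2 hmn]
      exact F.zero_mem
  exact this (h hx)

theorem homogeneous_of_proj_mem (M : DGSpace k) {F : Submodule k M}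
    (h : ∀ n, ∀ x ∈ F, M.proj n x ∈ F) : F ≤ ⨆ n, F ⊓ M.gr n := fun x hx =>
  M.mem_of_proj_mem _ fun n =>
    (le_iSup (fun n => F ⊓ M.gr n) n) ⟨h n x hx, M.proj_mem n x⟩

end DGSpace

namespace DCoalgebraOps

variable {k : Type u} [Field k] {d : ℤ}

section Square

variable (C : DCoalgebraOps k d)

theorem tmul_mem_square {F : Submodule k C} {x y : C} (hx : x ∈ F) (hy : y ∈ F) :
    x ⊗ₜ[k] y ∈ C.square F :=
  ⟨⟨x, hx⟩ ⊗ₜ ⟨y, hy⟩, by simp⟩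

theorem square_le {F : Submodule k C} {P : Submodule k (C ⊗[k] C)}
    (h : ∀ x ∈ F, ∀ y ∈ F, x ⊗ₜ[k] y ∈ P) : C.square F ≤ P := by
  rintro _ ⟨t, rfl⟩
  induction t with
  | zero => simp
  | tmul x y => exact h x x.2 y y.2
  | add a b ha hb => rw [map_add]; exact P.add_mem ha hb

theorem square_mono {F G : Submodule k C} (h : F ≤ G) : C.square F ≤ C.square G :=
  C.square_le fun _ hx _ hy => C.tmul_mem_square (h hx) (h hy)

theorem map_mem_square {E : DCoalgebraOps k d} (f : C →ₗ[k] E) {F : Submodule k C}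
    {G : Submodule k E} (h : ∀ x ∈ F, f x ∈ G) {t : C ⊗[k] C} (ht : t ∈ C.square F) :
    TensorProduct.map f f t ∈ E.square G := by
  have : C.square F ≤ (E.square G).comap (TensorProduct.map f f) :=
    C.square_le fun x hx y hy => E.tmul_mem_square (h x hx) (h y hy)
  exact this ht

theorem exists_of_mem_square_span {e : C} {t : C ⊗[k] C}
    (ht : t ∈ C.square (Submodule.span k {e})) : ∃ c : k, t = c • (e ⊗ₜ[k] e) := by
  have : C.square (Submodule.span k {e}) ≤ Submodule.span k {e ⊗ₜ[k] e} := by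
    refine C.square_le fun x hx y hy => ?_
    obtain ⟨a, rfl⟩ := Submodule.mem_span_singleton.1 hx
    obtain ⟨b, rfl⟩ := Submodule.mem_span_singleton.1 hy
    rw [TensorProduct.smul_tmul_smul]
    exact Submodule.smul_mem _ _ (Submodule.mem_span_singleton_self _)
  obtain ⟨c, hc⟩ := Submodule.mem_span_singleton.1 (this ht)
  exact ⟨c, hc.symm⟩

/-- Choose a projection `p` onto `F` whose kernel contains a complement of `F ∩ G` in `G`. Then `p ⊗
p` fixes `F ⊗ F` pointwise and sends `G ⊗ G` into `(F ∩ G) ⊗ (F ∩ G)`. -/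
theorem square_inf_square_le (F G : Submodule k C) :
    C.square F ⊓ C.square G ≤ C.square (F ⊓ G) := by
  obtain ⟨G', hG⟩ := Submodule.exists_isCompl (Submodule.comap G.subtype F)
  have hd : Disjoint (G'.map G.subtype) F := by
    rw [Submodule.disjoint_def]
    rintro _ ⟨y, hy, rfl⟩ hF
    have := (Submodule.disjoint_def.1 hG.disjoint) y hF hy
    simp [this]
  obtain ⟨Q, hQ, hc⟩ := hd.exists_isCompl
  let p : C →ₗ[k] C := F.subtype ∘ₗ F.projectionOnto Q hc.symm
  have hp₁ : ∀ x ∈ F, p x = x := fun x hx => by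
    exact congrArg Subtype.val (Submodule.projectionOnto_apply_left hc.symm ⟨x, hx⟩)
  have hp₂ : ∀ x ∈ G, p x ∈ F ⊓ G := fun x hx => by
    have h1 : (⟨x, hx⟩ : G) ∈ Submodule.comap G.subtype F ⊔ G' := by
      rw [hG.sup_eq_top]; trivial
    obtain ⟨a, ha, b, hb, hab⟩ := Submodule.mem_sup.1 h1
    have hb' : p b = 0 := by
      have : (b : C) ∈ Q := hQ ⟨b, hb, rfl⟩
      simp [p, Submodule.projectionOnto_apply_of_mem_right hc.symm this]
    have hx' : x = (a : C) + b := by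
      simpa using (congrArg Subtype.val hab).symm
    rw [hx', map_add, hb', add_zero, hp₁ (a : C) ha]
    exact ⟨ha, a.2⟩
  rintro t ⟨ht, ht'⟩
  have h1 : C.square F ≤ LinearMap.eqLocus (TensorProduct.map p p) LinearMap.id :=
    C.square_le fun x hx y hy => by simp [LinearMap.mem_eqLocus, hp₁ x hx, hp₁ y hy]
  have h2 : TensorProduct.map p p t = t := h1 ht
  rw [← h2]
  exact C.map_mem_square p hp₂ ht'

/-- The operator `x ↦ Δ x - e ⊗ x - x ⊗ e`. -/
def reducedComul (e : C) : C →ₗ[k] C ⊗[k] C :=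
  C.comul - TensorProduct.mk k C C e - (TensorProduct.mk k C C).flip e

theorem reducedComul_apply (e x : C) :
    C.reducedComul e x = C.comul x - e ⊗ₜ x - x ⊗ₜ e := rfl

end Square

variable {C : DCoalgebraOps k d}

theorem IsGrouplike.map {E : DCoalgebraOps k d} {f : C →ₗ[k] E} (h : C.IsGradedHom E f) {e : C}
    (he : C.IsGrouplike e) : E.IsGrouplike (f e) :=
  ⟨by rw [h.map_comul, he.1, TensorProduct.map_tmul], by rw [h.map_counit, he.2]⟩

/-- A uniform criterion without special clauses at level one. There the reduced coproduct and the
cobracket are multiples `c • (e ⊗ e)`, and the counit axioms force `c = 0` (for the coproduct, on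
elements of counit zero). -/
theorem IsDCoalgebra.isCoartFiltration (hC : C.IsDCoalgebra) {F : ℕ → Submodule k C} {e : C}
    (mono : Monotone F) (exhaustive : ∀ x, ∃ i, x ∈ F i)
    (homogeneous : ∀ i n, ∀ x ∈ F i, C.proj n x ∈ F i) (D_mem : ∀ i, ∀ x ∈ F i, C.D x ∈ F i)
    (zero_eq : F 0 = Submodule.span k {e}) (counit_one : C.counit e = 1)
    (comul_mem : ∀ i, ∀ x ∈ F (i + 1), C.reducedComul e x ∈ C.square (F i))
    (cobracket_mem : ∀ i, ∀ x ∈ F (i + 1), C.cobracket x ∈ C.square (F i)) :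
    C.IsCoartFiltration F e := by
  have he : ∀ i, e ∈ F i := fun i => mono (Nat.zero_le i) (by
    rw [zero_eq]; exact Submodule.mem_span_singleton_self e)
  have he0 : ∀ c : k, c • e = 0 → c = 0 := fun c hc => by
    simpa [counit_one] using congrArg C.counit hc
  refine ⟨mono, exhaustive, fun i => ⟨C.homogeneous_of_proj_mem (homogeneous i), D_mem i,
    fun x hx => ?_, fun x hx => cobracket_mem i x (mono (Nat.le_succ i) hx)⟩, zero_eq,
    counit_one, fun x hx hε => ?_, fun x hx => ?_, fun i hi x hx => ?_, fun i hi x hx => ?_⟩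
  · have := comul_mem i x (mono (Nat.le_succ i) hx)
    rw [reducedComul_apply] at this
    have h2 := add_mem (add_mem this (C.tmul_mem_square hx (he i)))
      (C.tmul_mem_square (he i) hx)
    convert h2 using 1
    abel
  · have := comul_mem 0 x hx
    rw [zero_eq] at this
    obtain ⟨c, hc⟩ := C.exists_of_mem_square_span this
    rw [reducedComul_apply, sub_sub, sub_eq_iff_eq_add] at hc
    have h1 := LinearMap.congr_fun hC.counit_comul x
    simp only [LinearMap.comp_apply, hc, map_add, map_smul, TensorProduct.map_tmul, counit_one,
      hε, LinearEquiv.coe_coe, TensorProduct.lid_tmul, LinearMap.id_apply, one_smul, zero_smul,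
      add_zero, add_eq_right] at h1
    rw [hc, he0 c h1, zero_smul, zero_add]
  · have := cobracket_mem 0 x hx
    rw [zero_eq] at this
    obtain ⟨c, hc⟩ := C.exists_of_mem_square_span this
    have h1 := LinearMap.congr_fun hC.counit_cobracket x
    simp only [LinearMap.comp_apply, hc, map_smul, TensorProduct.map_tmul, counit_one,
      LinearMap.id_apply, LinearMap.zero_apply] at h1
    have h2 := congrArg (TensorProduct.lid k C) h1
    simp only [map_smul, TensorProduct.lid_tmul, one_smul, map_zero] at h2
    rw [hc, he0 c h2, zero_smul]
  · obtain ⟨j, rfl⟩ : ∃ j, i = j + 1 := ⟨i - 1, by omega⟩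
    exact comul_mem j x hx
  · obtain ⟨j, rfl⟩ : ∃ j, i = j + 1 := ⟨i - 1, by omega⟩
    exact cobracket_mem j x hx

namespace IsCoartFiltration

variable {F : ℕ → Submodule k C} {e : C}

theorem one_mem (h : C.IsCoartFiltration F e) (i : ℕ) : e ∈ F i :=
  h.mono (Nat.zero_le i) (by rw [h.zero_eq]; exact Submodule.mem_span_singleton_self e)

theorem proj_mem (h : C.IsCoartFiltration F e) (i : ℕ) (n : ℤ) {x : C} (hx : x ∈ F i) :
    C.proj n x ∈ F i :=
  C.proj_mem_of_homogeneous (h.subcoalgebra i).homogeneous n hx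

theorem comul_grouplike (h : C.IsCoartFiltration F e) (hC : C.IsDCoalgebra) :
    C.comul e = e ⊗ₜ e := by
  have h1 := (h.subcoalgebra 0).comul_mem e (h.one_mem 0)
  rw [h.zero_eq] at h1
  obtain ⟨c, hc⟩ := C.exists_of_mem_square_span h1
  have h2 := LinearMap.congr_fun hC.counit_comul e
  simp only [LinearMap.comp_apply, hc, map_smul, TensorProduct.map_tmul, h.counit_one,
    LinearEquiv.coe_coe, TensorProduct.lid_tmul, LinearMap.id_apply, one_smul] at h2
  have h3 := congrArg C.counit h2
  rw [map_smul, h.counit_one, smul_eq_mul, mul_one] at h3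
  rw [hc, h3, one_smul]

theorem isGrouplike (h : C.IsCoartFiltration F e) (hC : C.IsDCoalgebra) : C.IsGrouplike e :=
  ⟨h.comul_grouplike hC, h.counit_one⟩

theorem mem_gr_zero (h : C.IsCoartFiltration F e) (hC : C.IsDCoalgebra) : e ∈ C.gr 0 := by
  refine C.mem_of_proj_mem _ fun n => ?_
  have h1 := h.proj_mem 0 n (h.one_mem 0)
  rw [h.zero_eq] at h1
  obtain ⟨c, hc⟩ := Submodule.mem_span_singleton.1 h1
  rcases eq_or_ne n 0 with rfl | hn
  · exact C.proj_mem 0 e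
  · have h2 := hC.counit_eq_zero n _ hn (C.proj_mem n e)
    rw [← hc, map_smul, h.counit_one, smul_eq_mul, mul_one] at h2
    rw [← hc, h2, zero_smul]
    exact Submodule.zero_mem _

theorem D_one (h : C.IsCoartFiltration F e) (hC : C.IsDCoalgebra) : C.D e = 0 := by
  have h1 := (h.subcoalgebra 0).D_mem e (h.one_mem 0)
  rw [h.zero_eq] at h1
  obtain ⟨c, hc⟩ := Submodule.mem_span_singleton.1 h1
  have h2 := hC.counit_D e
  rw [← hc, map_smul, h.counit_one, smul_eq_mul, mul_one] at h2
  rw [← hc, h2, zero_smul]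

theorem cobracket_grouplike (h : C.IsCoartFiltration F e) : C.cobracket e = 0 :=
  h.cobracket_one e (h.one_mem 1)

/-- At level one `x` may have nonzero counit. Subtracting `ε(x) e` makes it primitive, and the
reduced coproduct of `x` is then `-ε(x) e ⊗ e`, which lies in the square of `F 0`. -/
theorem reducedComul_mem (h : C.IsCoartFiltration F e) (hC : C.IsDCoalgebra) (i : ℕ) {x : C}
    (hx : x ∈ F (i + 1)) : C.reducedComul e x ∈ C.square (F i) := by
  rcases Nat.eq_zero_or_pos i with rfl | hi
  · have h1 := h.comul_one (x - C.counit x • e)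
      (Submodule.sub_mem _ hx (Submodule.smul_mem _ _ (h.one_mem _)))
      (by simp [h.counit_one])
    rw [map_sub, map_smul, h.comul_grouplike hC] at h1
    have h2 : C.reducedComul e x = -(C.counit x • (e ⊗ₜ[k] e)) := by
      rw [reducedComul_apply, eq_add_of_sub_eq h1]
      simp only [TensorProduct.tmul_sub, TensorProduct.sub_tmul, TensorProduct.tmul_smul,
        ← TensorProduct.smul_tmul']
      abel
    rw [h2]
    exact Submodule.neg_mem _ (Submodule.smul_mem _ _
      (C.tmul_mem_square (h.one_mem 0) (h.one_mem 0)))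
  · exact h.comul_mem (i + 1) (by omega) x hx

theorem cobracket_mem' (h : C.IsCoartFiltration F e) (i : ℕ) {x : C}
    (hx : x ∈ F (i + 1)) : C.cobracket x ∈ C.square (F i) := by
  rcases Nat.eq_zero_or_pos i with rfl | hi
  · rw [h.cobracket_one x hx]
    exact Submodule.zero_mem _
  · exact h.cobracket_mem (i + 1) (by omega) x hx

/-- For grouplike `g` the tensor `(g - e) ⊗ (g - e)` is the reduced coproduct plus `e ⊗ e`. If `g`
lies in level `i + 1` this tensor lies in the square of level `i`, so `g - e` lies in level `i`;
descend to the line `F 0` and compare counits. -/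
theorem eq_of_isGrouplike (h : C.IsCoartFiltration F e) (hC : C.IsDCoalgebra) {g : C}
    (hg : C.IsGrouplike g) : g = e := by
  have key : ∀ i, g ∈ F i → g ∈ F 0 := by
    intro i
    induction i with
    | zero => exact fun h => h
    | succ i ih =>
      intro hgi
      apply ih
      have h1 := h.reducedComul_mem hC i hgi
      rw [reducedComul_apply, hg.1] at h1
      have h2 : (g - e) ⊗ₜ[k] (g - e) ∈ C.square (F i) := by
        have := Submodule.add_mem _ h1 (C.tmul_mem_square (h.one_mem i) (h.one_mem i))
        convert this using 1
        simp only [TensorProduct.tmul_sub, TensorProduct.sub_tmul]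
        abel
      have h3 : C.square (F i) ≤ LinearMap.ker (TensorProduct.map (F i).mkQ (F i).mkQ) :=
        C.square_le fun x hx y hy => by
          simp [(Submodule.Quotient.mk_eq_zero (F i)).2 hx]
      have h4 := h3 h2
      rw [LinearMap.mem_ker, TensorProduct.map_tmul] at h4
      have h6 : g - e ∈ F i := by
        -- A vector `v` with `v ⊗ v = 0` is zero: applying `φ ⊗ φ` gives `φ(v)² = 0` for every
        -- functional `φ`.
        rw [← Submodule.Quotient.mk_eq_zero, ← Module.forall_dual_apply_eq_zero_iff k]
        intro φ
        have h5 := congrArg (LinearMap.mul' k k ∘ₗ TensorProduct.map φ φ) h4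
        simpa using h5
      simpa using Submodule.add_mem _ h6 (h.one_mem i)
  obtain ⟨i, hi⟩ := h.exhaustive g
  have h1 := key i hi
  rw [h.zero_eq] at h1
  obtain ⟨c, rfl⟩ := Submodule.mem_span_singleton.1 h1
  have h2 := hg.2
  rw [map_smul, h.counit_one, smul_eq_mul, mul_one] at h2
  rw [h2, one_smul]

end IsCoartFiltration

theorem IsCoproartinian.exists_isGrouplike (hC : C.IsCoproartinian) : ∃ e, C.IsGrouplike e := by
  obtain ⟨F, e, h⟩ := hC.exists_filtration
  exact ⟨e, h.isGrouplike hC.isDCoalgebra⟩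

theorem IsCoproartinian.grouplike_unique (hC : C.IsCoproartinian) {e e' : C}
    (he : C.IsGrouplike e) (he' : C.IsGrouplike e') : e = e' := by
  obtain ⟨F, e₀, h⟩ := hC.exists_filtration
  rw [h.eq_of_isGrouplike hC.isDCoalgebra he, h.eq_of_isGrouplike hC.isDCoalgebra he']

theorem IsCoproartinian.grouplike_mem_gr (hC : C.IsCoproartinian) {e : C}
    (he : C.IsGrouplike e) : e ∈ C.gr 0 := by
  obtain ⟨F, e₀, h⟩ := hC.exists_filtration
  rw [h.eq_of_isGrouplike hC.isDCoalgebra he]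
  exact h.mem_gr_zero hC.isDCoalgebra

theorem IsCoproartinian.D_grouplike (hC : C.IsCoproartinian) {e : C}
    (he : C.IsGrouplike e) : C.D e = 0 := by
  obtain ⟨F, e₀, h⟩ := hC.exists_filtration
  rw [h.eq_of_isGrouplike hC.isDCoalgebra he]
  exact h.D_one hC.isDCoalgebra

theorem IsCoproartinian.cobracket_grouplike (hC : C.IsCoproartinian) {e : C}
    (he : C.IsGrouplike e) : C.cobracket e = 0 := by
  obtain ⟨F, e₀, h⟩ := hC.exists_filtration
  rw [h.eq_of_isGrouplike hC.isDCoalgebra he]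
  exact h.cobracket_grouplike

/-- Level `n` is the sum of the images of the given levels `n`. The hypothesis that all grouplike
elements have the same image keeps level zero one-dimensional. -/
theorem isCoproartinian_of_jointly_surjective {ι : Type*} [Nonempty ι]
    {S : ι → DCoalgebraOps k d} {g : ∀ i, S i →ₗ[k] C} (hS : ∀ i, (S i).IsCoproartinian)
    (hg : ∀ i, (S i).IsHom C (g i)) (hs : ⨆ i, LinearMap.range (g i) = ⊤) {e : C}
    (he : ∀ i e', (S i).IsGrouplike e' → g i e' = e) : C.IsCoproartinian := by
  have hC : C.IsDCoalgebra :=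
    isDCoalgebra_of_jointly_surjective (fun i => (hS i).isDCoalgebra) hg hs
  choose F e' hF using fun i => (hS i).exists_filtration
  have hge : ∀ i, g i (e' i) = e := fun i => he i _ ((hF i).isGrouplike (hS i).isDCoalgebra)
  refine ⟨hC, fun n => ⨆ i, (F i n).map (g i), e, hC.isCoartFiltration ?_ ?_ ?_ ?_ ?_ ?_ ?_ ?_⟩
  · exact fun m n hmn => iSup_mono fun i => Submodule.map_mono ((hF i).mono hmn)
  · intro x
    have hx : x ∈ ⨆ i, LinearMap.range (g i) := hs ▸ Submodule.mem_top
    induction hx using Submodule.iSup_induction' with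
    | mem i x hx =>
      obtain ⟨y, rfl⟩ := hx
      obtain ⟨n, hn⟩ := (hF i).exhaustive y
      exact ⟨n, Submodule.mem_iSup_of_mem i ⟨y, hn, rfl⟩⟩
    | zero => exact ⟨0, Submodule.zero_mem _⟩
    | add x y _ _ hx hy =>
      obtain ⟨m, hm⟩ := hx
      obtain ⟨n, hn⟩ := hy
      have mono : Monotone fun n => ⨆ i, (F i n).map (g i) :=
        fun m n hmn => iSup_mono fun i => Submodule.map_mono ((hF i).mono hmn)
      exact ⟨max m n, Submodule.add_mem _ (mono (le_max_left m n) hm)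
        (mono (le_max_right m n) hn)⟩
  · intro n m
    suffices h : ⨆ i, (F i n).map (g i) ≤ (⨆ i, (F i n).map (g i)).comap (C.proj m) from
      fun x hx => h hx
    refine iSup_le fun i => ?_
    rintro _ ⟨y, hy, rfl⟩
    rw [Submodule.mem_comap, (hg i).proj_nat]
    exact Submodule.mem_iSup_of_mem i ⟨_, (hF i).proj_mem n m hy, rfl⟩
  · intro n
    suffices h : ⨆ i, (F i n).map (g i) ≤ (⨆ i, (F i n).map (g i)).comap C.D from
      fun x hx => h hx
    refine iSup_le fun i => ?_
    rintro _ ⟨y, hy, rfl⟩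
    rw [Submodule.mem_comap, ← (hg i).map_D]
    exact Submodule.mem_iSup_of_mem i ⟨_, ((hF i).subcoalgebra n).D_mem y hy, rfl⟩
  · simp only [fun i => (hF i).zero_eq, Submodule.map_span, Set.image_singleton, hge, iSup_const]
  · obtain ⟨i⟩ := ‹Nonempty ι›
    rw [← hge i, (hg i).map_counit, (hF i).counit_one]
  · intro n
    suffices h : ⨆ i, (F i (n + 1)).map (g i) ≤
        (C.square (⨆ i, (F i n).map (g i))).comap (C.reducedComul e) from fun x hx => h hx
    refine iSup_le fun i => ?_
    rintro _ ⟨y, hy, rfl⟩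
    have h1 := (S i).map_mem_square (g i) (G := ⨆ i, (F i n).map (g i))
      (fun x hx => Submodule.mem_iSup_of_mem i ⟨x, hx, rfl⟩)
      ((hF i).reducedComul_mem (hS i).isDCoalgebra n hy)
    rw [Submodule.mem_comap, reducedComul_apply, (hg i).map_comul, ← hge i]
    simpa only [reducedComul_apply, map_sub, TensorProduct.map_tmul] using h1
  · intro n
    suffices h : ⨆ i, (F i (n + 1)).map (g i) ≤
        (C.square (⨆ i, (F i n).map (g i))).comap C.cobracket from fun x hx => h hx
    refine iSup_le fun i => ?_
    rintro _ ⟨y, hy, rfl⟩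
    have h1 := (S i).map_mem_square (g i) (G := ⨆ i, (F i n).map (g i))
      (fun x hx => Submodule.mem_iSup_of_mem i ⟨x, hx, rfl⟩) ((hF i).cobracket_mem' n hy)
    rw [Submodule.mem_comap, (hg i).map_cobracket]
    exact h1

end DCoalgebraOps

/-! ### Sub-`d`-coalgebras and local finiteness -/

namespace DCoalgebraOps

variable {k : Type u} [Field k] {d : ℤ}

section Restrict

variable {C : DCoalgebraOps k d} {A : Submodule k C}

theorem map_subtype_injective (A : Submodule k C) :
    Function.Injective (TensorProduct.map A.subtype A.subtype) :=
  TensorProduct.map_injective_of_flat_flat _ _ A.subtype_injective A.subtype_injective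

/-- The identification of `A ⊗ A` with its image in `C ⊗ C`. -/
def squareEquiv (A : Submodule k C) : (A ⊗[k] A) ≃ₗ[k] C.square A :=
  LinearEquiv.ofInjective _ (map_subtype_injective A)

theorem map_subtype_squareEquiv_symm (t : C.square A) :
    TensorProduct.map A.subtype A.subtype ((squareEquiv A).symm t) = t :=
  congrArg Subtype.val ((squareEquiv A).apply_symm_apply t)

/-- A sub-`d`-coalgebra as a `d`-coalgebra. -/
def restrict (C : DCoalgebraOps k d) (A : Submodule k C) (hA : C.IsSubcoalgebra A) :
    DCoalgebraOps k d where
  carrier := A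
  gr n := (C.gr n).comap A.subtype
  internal := by
    refine DGSpace.isInternal_of_proj _ (fun n => (C.proj n).restrict
      (fun x hx => C.proj_mem_of_homogeneous hA.homogeneous n hx))
      (fun n x hx => Subtype.ext (C.proj_of_mem hx))
      (fun m n hmn x hx => Subtype.ext (C.proj_of_mem_ne hx hmn)) ?_
    rw [eq_top_iff]
    rintro x -
    have h : A ≤ (⨆ n, (C.gr n).comap A.subtype).map A.subtype := by
      refine hA.homogeneous.trans (iSup_le fun n y hy => ?_)
      exact ⟨⟨y, hy.1⟩, Submodule.mem_iSup_of_mem n hy.2, rfl⟩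
    obtain ⟨y, hy, hyx⟩ := h x.2
    rwa [← Subtype.ext hyx]
  D := C.D.restrict hA.D_mem
  D_mem n x hx := C.D_mem n x hx
  D_D x := Subtype.ext (C.D_D x)
  comul := (squareEquiv A).symm.toLinearMap ∘ₗ
    (C.comul ∘ₗ A.subtype).codRestrict (C.square A) fun x => hA.comul_mem x x.2
  counit := C.counit ∘ₗ A.subtype
  cobracket := (squareEquiv A).symm.toLinearMap ∘ₗ
    (C.cobracket ∘ₗ A.subtype).codRestrict (C.square A) fun x => hA.cobracket_mem x x.2

/-- The inclusion of a sub-`d`-coalgebra. -/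
def inclusion (hA : C.IsSubcoalgebra A) : C.restrict A hA →ₗ[k] C := A.subtype

theorem inclusion_injective (hA : C.IsSubcoalgebra A) : Function.Injective (inclusion hA) :=
  A.subtype_injective

theorem inclusion_mem (hA : C.IsSubcoalgebra A) (x : C.restrict A hA) : inclusion hA x ∈ A :=
  (show A from x).2

theorem inclusion_isHom (hA : C.IsSubcoalgebra A) :
    (C.restrict A hA).IsHom C (inclusion hA) :=
  ⟨⟨fun _ _ hx => hx, fun _ => rfl,
    fun x => (map_subtype_squareEquiv_symm
      ⟨C.comul (inclusion hA x), hA.comul_mem _ (inclusion_mem hA x)⟩).symm,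
    fun x => (map_subtype_squareEquiv_symm
      ⟨C.cobracket (inclusion hA x), hA.cobracket_mem _ (inclusion_mem hA x)⟩).symm⟩,
    fun _ => rfl⟩

/-- The preimages of the levels form the required filtration. The images of the reduced coproduct
and of the cobracket lie both in the square of a level and in the square of the range, and
`square_inf_square_le` places them in the square of the intersection. -/
theorem isCoproartinian_of_injective {E : DCoalgebraOps k d} {f : C →ₗ[k] E} (hf : C.IsHom E f)
    (hi : Function.Injective f) (hE : E.IsCoproartinian) {e : C} (he : E.IsGrouplike (f e)) :
    C.IsCoproartinian := by
  obtain ⟨F, e', h⟩ := hE.exists_filtration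
  obtain rfl : f e = e' := h.eq_of_isGrouplike hE.isDCoalgebra he
  have hC : C.IsDCoalgebra := isDCoalgebra_of_injective hf hi hE.isDCoalgebra
  have hii : Function.Injective (TensorProduct.map f f) :=
    TensorProduct.map_injective_of_flat_flat _ _ hi hi
  have key : ∀ (i : ℕ) (t : C ⊗[k] C), TensorProduct.map f f t ∈ E.square (F i) →
      t ∈ C.square ((F i).comap f) := by
    intro i t ht
    have h0 : TensorProduct.map f f t ∈ E.square (LinearMap.range f) := by
      clear ht
      induction t with
      | zero => simp
      | tmul x y => exact E.tmul_mem_square ⟨x, rfl⟩ ⟨y, rfl⟩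
      | add a b ha hb => rw [map_add]; exact add_mem ha hb
    have h1 := E.square_inf_square_le (F i) (LinearMap.range f) ⟨ht, h0⟩
    have h2 : E.square (F i ⊓ LinearMap.range f) ≤
        (C.square ((F i).comap f)).map (TensorProduct.map f f) := by
      refine E.square_le ?_
      rintro _ ⟨hx, x, rfl⟩ _ ⟨hy, y, rfl⟩
      exact ⟨x ⊗ₜ y, C.tmul_mem_square hx hy, rfl⟩
    obtain ⟨s, hs, hst⟩ := h2 h1
    rwa [← hii hst]
  refine ⟨hC, fun i => (F i).comap f, e,
    hC.isCoartFiltration (fun i j hij => Submodule.comap_mono (h.mono hij))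
    (fun x => h.exhaustive (f x)) (fun i n x hx => ?_) (fun i x hx => ?_) ?_
    (by rw [← hf.map_counit, he.2]) (fun i x hx => key i _ ?_) (fun i x hx => key i _ ?_)⟩
  · rw [Submodule.mem_comap, ← hf.proj_nat]
    exact h.proj_mem i n hx
  · rw [Submodule.mem_comap, hf.map_D]
    exact (h.subcoalgebra i).D_mem _ hx
  · ext x
    rw [Submodule.mem_comap, h.zero_eq, Submodule.mem_span_singleton,
      Submodule.mem_span_singleton]
    exact ⟨fun ⟨c, hc⟩ => ⟨c, hi (by rw [map_smul, hc])⟩,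
      fun ⟨c, hc⟩ => ⟨c, by rw [← hc, map_smul]⟩⟩
  · have h1 := h.reducedComul_mem hE.isDCoalgebra i hx
    rw [reducedComul_apply, hf.map_comul x] at h1
    simpa only [reducedComul_apply, map_sub, TensorProduct.map_tmul] using h1
  · rw [← hf.map_cobracket]
    exact h.cobracket_mem' i hx

theorem IsSubcoalgebra.sup {A B : Submodule k C} (hA : C.IsSubcoalgebra A)
    (hB : C.IsSubcoalgebra B) : C.IsSubcoalgebra (A ⊔ B) where
  homogeneous := sup_le
    (hA.homogeneous.trans (iSup_mono fun _ => inf_le_inf_right _ le_sup_left))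
    (hB.homogeneous.trans (iSup_mono fun _ => inf_le_inf_right _ le_sup_right))
  D_mem := sup_le (c := (A ⊔ B).comap C.D) (fun x hx => le_sup_left (a := A) (hA.D_mem x hx))
    (fun x hx => le_sup_right (a := A) (hB.D_mem x hx))
  comul_mem := sup_le (c := (C.square (A ⊔ B)).comap C.comul)
    (fun x hx => C.square_mono le_sup_left (hA.comul_mem x hx))
    (fun x hx => C.square_mono le_sup_right (hB.comul_mem x hx))
  cobracket_mem := sup_le (c := (C.square (A ⊔ B)).comap C.cobracket)
    (fun x hx => C.square_mono le_sup_left (hA.cobracket_mem x hx))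
    (fun x hx => C.square_mono le_sup_right (hB.cobracket_mem x hx))

/-- A finite-dimensional sub-`d`-coalgebra containing `e`. -/
structure IsFiniteSub (C : DCoalgebraOps k d) (e : C) (A : Submodule k C) : Prop where
  sub : C.IsSubcoalgebra A
  finite : FiniteDimensional k A
  one_mem : e ∈ A

theorem IsFiniteSub.sup {e : C} {A B : Submodule k C} (hA : C.IsFiniteSub e A)
    (hB : C.IsFiniteSub e B) : C.IsFiniteSub e (A ⊔ B) :=
  ⟨hA.sub.sup hB.sub, by have := hA.finite; have := hB.finite; infer_instance,
    Submodule.mem_sup_left hA.one_mem⟩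

theorem exists_isFiniteSub_square {e : C} {F : Submodule k C} (h0 : ∃ A, C.IsFiniteSub e A)
    (h : ∀ x ∈ F, ∃ A, C.IsFiniteSub e A ∧ x ∈ A) {t : C ⊗[k] C} (ht : t ∈ C.square F) :
    ∃ A, C.IsFiniteSub e A ∧ t ∈ C.square A := by
  obtain ⟨s, rfl⟩ := ht
  induction s with
  | zero =>
    obtain ⟨A, hA⟩ := h0
    exact ⟨A, hA, by simp⟩
  | tmul x y =>
    obtain ⟨A, hA, hx⟩ := h x x.2
    obtain ⟨B, hB, hy⟩ := h y y.2
    exact ⟨A ⊔ B, hA.sup hB,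
      C.tmul_mem_square (Submodule.mem_sup_left hx) (Submodule.mem_sup_right hy)⟩
  | add a b ha hb =>
    obtain ⟨A, hA, hx⟩ := ha
    obtain ⟨B, hB, hy⟩ := hb
    rw [map_add]
    exact ⟨A ⊔ B, hA.sup hB, Submodule.add_mem _ (C.square_mono le_sup_left hx)
      (C.square_mono le_sup_right hy)⟩

/-- The fundamental theorem of coalgebras in this setting. For homogeneous `x` in level `i + 1`, the
reduced coproducts and cobrackets of `x` and `D x` involve only elements of level `i`, which
induction places in a finite-dimensional subcoalgebra; it remains to adjoin `x` and `D x`. -/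
theorem IsCoartFiltration.exists_isFiniteSub {F : ℕ → Submodule k C} {e : C}
    (h : C.IsCoartFiltration F e) (hC : C.IsDCoalgebra) (i : ℕ) :
    ∀ x ∈ F i, ∃ A, C.IsFiniteSub e A ∧ x ∈ A := by
  have h0 : C.IsFiniteSub e (F 0) :=
    ⟨h.subcoalgebra 0, by rw [h.zero_eq]; infer_instance, h.one_mem 0⟩
  induction i with
  | zero => exact fun x hx => ⟨F 0, h0, hx⟩
  | succ i ih =>
    have step : ∀ x ∈ F (i + 1), ∃ A, C.IsFiniteSub e A ∧ C.reducedComul e x ∈ C.square A ∧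
        C.cobracket x ∈ C.square A := by
      intro x hx
      obtain ⟨A, hA, h1⟩ := exists_isFiniteSub_square ⟨_, h0⟩ ih (h.reducedComul_mem hC i hx)
      obtain ⟨B, hB, h2⟩ := exists_isFiniteSub_square ⟨_, h0⟩ ih (h.cobracket_mem' i hx)
      exact ⟨A ⊔ B, hA.sup hB, C.square_mono le_sup_left h1, C.square_mono le_sup_right h2⟩
    intro x hx
    have hx' := (h.subcoalgebra (i + 1)).homogeneous hx
    induction hx' using Submodule.iSup_induction' with
    | mem n x hxn =>
      obtain ⟨A, hA, h1, h2⟩ := step x hxn.1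
      obtain ⟨B, hB, h3, h4⟩ := step (C.D x) ((h.subcoalgebra (i + 1)).D_mem x hxn.1)
      -- Adjoining `D x` makes the span stable under the differential, as `D (D x) = 0`; homogeneity
      -- of `x` makes it graded.
      let G := A ⊔ B ⊔ Submodule.span k {x, C.D x}
      have hAG : A ≤ G := le_sup_left.trans le_sup_left
      have hBG : B ≤ G := le_sup_right.trans le_sup_left
      have hxG : x ∈ G := Submodule.mem_sup_right (Submodule.subset_span (by simp))
      have hDG : C.D x ∈ G := Submodule.mem_sup_right (Submodule.subset_span (by simp))
      have heG : e ∈ G := hAG hA.one_mem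
      have comulG : ∀ y ∈ G, C.reducedComul e y ∈ C.square G → C.comul y ∈ C.square G := by
        intro y hy hr
        rw [reducedComul_apply] at hr
        have h5 := add_mem (add_mem hr (C.tmul_mem_square hy heG)) (C.tmul_mem_square heG hy)
        convert h5 using 1
        abel
      have gen : ∀ {P : Submodule k C}, A ≤ P → B ≤ P → x ∈ P → C.D x ∈ P → G ≤ P :=
        fun hAP hBP hxP hDP => sup_le (sup_le hAP hBP) (Submodule.span_le.2 (by
          rintro y (rfl | rfl)
          · exact hxP
          · exact hDP))
      refine ⟨G, ⟨⟨?_, ?_, ?_, ?_⟩, ?_, heG⟩, hxG⟩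
      · refine gen (hA.sub.homogeneous.trans (iSup_mono fun _ => inf_le_inf_right _ hAG))
          (hB.sub.homogeneous.trans (iSup_mono fun _ => inf_le_inf_right _ hBG)) ?_ ?_
        · exact Submodule.mem_iSup_of_mem n ⟨hxG, hxn.2⟩
        · exact Submodule.mem_iSup_of_mem (n + 1) ⟨hDG, C.D_mem n x hxn.2⟩
      · refine gen (P := G.comap C.D) (fun y hy => hAG (hA.sub.D_mem y hy))
          (fun y hy => hBG (hB.sub.D_mem y hy)) hDG ?_
        rw [Submodule.mem_comap, C.D_D]
        exact G.zero_mem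
      · exact gen (P := (C.square G).comap C.comul)
          (fun y hy => C.square_mono hAG (hA.sub.comul_mem y hy))
          (fun y hy => C.square_mono hBG (hB.sub.comul_mem y hy))
          (comulG x hxG (C.square_mono hAG h1)) (comulG _ hDG (C.square_mono hBG h3))
      · exact gen (P := (C.square G).comap C.cobracket)
          (fun y hy => C.square_mono hAG (hA.sub.cobracket_mem y hy))
          (fun y hy => C.square_mono hBG (hB.sub.cobracket_mem y hy))
          (C.square_mono hAG h2) (C.square_mono hBG h4)
      · have := hA.finite
        have := hB.finite
        have : FiniteDimensional k (Submodule.span k {x, C.D x}) :=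
          FiniteDimensional.span_of_finite k (by simp)
        infer_instance
    | zero => exact ⟨F 0, h0, Submodule.zero_mem _⟩
    | add x y hx' hy' ihx ihy =>
      have le : ⨆ n, F (i + 1) ⊓ C.gr n ≤ F (i + 1) := iSup_le fun n => inf_le_left
      obtain ⟨A, hA, h1⟩ := ihx (le hx')
      obtain ⟨B, hB, h2⟩ := ihy (le hy')
      exact ⟨A ⊔ B, hA.sup hB,
        Submodule.add_mem _ (Submodule.mem_sup_left h1) (Submodule.mem_sup_right h2)⟩

theorem IsCoproartinian.exists_isFiniteSub (hC : C.IsCoproartinian) {e : C}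
    (he : C.IsGrouplike e) (x : C) : ∃ A, C.IsFiniteSub e A ∧ x ∈ A := by
  obtain ⟨F, e', h⟩ := hC.exists_filtration
  obtain rfl : e = e' := h.eq_of_isGrouplike hC.isDCoalgebra he
  obtain ⟨i, hi⟩ := h.exhaustive x
  exact h.exists_isFiniteSub hC.isDCoalgebra i x hi

end Restrict

/-! ### Coideals, quotients and simple objects -/

section Quotient

/-- A graded dg coideal for the coproduct and the cobracket, annihilated by the counit. -/
structure IsCoideal (C : DCoalgebraOps k d) (I : Submodule k C) : Prop where
  proj_mem : ∀ n, ∀ x ∈ I, C.proj n x ∈ I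
  D_mem : ∀ x ∈ I, C.D x ∈ I
  counit_eq : ∀ x ∈ I, C.counit x = 0
  comul_eq : ∀ x ∈ I, TensorProduct.map I.mkQ I.mkQ (C.comul x) = 0
  cobracket_eq : ∀ x ∈ I, TensorProduct.map I.mkQ I.mkQ (C.cobracket x) = 0

variable {C : DCoalgebraOps k d}

/-- The quotient by a coideal. -/
def quotient (C : DCoalgebraOps k d) (I : Submodule k C) (hI : C.IsCoideal I) :
    DCoalgebraOps k d where
  carrier := C.carrier ⧸ I
  gr n := (C.gr n).map I.mkQ
  internal := by
    refine DGSpace.isInternal_of_proj _ (fun n => I.mapQ I (C.proj n) (hI.proj_mem n)) ?_ ?_ ?_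
    · rintro n _ ⟨x, hx, rfl⟩
      simp [C.proj_of_mem hx]
    · rintro m n hmn _ ⟨x, hx, rfl⟩
      simp [C.proj_of_mem_ne hx hmn]
    · rw [← Submodule.map_iSup, C.iSup_gr, Submodule.map_top, Submodule.range_mkQ]
  D := I.mapQ I C.D hI.D_mem
  D_mem := by
    rintro n _ ⟨x, hx, rfl⟩
    exact ⟨C.D x, C.D_mem n x hx, rfl⟩
  D_D := by
    intro x
    obtain ⟨x, rfl⟩ := I.mkQ_surjective x
    simp [C.D_D]
  comul := I.liftQ (TensorProduct.map I.mkQ I.mkQ ∘ₗ C.comul) hI.comul_eq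
  counit := I.liftQ C.counit hI.counit_eq
  cobracket := I.liftQ (TensorProduct.map I.mkQ I.mkQ ∘ₗ C.cobracket) hI.cobracket_eq

/-- The projection onto the quotient by a coideal. -/
def quotientMk {I : Submodule k C} (hI : C.IsCoideal I) : C →ₗ[k] C.quotient I hI := I.mkQ

theorem quotientMk_isHom {I : Submodule k C} (hI : C.IsCoideal I) :
    C.IsHom (C.quotient I hI) (quotientMk hI) :=
  ⟨⟨fun _ x hx => ⟨x, hx, rfl⟩, fun _ => rfl, fun _ => rfl, fun _ => rfl⟩, fun _ => rfl⟩

theorem quotientMk_eq_zero {I : Submodule k C} (hI : C.IsCoideal I) {x : C} :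
    quotientMk hI x = 0 ↔ x ∈ I :=
  Submodule.Quotient.mk_eq_zero I

/-- The quotient by the kernel embeds in `E`, and so does its tensor square; the coideal conditions
can be checked in `E ⊗ E`, where they follow from compatibility with `g`. -/
theorem IsHom.isCoideal_ker {E : DCoalgebraOps k d} {g : C →ₗ[k] E} (h : C.IsHom E g) :
    C.IsCoideal (LinearMap.ker g) := by
  let I := LinearMap.ker g
  let j : (C ⧸ I) →ₗ[k] E := I.liftQ g le_rfl
  have hj : Function.Injective j := LinearMap.ker_eq_bot.1 (Submodule.ker_liftQ_eq_bot _ _ _ le_rfl)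
  have hjj := TensorProduct.map_injective_of_flat_flat j j hj hj
  have e : j ∘ₗ I.mkQ = g := I.liftQ_mkQ g le_rfl
  refine ⟨fun n x hx => ?_, fun x hx => ?_, fun x hx => ?_, fun x hx => hjj ?_,
    fun x hx => hjj ?_⟩
  · rw [LinearMap.mem_ker, ← h.proj_nat, LinearMap.mem_ker.1 hx, map_zero]
  · rw [LinearMap.mem_ker, h.map_D, LinearMap.mem_ker.1 hx, map_zero]
  · rw [← h.map_counit, LinearMap.mem_ker.1 hx, map_zero]
  · rw [TensorProduct.map_map, map_zero, e, ← h.map_comul, LinearMap.mem_ker.1 hx, map_zero]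
  · rw [TensorProduct.map_map, map_zero, e, ← h.map_cobracket, LinearMap.mem_ker.1 hx, map_zero]

/-- Modulo this range `f` and `g` coincide, hence so do the images of `f ⊗ f` and `g ⊗ g`; their
difference, applied to the coproduct or cobracket of `x`, gives the operation on `f x - g x`. -/
theorem IsHom.isCoideal_range_sub {E : DCoalgebraOps k d} {f g : C →ₗ[k] E} (hf : C.IsHom E f)
    (hg : C.IsHom E g) : E.IsCoideal (LinearMap.range (f - g)) := by
  have e : (LinearMap.range (f - g)).mkQ ∘ₗ f = (LinearMap.range (f - g)).mkQ ∘ₗ g := by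
    ext x
    simp only [LinearMap.comp_apply, Submodule.mkQ_apply]
    rw [Submodule.Quotient.eq]
    exact ⟨x, rfl⟩
  refine ⟨?_, ?_, ?_, ?_, ?_⟩
  · rintro n _ ⟨x, rfl⟩
    exact ⟨C.proj n x, by simp [hf.proj_nat, hg.proj_nat]⟩
  · rintro _ ⟨x, rfl⟩
    exact ⟨C.D x, by simp [hf.map_D, hg.map_D]⟩
  · rintro _ ⟨x, rfl⟩
    simp [hf.map_counit, hg.map_counit]
  · rintro _ ⟨x, rfl⟩
    rw [LinearMap.sub_apply, map_sub, map_sub, hf.map_comul, hg.map_comul, TensorProduct.map_map,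
      TensorProduct.map_map, e, sub_self]
  · rintro _ ⟨x, rfl⟩
    rw [LinearMap.sub_apply, map_sub, map_sub, hf.map_cobracket, hg.map_cobracket,
      TensorProduct.map_map, TensorProduct.map_map, e, sub_self]

variable {M : Type*} [AddCommGroup M] [Module k M]

/-- The largest coideal on which `f` vanishes. -/
def maxCoideal (C : DCoalgebraOps k d) (f : C →ₗ[k] M) : Submodule k C :=
  sSup {I | C.IsCoideal I ∧ I ≤ LinearMap.ker f}

theorem le_maxCoideal {f : C →ₗ[k] M} {I : Submodule k C} (hI : C.IsCoideal I)
    (h : I ≤ LinearMap.ker f) : I ≤ C.maxCoideal f :=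
  le_sSup ⟨hI, h⟩

theorem maxCoideal_le_ker (f : C →ₗ[k] M) : C.maxCoideal f ≤ LinearMap.ker f :=
  sSup_le fun _ hI => hI.2

/-- A sum of coideals is a coideal: the projection modulo the sum factors through the projection
modulo each summand. -/
theorem maxCoideal_isCoideal (f : C →ₗ[k] M) : C.IsCoideal (C.maxCoideal f) := by
  have fac : ∀ I, C.IsCoideal I → I ≤ LinearMap.ker f → ∀ t : C ⊗[k] C,
      TensorProduct.map I.mkQ I.mkQ t = 0 →
      TensorProduct.map (C.maxCoideal f).mkQ (C.maxCoideal f).mkQ t = 0 := by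
    intro I hI hIf t ht
    have e : I.liftQ (C.maxCoideal f).mkQ
        ((le_maxCoideal hI hIf).trans (Submodule.ker_mkQ _).ge) ∘ₗ I.mkQ =
        (C.maxCoideal f).mkQ := Submodule.liftQ_mkQ _ _ _
    rw [← e, ← TensorProduct.map_map, ht, map_zero]
  refine ⟨fun n => ?_, ?_, ?_, ?_, ?_⟩
  · change C.maxCoideal f ≤ (C.maxCoideal f).comap (C.proj n)
    exact sSup_le fun I hI x hx => le_maxCoideal hI.1 hI.2 (hI.1.proj_mem n x hx)
  · change C.maxCoideal f ≤ (C.maxCoideal f).comap C.D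
    exact sSup_le fun I hI x hx => le_maxCoideal hI.1 hI.2 (hI.1.D_mem x hx)
  · change C.maxCoideal f ≤ LinearMap.ker C.counit
    exact sSup_le fun I hI x hx => hI.1.counit_eq x hx
  · change C.maxCoideal f ≤ LinearMap.ker (TensorProduct.map _ _ ∘ₗ C.comul)
    exact sSup_le fun I hI x hx => fac I hI.1 hI.2 _ (hI.1.comul_eq x hx)
  · change C.maxCoideal f ≤ LinearMap.ker (TensorProduct.map _ _ ∘ₗ C.cobracket)
    exact sSup_le fun I hI x hx => fac I hI.1 hI.2 _ (hI.1.cobracket_eq x hx)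

/-- There is no non-zero coideal on which `f` vanishes. -/
def IsSimple (C : DCoalgebraOps k d) (f : C →ₗ[k] M) : Prop :=
  ∀ I, C.IsCoideal I → I ≤ LinearMap.ker f → I = ⊥

/-- The range of `a - b` is a coideal killed by `f`. This is the source of all uniqueness statements
for universal objects. -/
theorem IsSimple.hom_ext {E : DCoalgebraOps k d} {f : E →ₗ[k] M} (h : E.IsSimple f)
    {a b : C →ₗ[k] E} (ha : C.IsHom E a) (hb : C.IsHom E b) (hab : f ∘ₗ a = f ∘ₗ b) : a = b := by
  have h1 := h _ (ha.isCoideal_range_sub hb) (by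
    rintro _ ⟨x, rfl⟩
    have := LinearMap.congr_fun hab x
    simp only [LinearMap.comp_apply] at this
    simp [this])
  rw [LinearMap.range_eq_bot] at h1
  exact sub_eq_zero.1 h1

/-- The kernel of `a` is a coideal on which `f = g ∘ a` vanishes. -/
theorem IsSimple.injective {E : DCoalgebraOps k d} {f : C →ₗ[k] M} (h : C.IsSimple f)
    {a : C →ₗ[k] E} (ha : C.IsHom E a) (g : E →ₗ[k] M) (hf : g ∘ₗ a = f) :
    Function.Injective a :=
  LinearMap.ker_eq_bot.1 <| h _ ha.isCoideal_ker fun x hx => by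
    rw [LinearMap.mem_ker, ← hf, LinearMap.comp_apply, LinearMap.mem_ker.1 hx, map_zero]

/-- The quotient by the largest coideal on which `f` vanishes. -/
def simpleQuotient (C : DCoalgebraOps k d) (f : C →ₗ[k] M) : DCoalgebraOps k d :=
  C.quotient (C.maxCoideal f) (maxCoideal_isCoideal f)

/-- The projection onto the quotient by the largest coideal on which `f` vanishes. -/
def simpleMk (f : C →ₗ[k] M) : C →ₗ[k] C.simpleQuotient f := quotientMk (maxCoideal_isCoideal f)

theorem simpleMk_isHom (f : C →ₗ[k] M) : C.IsHom (C.simpleQuotient f) (simpleMk f) :=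
  quotientMk_isHom _

theorem simpleMk_surjective (f : C →ₗ[k] M) : Function.Surjective (simpleMk f) :=
  Submodule.mkQ_surjective _

/-- The map induced by `f` on the quotient by the largest coideal on which `f` vanishes. -/
def simpleLift (f : C →ₗ[k] M) : C.simpleQuotient f →ₗ[k] M :=
  (C.maxCoideal f).liftQ f (maxCoideal_le_ker f)

theorem simpleLift_comp_mk (f : C →ₗ[k] M) : simpleLift f ∘ₗ simpleMk f = f :=
  Submodule.liftQ_mkQ _ _ _

theorem simpleLift_mk (f : C →ₗ[k] M) (x : C) : simpleLift f (simpleMk f x) = f x :=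
  LinearMap.congr_fun (simpleLift_comp_mk f) x

/-- The preimage in `C` of a coideal `I` of the quotient is the kernel of a composite of two
quotient maps, hence a coideal; if `I` is killed by the induced map, this preimage lies in the
largest coideal already divided out. -/
theorem simpleLift_isSimple (f : C →ₗ[k] M) : (C.simpleQuotient f).IsSimple (simpleLift f) := by
  intro I hI hIf
  have h1 := (quotientMk_isHom hI).comp (simpleMk_isHom f)
  have mem : ∀ x, x ∈ LinearMap.ker (quotientMk hI ∘ₗ simpleMk f) ↔ simpleMk f x ∈ I :=
    fun x => quotientMk_eq_zero hI
  have h2 : LinearMap.ker (quotientMk hI ∘ₗ simpleMk f) ≤ LinearMap.ker f := by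
    intro x hx
    have h4 := hIf ((mem x).1 hx)
    rwa [LinearMap.mem_ker, simpleLift_mk] at h4
  have h3 := le_maxCoideal h1.isCoideal_ker h2
  rw [eq_bot_iff]
  intro y hy
  obtain ⟨x, rfl⟩ := simpleMk_surjective f y
  exact (Submodule.mem_bot k).2 ((quotientMk_eq_zero _).2 (h3 ((mem x).2 hy)))

end Quotient

end DCoalgebraOps

namespace DCoalgebraOps

variable {k : Type u} [Field k] {d : ℤ}

/-! ### Direct sums -/

section DirectSum

open scoped Classical

/-- The direct sum of a family of `d`-coalgebras. -/
def directSum {ι : Type u} (S : ι → DCoalgebraOps k d) : DCoalgebraOps k d where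
  carrier := ⨁ i, S i
  gr n := ⨆ i, ((S i).gr n).map (DirectSum.lof k ι (fun i => (S i).carrier) i)
  internal := by
    refine DGSpace.isInternal_of_proj _ (fun n => DirectSum.toModule k ι _ fun i =>
      DirectSum.lof k ι (fun i => (S i).carrier) i ∘ₗ (S i).proj n) ?_ ?_ ?_
    · intro n
      change _ ≤ LinearMap.eqLocus _ LinearMap.id
      refine iSup_le fun i => ?_
      rintro _ ⟨x, hx, rfl⟩
      simp [LinearMap.mem_eqLocus, (S i).proj_of_mem hx]
    · intro m n hmn
      change _ ≤ LinearMap.ker _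
      refine iSup_le fun i => ?_
      rintro _ ⟨x, hx, rfl⟩
      simp [(S i).proj_of_mem_ne hx hmn]
    · rw [eq_top_iff]
      rintro x -
      induction x using DirectSum.induction_on with
      | zero => exact Submodule.zero_mem _
      | of i x =>
        refine (S i).mem_of_proj_mem (Submodule.comap (DirectSum.lof k ι (fun i => (S i).carrier) i)
          (⨆ n, ⨆ i, ((S i).gr n).map (DirectSum.lof k ι (fun i => (S i).carrier) i)))
          (x := x) fun n => ?_
        exact Submodule.mem_iSup_of_mem n (Submodule.mem_iSup_of_mem i ⟨_, (S i).proj_mem n x, rfl⟩)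
      | add x y hx hy => exact Submodule.add_mem _ hx hy
  D := DirectSum.toModule k ι _ fun i => DirectSum.lof k ι (fun i => (S i).carrier) i ∘ₗ (S i).D
  D_mem := by
    intro n
    suffices h : (⨆ i, ((S i).gr n).map (DirectSum.lof k ι (fun i => (S i).carrier) i)) ≤
        (⨆ i, ((S i).gr (n + 1)).map (DirectSum.lof k ι (fun i => (S i).carrier) i)).comap
          (DirectSum.toModule k ι _ fun i =>
            DirectSum.lof k ι (fun i => (S i).carrier) i ∘ₗ (S i).D) from fun x hx => h hx
    refine iSup_le fun i => ?_
    rintro _ ⟨x, hx, rfl⟩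
    rw [Submodule.mem_comap, DirectSum.toModule_lof]
    exact Submodule.mem_iSup_of_mem i ⟨_, (S i).D_mem n x hx, rfl⟩
  D_D x := by
    induction x using DirectSum.induction_on with
    | zero => simp
    | of i x =>
      rw [← DirectSum.lof_eq_of k, DirectSum.toModule_lof, LinearMap.comp_apply,
        DirectSum.toModule_lof, LinearMap.comp_apply, (S i).D_D, map_zero]
    | add x y hx hy => rw [map_add, map_add, hx, hy, add_zero]
  comul := DirectSum.toModule k ι _ fun i =>
    TensorProduct.map (DirectSum.lof k ι (fun i => (S i).carrier) i)
      (DirectSum.lof k ι (fun i => (S i).carrier) i) ∘ₗ (S i).comul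
  counit := DirectSum.toModule k ι _ fun i => (S i).counit
  cobracket := DirectSum.toModule k ι _ fun i =>
    TensorProduct.map (DirectSum.lof k ι (fun i => (S i).carrier) i)
      (DirectSum.lof k ι (fun i => (S i).carrier) i) ∘ₗ (S i).cobracket

variable {ι : Type u} {S : ι → DCoalgebraOps k d}

/-- The inclusion of a summand. -/
def directSumIncl (S : ι → DCoalgebraOps k d) (i : ι) : S i →ₗ[k] directSum S :=
  DirectSum.lof k ι (fun i => (S i).carrier) i

/-- The map defined on a direct sum by maps defined on the summands. -/
def directSumLift {M : Type*} [AddCommGroup M] [Module k M] (f : ∀ i, S i →ₗ[k] M) :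
    directSum S →ₗ[k] M :=
  DirectSum.toModule k ι M f

theorem directSumLift_incl {M : Type*} [AddCommGroup M] [Module k M] (f : ∀ i, S i →ₗ[k] M)
    (i : ι) (x : S i) : directSumLift f (directSumIncl S i x) = f i x :=
  DirectSum.toModule_lof (φ := f) k i x

theorem directSumIncl_mem (i : ι) {n : ℤ} {x : S i} (hx : x ∈ (S i).gr n) :
    directSumIncl S i x ∈ (directSum S).gr n :=
  (le_iSup (fun i => ((S i).gr n).map (DirectSum.lof k ι (fun i => (S i).carrier) i)) i) ⟨x, hx, rfl⟩

theorem directSumIncl_isHom (i : ι) : (S i).IsHom (directSum S) (directSumIncl S i) := by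
  refine ⟨⟨fun n x hx => ?_, fun x => ?_, fun x => ?_, fun x => ?_⟩, fun x => ?_⟩
  · exact directSumIncl_mem i hx
  · exact directSumLift_incl (fun i => (S i).counit) i x
  · exact directSumLift_incl (M := directSum S ⊗[k] directSum S) (fun i => TensorProduct.map (directSumIncl S i) (directSumIncl S i) ∘ₗ
      (S i).comul) i x
  · exact directSumLift_incl (M := directSum S ⊗[k] directSum S) (fun i => TensorProduct.map (directSumIncl S i) (directSumIncl S i) ∘ₗ
      (S i).cobracket) i x
  · exact (directSumLift_incl (M := directSum S) (fun i => directSumIncl S i ∘ₗ (S i).D) i x).symm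

theorem iSup_range_directSumIncl : ⨆ i, LinearMap.range (directSumIncl S i) = ⊤ := by
  rw [eq_top_iff]
  rintro (x : ⨁ i, S i) -
  induction x using DirectSum.induction_on with
  | zero => exact Submodule.zero_mem _
  | of i x => exact Submodule.mem_iSup_of_mem i ⟨x, rfl⟩
  | add x y hx hy => exact Submodule.add_mem _ hx hy

theorem directSumLift_comp_incl {M : Type*} [AddCommGroup M] [Module k M]
    (f : ∀ i, S i →ₗ[k] M) (i : ι) :
    directSumLift f ∘ₗ directSumIncl S i = f i :=
  LinearMap.ext fun x => directSumLift_incl f i x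

end DirectSum

/-! ### Transport of structure and models on standard spaces -/

section Transport

/-- Transport of structure along a linear isomorphism. -/
def transport (C : DCoalgebraOps k d) {A : Type u} [AddCommGroup A] [Module k A]
    (e : C ≃ₗ[k] A) : DCoalgebraOps k d where
  carrier := A
  gr n := (C.gr n).comap e.symm.toLinearMap
  internal := by
    refine DGSpace.isInternal_of_proj _
      (fun n => e.toLinearMap ∘ₗ C.proj n ∘ₗ e.symm.toLinearMap) ?_ ?_ ?_
    · intro n x hx
      simp [C.proj_of_mem (show e.symm x ∈ C.gr n from hx)]
    · intro m n hmn x hx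
      simp [C.proj_of_mem_ne (show e.symm x ∈ C.gr m from hx) hmn]
    · rw [eq_top_iff]
      rintro x -
      have := C.mem_of_proj_mem (Submodule.comap e.toLinearMap
        (⨆ n, (C.gr n).comap e.symm.toLinearMap)) (x := e.symm x) fun n => by
          refine Submodule.mem_iSup_of_mem n ?_
          simpa using C.proj_mem n (e.symm x)
      simpa using this
  D := e.toLinearMap ∘ₗ C.D ∘ₗ e.symm.toLinearMap
  D_mem n x hx := by simpa using C.D_mem n _ hx
  D_D x := by simp [C.D_D]
  comul := TensorProduct.map e.toLinearMap e.toLinearMap ∘ₗ C.comul ∘ₗ e.symm.toLinearMap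
  counit := C.counit ∘ₗ e.symm.toLinearMap
  cobracket := TensorProduct.map e.toLinearMap e.toLinearMap ∘ₗ C.cobracket ∘ₗ e.symm.toLinearMap

variable {C : DCoalgebraOps k d} {A : Type u} [AddCommGroup A] [Module k A]

theorem transport_isHom (e : C ≃ₗ[k] A) : C.IsHom (C.transport e) e.toLinearMap :=
  ⟨⟨fun n x hx => (show e.symm (e x) ∈ C.gr n by simpa),
    fun x => congrArg C.counit (e.symm_apply_apply x),
    fun x => congrArg (fun y => TensorProduct.map e.toLinearMap e.toLinearMap (C.comul y))
      (e.symm_apply_apply x),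
    fun x => congrArg (fun y => TensorProduct.map e.toLinearMap e.toLinearMap (C.cobracket y))
      (e.symm_apply_apply x)⟩,
    fun x => congrArg (fun y => e (C.D y)) (e.symm_apply_apply x).symm⟩

theorem IsHom.symm {E : DCoalgebraOps k d} {e : C ≃ₗ[k] E} (h : C.IsHom E e.toLinearMap) :
    E.IsHom C e.symm.toLinearMap := by
  have hc : e.symm.toLinearMap ∘ₗ e.toLinearMap = LinearMap.id := by ext; simp
  refine ⟨⟨fun n x hx => ?_, fun x => ?_, fun x => ?_, fun x => ?_⟩, fun x => ?_⟩
  · refine h.hasDegree.mem_of_injective e.injective ?_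
    simpa using hx
  · obtain ⟨y, rfl⟩ := e.surjective x
    simpa using (h.map_counit y).symm
  · obtain ⟨y, rfl⟩ := e.surjective x
    have := h.map_comul y
    rw [LinearEquiv.coe_coe] at this
    rw [this, TensorProduct.map_map, hc]
    simp
  · obtain ⟨y, rfl⟩ := e.surjective x
    have := h.map_cobracket y
    rw [LinearEquiv.coe_coe] at this
    rw [this, TensorProduct.map_map, hc]
    simp
  · obtain ⟨y, rfl⟩ := e.surjective x
    have := h.map_D y
    rw [LinearEquiv.coe_coe] at this
    simp [← this]

/-- The structures of `d`-coalgebra on the standard vector space of dimension `n`. -/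
structure StandardOps (k : Type u) [Field k] (n : ℕ) where
  gr : ℤ → Submodule k (Fin n → k)
  internal : DirectSum.IsInternal gr
  D : (Fin n → k) →ₗ[k] (Fin n → k)
  D_mem : ∀ (n : ℤ) (x : _), x ∈ gr n → D x ∈ gr (n + 1)
  D_D : ∀ x, D (D x) = 0
  comul : (Fin n → k) →ₗ[k] (Fin n → k) ⊗[k] (Fin n → k)
  counit : (Fin n → k) →ₗ[k] k
  cobracket : (Fin n → k) →ₗ[k] (Fin n → k) ⊗[k] (Fin n → k)

/-- The `d`-coalgebra defined by a structure on a standard vector space. -/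
abbrev StandardOps.toOps (d : ℤ) {n : ℕ} (s : StandardOps k n) : DCoalgebraOps k d where
  carrier := Fin n → k
  gr := s.gr
  internal := s.internal
  D := s.D
  D_mem := s.D_mem
  D_D := s.D_D
  comul := s.comul
  counit := s.counit
  cobracket := s.cobracket

/-- Makes the finite-dimensional objects, up to isomorphism, into a set in the universe of `k`, so
that their direct sum can be formed. -/
theorem exists_standardOps (C : DCoalgebraOps k d) [FiniteDimensional k C] :
    ∃ (n : ℕ) (s : StandardOps k n) (e : C ≃ₗ[k] (Fin n → k)),
      C.IsHom (s.toOps d) e.toLinearMap := by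
  let e : C ≃ₗ[k] (Fin (Module.finrank k C) → k) := (Module.finBasis k C).equivFun
  let T := C.transport e
  exact ⟨_, ⟨T.gr, T.internal, T.D, T.D_mem, T.D_D, T.comul, T.counit, T.cobracket⟩, e,
    transport_isHom e⟩

end Transport

/-! ### Representability of local conditions -/

section Representability

variable {M : Type u} [AddCommGroup M] [Module k M]

/-- A condition on linear maps from coproartinian `d`-coalgebras to `M` which is local in the
source. -/
structure IsLocal (Φ : ∀ S : DCoalgebraOps k d, (S →ₗ[k] M) → Prop) : Prop where
  pull : ∀ {S T : DCoalgebraOps k d} {g : S →ₗ[k] T} {f : T →ₗ[k] M}, S.IsCoproartinian →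
    T.IsCoproartinian → S.IsHom T g → Function.Injective g → Φ T f → Φ S (f ∘ₗ g)
  unit : ∀ {S T : DCoalgebraOps k d} {f : S →ₗ[k] M} {g : T →ₗ[k] M} {e : S} {e' : T}, Φ S f →
    Φ T g → S.IsGrouplike e → T.IsGrouplike e' → f e = g e'
  glue : ∀ {ι : Type u} [Nonempty ι] {S : ι → DCoalgebraOps k d} {T : DCoalgebraOps k d}
    {g : ∀ i, S i →ₗ[k] T} {f : T →ₗ[k] M}, (∀ i, (S i).IsCoproartinian) → T.IsCoproartinian →
    (∀ i, (S i).IsHom T (g i)) → ⨆ i, LinearMap.range (g i) = ⊤ → (∀ i, Φ (S i) (f ∘ₗ g i)) →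
    Φ T f
  inhabited : ∃ (S : DCoalgebraOps k d) (f : S →ₗ[k] M), S.IsCoproartinian ∧ Φ S f

/-- The constant morphism at a grouplike element. Comparing two of these into a simple object shows
that two grouplike elements coincide. -/
theorem isHom_smulRight_grouplike {C E : DCoalgebraOps k d} (hC : C.IsDCoalgebra) {e : E}
    (he : E.IsGrouplike e) (hgr : e ∈ E.gr 0) (hD : E.D e = 0) (hδ : E.cobracket e = 0) :
    C.IsHom E (C.counit.smulRight e) := by
  have h1 : ∀ t : C ⊗[k] C,
      TensorProduct.map (C.counit.smulRight e) (C.counit.smulRight e) t =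
        LinearMap.mul' k k (TensorProduct.map C.counit C.counit t) • (e ⊗ₜ[k] e) := by
    intro t
    induction t with
    | zero => simp
    | tmul x y => simp only [TensorProduct.map_tmul, LinearMap.smulRight_apply,
        TensorProduct.smul_tmul_smul, LinearMap.mul'_apply]
    | add a b ha hb => rw [map_add, map_add, map_add, ha, hb, add_smul]
  have h2 : ∀ t : C ⊗[k] C, LinearMap.mul' k k (TensorProduct.map C.counit C.counit t) =
      C.counit (TensorProduct.lid k C (TensorProduct.map C.counit LinearMap.id t)) := by
    intro t
    induction t with
    | zero => simp
    | tmul x y => simp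
    | add a b ha hb => simp only [map_add, ha, hb]
  refine ⟨⟨fun n x hx => ?_, fun x => ?_, fun x => ?_, fun x => ?_⟩, fun x => ?_⟩
  · rcases eq_or_ne n 0 with rfl | hn
    · exact Submodule.smul_mem _ _ hgr
    · rw [LinearMap.smulRight_apply, hC.counit_eq_zero n x hn hx, zero_smul]
      exact Submodule.zero_mem _
  · simp [he.2]
  · rw [h1, h2, (isDCoalgebra_iff.1 hC x).counit_comul, LinearMap.smulRight_apply, map_smul, he.1]
  · rw [h1, h2, (isDCoalgebra_iff.1 hC x).counit_cobracket, LinearMap.smulRight_apply, map_smul,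
      hδ]
    simp
  · simp [hC.counit_D, hD]

/-- Amalgamation of a family of coproartinian `d`-coalgebras over `M`. -/
theorem IsLocal.exists_amalgam {Φ : ∀ S : DCoalgebraOps k d, (S →ₗ[k] M) → Prop}
    (hΦ : IsLocal Φ) {ι : Type u} [Nonempty ι] (S : ι → DCoalgebraOps k d)
    (hS : ∀ i, (S i).IsCoproartinian) (f : ∀ i, S i →ₗ[k] M) (hf : ∀ i, Φ (S i) (f i)) :
    ∃ (K : DCoalgebraOps k d) (ev : K →ₗ[k] M) (j : ∀ i, S i →ₗ[k] K), K.IsCoproartinian ∧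
      Φ K ev ∧ K.IsSimple ev ∧ (∀ i, (S i).IsHom K (j i)) ∧ (∀ i, ev ∘ₗ j i = f i) ∧
      ⨆ i, LinearMap.range (j i) = ⊤ := by
  let F := directSumLift f
  let K := (directSum S).simpleQuotient F
  let ev : K →ₗ[k] M := simpleLift F
  let j : ∀ i, S i →ₗ[k] K := fun i => simpleMk F ∘ₗ directSumIncl S i
  have hj : ∀ i, (S i).IsHom K (j i) := fun i => (simpleMk_isHom F).comp (directSumIncl_isHom i)
  have hev : ∀ i, ev ∘ₗ j i = f i := fun i => by
    rw [← directSumLift_comp_incl f i, ← LinearMap.comp_assoc]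
    exact congrArg (· ∘ₗ _) (simpleLift_comp_mk F)
  have hsimple : K.IsSimple ev := simpleLift_isSimple F
  have hr : ⨆ i, LinearMap.range (j i) = ⊤ := by
    have h1 : ∀ i, LinearMap.range (j i) =
        (LinearMap.range (directSumIncl S i)).map (simpleMk F) := fun i =>
      LinearMap.range_comp _ _
    rw [iSup_congr h1, ← Submodule.map_iSup, iSup_range_directSumIncl, Submodule.map_top,
      LinearMap.range_eq_top]
    exact simpleMk_surjective F
  choose e he using fun i => (hS i).exists_isGrouplike
  -- The constant morphisms at these two grouplike elements agree after `ev`, by the `unit` clause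
  -- of locality, and `K` is simple. This is what allows the amalgam to be coproartinian.
  have hje : ∀ i i', j i (e i) = j i' (e i') := by
    intro i i'
    have hom : ∀ l, (S i).IsHom K ((S i).counit.smulRight (j l (e l))) := fun l =>
      isHom_smulRight_grouplike (hS i).isDCoalgebra ((he l).map (hj l).toIsGradedHom)
        ((hj l).map_mem 0 _ ((hS l).grouplike_mem_gr (he l)))
        (by rw [← (hj l).map_D, (hS l).D_grouplike (he l), map_zero])
        (by rw [(hj l).map_cobracket, (hS l).cobracket_grouplike (he l), map_zero])
    have h1 := hsimple.hom_ext (hom i) (hom i') (by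
      ext x
      have h2 := LinearMap.congr_fun (hev i) (e i)
      have h3 := LinearMap.congr_fun (hev i') (e i')
      simp only [LinearMap.comp_apply] at h2 h3
      simp only [LinearMap.comp_apply, LinearMap.smulRight_apply, map_smul, h2, h3,
        hΦ.unit (hf i) (hf i') (he i) (he i')])
    have h2 := LinearMap.congr_fun h1 (e i)
    simpa [(he i).2] using h2
  obtain ⟨i₀⟩ := ‹Nonempty ι›
  have hK : K.IsCoproartinian :=
    have : Nonempty ι := ⟨i₀⟩
    isCoproartinian_of_jointly_surjective hS hj hr (e := j i₀ (e i₀)) fun i e' he' => by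
      rw [(hS i).grouplike_unique he' (he i), hje]
  have : Nonempty ι := ⟨i₀⟩
  exact ⟨K, ev, j, hK, hΦ.glue hS hK hj hr (fun i => by rw [hev]; exact hf i), hsimple, hj, hev, hr⟩

/-- The amalgam `H` of all finite-dimensional objects on standard spaces is universal. Uniqueness is
simplicity; for existence, amalgamating `H` with any further object `T` adds nothing to `H`, because
`T` is locally finite. -/
theorem IsLocal.exists_universal {Φ : ∀ S : DCoalgebraOps k d, (S →ₗ[k] M) → Prop}
    (hΦ : IsLocal Φ) :
    ∃ (H : DCoalgebraOps k d) (ev : H →ₗ[k] M), H.IsCoproartinian ∧ Φ H ev ∧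
      ∀ S : DCoalgebraOps k d, S.IsCoproartinian → ∀ f : S →ₗ[k] M, Φ S f →
        ∃! g : S →ₗ[k] H, S.IsHom H g ∧ ev ∘ₗ g = f := by
  let ι : Type u := {p : Σ n : ℕ, StandardOps k n × ((Fin n → k) →ₗ[k] M) //
    (p.2.1.toOps d).IsCoproartinian ∧ Φ (p.2.1.toOps d) p.2.2}
  -- every finite-dimensional object is isomorphic to a member of the family
  have fin : ∀ (A : DCoalgebraOps k d) [FiniteDimensional k A], A.IsCoproartinian →
      ∀ f : A →ₗ[k] M, Φ A f → ∃ (i : ι) (e : A →ₗ[k] i.1.2.1.toOps d),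
        A.IsHom (i.1.2.1.toOps d) e ∧ i.1.2.2 ∘ₗ e = f := by
    intro A _ hA f hf
    obtain ⟨n, s, e, he⟩ := exists_standardOps A
    have he' := IsHom.symm (E := s.toOps d) he
    obtain ⟨a, ha⟩ := hA.exists_isGrouplike
    have hs : (s.toOps d).IsCoproartinian :=
      isCoproartinian_of_injective he' e.symm.injective hA (e := e a) (by simpa using ha)
    refine ⟨⟨⟨n, s, f ∘ₗ e.symm.toLinearMap⟩, hs,
      hΦ.pull (S := s.toOps d) hs hA he' e.symm.injective hf⟩, e.toLinearMap, he, ?_⟩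
    ext x
    simp
  have hne : Nonempty ι := by
    obtain ⟨S, f, hS, hf⟩ := hΦ.inhabited
    obtain ⟨e, he⟩ := hS.exists_isGrouplike
    obtain ⟨A, hA, -⟩ := hS.exists_isFiniteSub he 0
    have : FiniteDimensional k (S.restrict A hA.sub) := hA.finite
    have hA' : (S.restrict A hA.sub).IsCoproartinian :=
      isCoproartinian_of_injective (inclusion_isHom hA.sub) (inclusion_injective hA.sub) hS
        (e := (⟨e, hA.one_mem⟩ : A)) he
    obtain ⟨i, -⟩ := fin _ hA' _ (hΦ.pull hA' hS (inclusion_isHom hA.sub)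
      (inclusion_injective hA.sub) hf)
    exact ⟨i⟩
  obtain ⟨H, ev, j, hH, hev, hsimple, hj, hevj, -⟩ := hΦ.exists_amalgam
    (fun i : ι => i.1.2.1.toOps d) (fun i => i.2.1) (fun i => i.1.2.2) (fun i => i.2.2)
  refine ⟨H, ev, hH, hev, fun T hT f hf => ?_⟩
  refine existsUnique_of_exists_of_unique ?_ fun a b ha hb =>
    hsimple.hom_ext ha.1 hb.1 (ha.2.trans hb.2.symm)
  -- Amalgamate the pair `H`, `T`, indexed by a lifted `Bool` to stay in the right universe.
  obtain ⟨K, ev', j', -, -, hsimple', hj', hevj', hr⟩ := hΦ.exists_amalgam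
    (fun b : ULift.{u} Bool => cond b.down H T)
    (fun b => by rcases b with ⟨_ | _⟩ <;> assumption)
    (fun b => match b with
      | ⟨true⟩ => ev
      | ⟨false⟩ => f)
    (fun b => by rcases b with ⟨_ | _⟩ <;> assumption)
  let a : H →ₗ[k] K := j' ⟨true⟩
  let b : T →ₗ[k] K := j' ⟨false⟩
  have ha : H.IsHom K a := hj' ⟨true⟩
  have hb : T.IsHom K b := hj' ⟨false⟩
  have hea : ev' ∘ₗ a = ev := hevj' ⟨true⟩
  have heb : ev' ∘ₗ b = f := hevj' ⟨false⟩
  have hinj : Function.Injective a := hsimple.injective ha ev' hea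
  -- A finite-dimensional subcoalgebra of `T` containing `x` reaches `K` in two ways, through `T`
  -- and, as a member of the family, through `H`. Both agree after `ev'`, so they agree by
  -- simplicity of `K`.
  have hba : ∀ x, b x ∈ LinearMap.range a := by
    intro x
    obtain ⟨e, he⟩ := hT.exists_isGrouplike
    obtain ⟨A, hA, hx⟩ := hT.exists_isFiniteSub he x
    have : FiniteDimensional k (T.restrict A hA.sub) := hA.finite
    have hi := inclusion_isHom hA.sub
    have hA' : (T.restrict A hA.sub).IsCoproartinian :=
      isCoproartinian_of_injective hi (inclusion_injective hA.sub) hT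
        (e := (⟨e, hA.one_mem⟩ : A)) he
    obtain ⟨i, c, hc, hcf⟩ := fin _ hA' _ (hΦ.pull hA' hT hi (inclusion_injective hA.sub) hf)
    have h1 := hsimple'.hom_ext (hb.comp hi) (ha.comp ((hj i).comp hc)) (by
      rw [← LinearMap.comp_assoc, heb, ← LinearMap.comp_assoc, hea, ← LinearMap.comp_assoc, hevj,
        hcf])
    have h2 := LinearMap.congr_fun h1 (⟨x, hx⟩ : A)
    exact ⟨_, h2.symm⟩
  have hsurj : Function.Surjective a := by
    rw [← LinearMap.range_eq_top, eq_top_iff, ← hr]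
    refine iSup_le fun i => ?_
    rcases i with ⟨_ | _⟩
    · rintro _ ⟨x, rfl⟩
      exact hba x
    · exact le_rfl
  let e : H ≃ₗ[k] K := LinearEquiv.ofBijective a ⟨hinj, hsurj⟩
  have he : H.IsHom K e.toLinearMap := ha
  refine ⟨e.symm.toLinearMap ∘ₗ b, he.symm.comp hb, ?_⟩
  ext x
  have h1 : a (e.symm (b x)) = b x := e.apply_symm_apply _
  have h2 := LinearMap.congr_fun hea (e.symm (b x))
  have h3 := LinearMap.congr_fun heb x
  simp only [LinearMap.comp_apply] at h2 h3 ⊢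
  exact h2.symm.trans ((congrArg ev' h1).trans h3)

end Representability

end DCoalgebraOps

/-! ### Shuffles and rotations of threefold tensor powers -/

namespace DGSpace

variable {k : Type u} [Field k]

theorem sgn_zero (M : DGSpace k) : M.sgn 0 = LinearMap.id :=
  M.hom_ext fun i x hx => by simp [M.sgn_apply' 0 hx, koszulSign_zero]

/-- The signed shuffle `((x ⊗ y) ⊗ z) ⊗ ((x' ⊗ y') ⊗ z') ↦ ± ((x ⊗ x') ⊗ (y ⊗ y')) ⊗ (z ⊗ z')`. -/
def shuffle₃ (M N : DGSpace k) : ((M ⊗[k] M) ⊗[k] M) ⊗[k] ((N ⊗[k] N) ⊗[k] N) →ₗ[k]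
    ((M ⊗[k] N) ⊗[k] (M ⊗[k] N)) ⊗[k] (M ⊗[k] N) :=
  TensorProduct.map (interchange M N) LinearMap.id ∘ₗ
    interchange₄ (M.tensor M) M (N.tensor N) N

/-- The signed shuffle `(x ⊗ (y ⊗ z)) ⊗ (x' ⊗ (y' ⊗ z')) ↦ ± (x ⊗ x') ⊗ ((y ⊗ y') ⊗ (z ⊗ z'))`. -/
def shuffle₃' (M N : DGSpace k) : (M ⊗[k] (M ⊗[k] M)) ⊗[k] (N ⊗[k] (N ⊗[k] N)) →ₗ[k]
    (M ⊗[k] N) ⊗[k] ((M ⊗[k] N) ⊗[k] (M ⊗[k] N)) :=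
  TensorProduct.map LinearMap.id (interchange M N) ∘ₗ
    interchange₄ M (M.tensor M) N (N.tensor N)

theorem assoc_comp_shuffle₃ (M N : DGSpace k) :
    (TensorProduct.assoc k (M ⊗[k] N) (M ⊗[k] N) (M ⊗[k] N)).toLinearMap ∘ₗ shuffle₃ M N =
      shuffle₃' M N ∘ₗ TensorProduct.map (TensorProduct.assoc k M M M).toLinearMap
        (TensorProduct.assoc k N N N).toLinearMap := by
  refine tensor_hom_ext₆ M M M N N N fun i x hx j y hy l z hz i' x' hx' j' y' hy' l' z' hz' => ?_
  simp only [shuffle₃, shuffle₃', LinearMap.comp_apply, LinearEquiv.coe_coe,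
    TensorProduct.map_tmul, TensorProduct.assoc_tmul, interchange_eq,
    interchange₄_tmul (M.tensor M) M (N.tensor N) N _ _ hz (tmul_mem N N hx' hy'),
    interchange₄_tmul M (M.tensor M) N (N.tensor N) _ _ (tmul_mem M M hy hz) hx', map_smul,
    interchange₄_tmul M M N N _ _ hy hx', interchange₄_tmul M M N N _ _ hz hy', LinearMap.id_apply,
    TensorProduct.tmul_smul, ← TensorProduct.smul_tmul', smul_smul, ← koszulSign_add]
  congr 1
  exact koszulSign_congr (by push_cast; grind)

theorem swap_comp_shuffle₃ (M N : DGSpace k) :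
    swap ((M.tensor N).tensor (M.tensor N)) (M.tensor N) ∘ₗ shuffle₃ M N =
      shuffle₃' M N ∘ₗ TensorProduct.map (swap (M.tensor M) M) (swap (N.tensor N) N) := by
  have h1 := swap_comp_map (hasDegree_interchange₄ M M N N) (hasDegree_id (M.tensor N))
  have h2 := swap_comp_interchange₄ (M.tensor M) M (N.tensor N) N
  calc _ = (swap ((M.tensor N).tensor (M.tensor N)) (M.tensor N) ∘ₗ
        TensorProduct.map (interchange M N) LinearMap.id) ∘ₗ
          interchange₄ (M.tensor M) M (N.tensor N) N := rfl
    _ = (TensorProduct.map LinearMap.id (interchange M N) ∘ₗ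
        swap ((M.tensor M).tensor (N.tensor N)) (M.tensor N)) ∘ₗ
          interchange₄ (M.tensor M) M (N.tensor N) N := congrArg (· ∘ₗ _) h1
    _ = TensorProduct.map LinearMap.id (interchange M N) ∘ₗ
          interchange₄ M (M.tensor M) N (N.tensor N) ∘ₗ
            TensorProduct.map (swap (M.tensor M) M) (swap (N.tensor N) N) := by
        rw [← h2]; rfl

/-- The rotation on the tensor product becomes the simultaneous rotation of both triples, so cyclic
sums can be computed factor by factor. -/
theorem cyc_comp_shuffle₃ (M N : DGSpace k) :
    (M.tensor N).cyc ∘ₗ shuffle₃ M N =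
      shuffle₃ M N ∘ₗ TensorProduct.map M.cyc N.cyc := by
  have h1 := swap_comp_shuffle₃ M N
  have h2 : (TensorProduct.assoc k (M ⊗[k] N) (M ⊗[k] N) (M ⊗[k] N)).symm.toLinearMap ∘ₗ
      shuffle₃' M N = shuffle₃ M N ∘ₗ TensorProduct.map (TensorProduct.assoc k M M M).symm.toLinearMap
        (TensorProduct.assoc k N N N).symm.toLinearMap := by
    refine LinearMap.ext fun t => ?_
    have h3 := LinearMap.congr_fun (assoc_comp_shuffle₃ M N)
      (TensorProduct.map (TensorProduct.assoc k M M M).symm.toLinearMap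
        (TensorProduct.assoc k N N N).symm.toLinearMap t)
    rw [LinearMap.comp_apply, LinearMap.comp_apply, TensorProduct.map_map,
      LinearEquiv.comp_symm, LinearEquiv.comp_symm, TensorProduct.map_id] at h3
    rw [LinearMap.comp_apply, LinearEquiv.coe_coe, LinearEquiv.symm_apply_eq]
    exact h3.symm
  calc _ = (TensorProduct.assoc k (M ⊗[k] N) (M ⊗[k] N) (M ⊗[k] N)).symm.toLinearMap ∘ₗ
        (swap ((M.tensor N).tensor (M.tensor N)) (M.tensor N) ∘ₗ shuffle₃ M N) := rfl
    _ = ((TensorProduct.assoc k (M ⊗[k] N) (M ⊗[k] N) (M ⊗[k] N)).symm.toLinearMap ∘ₗ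
        shuffle₃' M N) ∘ₗ TensorProduct.map (swap (M.tensor M) M) (swap (N.tensor N) N) := by
        rw [h1]; rfl
    _ = _ := by rw [h2, LinearMap.comp_assoc, ← TensorProduct.map_comp]; rfl

theorem id_swap_comp_shuffle₃' (M N : DGSpace k) :
    TensorProduct.map LinearMap.id (swap (M.tensor N) (M.tensor N)) ∘ₗ shuffle₃' M N =
      shuffle₃' M N ∘ₗ TensorProduct.map (TensorProduct.map LinearMap.id (swap M M))
        (TensorProduct.map LinearMap.id (swap N N)) := by
  have h1 := swap_comp_interchange₄ M M N N
  have h2 := interchange₄_comp_map (A := M) (B := M.tensor M) (B₁ := M.tensor M) (A' := N) (A₁ := M)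
    (A₁' := N) (B' := N.tensor N) (B₁' := N.tensor N) LinearMap.id (f' := LinearMap.id)
    (swap N N) (hasDegree_swap M M) (hasDegree_id N)
  simp only [TensorProduct.map_id] at h2
  rw [shuffle₃', LinearMap.comp_assoc, h2, ← LinearMap.comp_assoc, ← LinearMap.comp_assoc,
    ← TensorProduct.map_comp, ← TensorProduct.map_comp, interchange_eq, h1]

theorem cyc_tmul (M : DGSpace k) {i j l : ℤ} {x y z : M} (hx : x ∈ M.gr i) (hy : y ∈ M.gr j)
    (hz : z ∈ M.gr l) :
    M.cyc ((x ⊗ₜ y) ⊗ₜ z) = koszulSign k ((i + j) * l) • ((z ⊗ₜ[k] x) ⊗ₜ[k] y) := by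
  simp only [cyc, LinearMap.comp_apply, swap_tmul (M.tensor M) M (tmul_mem M M hx hy) hz, map_smul,
    LinearEquiv.coe_coe, TensorProduct.assoc_symm_tmul]

theorem cyc_cyc_cyc (M : DGSpace k) : M.cyc ∘ₗ M.cyc ∘ₗ M.cyc = LinearMap.id := by
  refine tensor_hom_ext₃ M M M fun i x hx j y hy l z hz => ?_
  simp only [LinearMap.comp_apply, cyc_tmul M hx hy hz, cyc_tmul M hz hx hy, cyc_tmul M hy hz hx,
    map_smul, smul_smul, ← koszulSign_add, LinearMap.id_apply]
  rw [koszulSign_congr (n := 0) (by push_cast; grind), koszulSign_zero, one_smul]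

/-- In the symmetric group on three letters, the transposition of the last two is the transposition
of the first two followed by the square of the rotation; the Koszul signs respect this relation. -/
theorem id_swap_comp_assoc (M : DGSpace k) :
    TensorProduct.map LinearMap.id (swap M M) ∘ₗ (TensorProduct.assoc k M M M).toLinearMap =
      (TensorProduct.assoc k M M M).toLinearMap ∘ₗ M.cyc ∘ₗ M.cyc ∘ₗ
        TensorProduct.map (swap M M) LinearMap.id := by
  refine tensor_hom_ext₃ M M M fun i x hx j y hy l z hz => ?_
  simp only [LinearMap.comp_apply, TensorProduct.map_tmul, swap_tmul M M hx hy,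
    LinearMap.id_apply, ← TensorProduct.smul_tmul', cyc_tmul M hy hx hz, cyc_tmul M hz hy hx,
    map_smul, smul_smul, ← koszulSign_add, LinearEquiv.coe_coe, TensorProduct.assoc_tmul,
    swap_tmul M M hy hz, TensorProduct.tmul_smul]
  congr 1
  exact koszulSign_congr (by push_cast; grind)

/-- Applying an operator with values in a tensor product to the left factor. -/
theorem interchange_left (M N : DGSpace k) {q : ℤ} (f : M →ₗ[k] M ⊗[k] M)
    {f' : N →ₗ[k] N ⊗[k] N} (hf' : HasDegree N (N.tensor N) q f') :
    TensorProduct.map (interchange M N ∘ₗ TensorProduct.map f f') LinearMap.id ∘ₗ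
        interchange M N =
      shuffle₃ M N ∘ₗ TensorProduct.map (TensorProduct.map f (M.sgn q))
        (TensorProduct.map f' LinearMap.id) := by
  have h := map_left_comp_interchange₄ (A := M) (B := M) (A' := N) (B' := N)
    (A₁ := M.tensor M) (A₁' := N.tensor N) f hf'
  calc _ = TensorProduct.map (interchange M N) LinearMap.id ∘ₗ
        (TensorProduct.map (TensorProduct.map f f') LinearMap.id ∘ₗ interchange₄ M M N N) := by
        rw [← LinearMap.comp_assoc, ← TensorProduct.map_comp]; rfl
    _ = _ := by rw [h]; rfl

/-- Applying an operator with values in a tensor product to the right factor. -/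
theorem interchange_right (M N : DGSpace k) {q : ℤ} (r : ℤ) {f : M →ₗ[k] M ⊗[k] M}
    (f' : N →ₗ[k] N ⊗[k] N) (hf : HasDegree M (M.tensor M) q f) :
    TensorProduct.map ((M.tensor N).sgn r) (interchange M N ∘ₗ TensorProduct.map f f') ∘ₗ
        interchange M N =
      shuffle₃' M N ∘ₗ TensorProduct.map (TensorProduct.map (M.sgn r) f)
        (TensorProduct.map (N.sgn (r - q)) f') := by
  have h := map_right_comp_interchange₄ (A := M) (B := M) (A' := N) (B' := N)
    (B₁ := M.tensor M) (B₁' := N.tensor N) (r := r) f' hf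
  calc _ = TensorProduct.map LinearMap.id (interchange M N) ∘ₗ
        (TensorProduct.map ((M.tensor N).sgn r) (TensorProduct.map f f') ∘ₗ
          interchange₄ M M N N) := by
        rw [← LinearMap.comp_assoc, ← TensorProduct.map_comp]; rfl
    _ = _ := by rw [h]; rfl

end DGSpace

/-- The cyclic sum appearing in the co-Jacobi identity for a tensor product. -/
theorem LinearMap.rotation_sum_eq_zero {k C E A B : Type u} [Field k] [AddCommGroup A]
    [AddCommGroup B] [AddCommGroup C] [AddCommGroup E] [Module k A] [Module k B] [Module k C]
    [Module k E] (a : A →ₗ[k] A) (b : B →ₗ[k] B) (ha : a ∘ₗ a ∘ₗ a = LinearMap.id)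
    (hb : b ∘ₗ b ∘ₗ b = LinearMap.id) (ε ε' : k) (hε : ε * ε = 1) (hε' : ε' = -ε)
    {J R : C →ₗ[k] A} {J' R' : E →ₗ[k] B} (hJ : (LinearMap.id + a + a ∘ₗ a) ∘ₗ J = 0)
    (hJ' : (LinearMap.id + b + b ∘ₗ b) ∘ₗ J' = 0) (hR : a ∘ₗ R = R) (hR' : b ∘ₗ R' = R')
    (P : C →ₗ[k] A) (P' : E →ₗ[k] B) (s : C →ₗ[k] C) :
    (LinearMap.id + TensorProduct.map a b + TensorProduct.map (a ∘ₗ a) (b ∘ₗ b)) ∘ₗ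
      (TensorProduct.map J R' +
        ε' • TensorProduct.map ((a ∘ₗ P + ε • (a ∘ₗ a ∘ₗ P)) ∘ₗ s) P' +
        (TensorProduct.map (P ∘ₗ s) (b ∘ₗ P' + ε • (b ∘ₗ b ∘ₗ P')) +
        TensorProduct.map R J')) = 0 := by
  refine TensorProduct.ext' fun x y => ?_
  have ha' : ∀ t, a (a (a t)) = t := LinearMap.congr_fun ha
  have hb' : ∀ t, b (b (b t)) = t := LinearMap.congr_fun hb
  have hJx : J x + a (J x) + a (a (J x)) = 0 := LinearMap.congr_fun hJ x
  have hJy : J' y + b (J' y) + b (b (J' y)) = 0 := LinearMap.congr_fun hJ' y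
  have hRx : a (R x) = R x := LinearMap.congr_fun hR x
  have hRy : b (R' y) = R' y := LinearMap.congr_fun hR' y
  have e1 : J x ⊗ₜ[k] R' y + a (J x) ⊗ₜ[k] R' y + a (a (J x)) ⊗ₜ[k] R' y = 0 := by
    rw [← TensorProduct.add_tmul, ← TensorProduct.add_tmul]
    rw [hJx, TensorProduct.zero_tmul]
  have e2 : R x ⊗ₜ[k] J' y + R x ⊗ₜ[k] b (J' y) + R x ⊗ₜ[k] b (b (J' y)) = 0 := by
    rw [← TensorProduct.tmul_add, ← TensorProduct.tmul_add]
    rw [hJy, TensorProduct.tmul_zero]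
  -- The terms `e1` and `e2` are the unmixed ones. For the mixed ones, as `a` and `b` have order
  -- three, the orbit sum of `aP ⊗ P'` is that of `P ⊗ b²P'`, and the orbit sum of `a²P ⊗ P'` is
  -- that of `P ⊗ bP'`. With coefficients `ε' = -ε` and `ε'ε = -1` they cancel against the orbit
  -- sums of `ε P ⊗ b²P'` and `P ⊗ bP'`.
  have e3 : ε' * ε = -1 := by rw [hε', neg_mul, hε]
  simp only [LinearMap.comp_apply, LinearMap.add_apply, LinearMap.id_apply, LinearMap.smul_apply,
    TensorProduct.map_tmul, map_add, map_smul, TensorProduct.tmul_add, TensorProduct.add_tmul,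
    TensorProduct.tmul_smul, ← TensorProduct.smul_tmul', smul_add, smul_smul, ha', hb', hRx, hRy,
    LinearMap.zero_apply, e3]
  rw [hε']
  linear_combination (norm := module) e1 + e2

/-! ### The tensor product of `d`-coalgebras is a `d`-coalgebra -/

namespace DCoalgebraOps

variable {k : Type u} [Field k] {d : ℤ}

namespace IsDCoalgebra

variable {C E : DCoalgebraOps k d}

theorem hasDegree_comul (h : C.IsDCoalgebra) :
    DGSpace.HasDegree C.toDGSpace (C.toDGSpace.tensor C.toDGSpace) 0 C.comul :=
  DGSpace.hasDegree_zero_iff.2 h.comul_mem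

theorem hasDegree_cobracket (h : C.IsDCoalgebra) :
    DGSpace.HasDegree C.toDGSpace (C.toDGSpace.tensor C.toDGSpace) (1 - d) C.cobracket :=
  h.cobracket_mem

theorem sgn_comul (h : C.IsDCoalgebra) (q : ℤ) :
    TensorProduct.map (C.sgn q) (C.sgn q) ∘ₗ C.comul = C.comul ∘ₗ C.sgn q := by
  rw [← DGSpace.sgn_tensor, h.hasDegree_comul.sgn_comp_zero]

theorem sgn_cobracket (h : C.IsDCoalgebra) (q : ℤ) :
    TensorProduct.map (C.sgn q) (C.sgn q) ∘ₗ C.cobracket =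
      koszulSign k (q * (1 - d)) • (C.cobracket ∘ₗ C.sgn q) := by
  rw [← DGSpace.sgn_tensor, h.hasDegree_cobracket.sgn_comp]

theorem swap_id_coassoc (h : C.IsDCoalgebra) :
    TensorProduct.map LinearMap.id (DGSpace.swap C.toDGSpace C.toDGSpace) ∘ₗ
      TensorProduct.map LinearMap.id C.comul ∘ₗ C.comul =
    TensorProduct.map LinearMap.id C.comul ∘ₗ C.comul := by
  rw [← LinearMap.comp_assoc, ← TensorProduct.map_comp, h.cocomm, LinearMap.comp_id]

theorem swap_comul_id (h : C.IsDCoalgebra) :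
    DGSpace.swap (C.toDGSpace.tensor C.toDGSpace) C.toDGSpace ∘ₗ
      TensorProduct.map C.comul LinearMap.id ∘ₗ C.comul =
    TensorProduct.map LinearMap.id C.comul ∘ₗ C.comul := by
  have := DGSpace.swap_comp_map_left (N := C.toDGSpace) h.hasDegree_comul
  rw [← LinearMap.comp_assoc, this, LinearMap.comp_assoc, h.cocomm, DGSpace.sgn_zero]

theorem swap_cobracket_id (h : C.IsDCoalgebra) :
    DGSpace.swap (C.toDGSpace.tensor C.toDGSpace) C.toDGSpace ∘ₗ
      TensorProduct.map C.cobracket LinearMap.id ∘ₗ C.comul =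
    TensorProduct.map (C.sgn (1 - d)) C.cobracket ∘ₗ C.comul := by
  have := DGSpace.swap_comp_map_left (N := C.toDGSpace) h.hasDegree_cobracket
  rw [← LinearMap.comp_assoc, this, LinearMap.comp_assoc, h.cocomm]

/-- By cocommutativity and coassociativity the iterated coproduct is invariant under rotation. -/
theorem cyc_comul_id (h : C.IsDCoalgebra) :
    C.cyc ∘ₗ TensorProduct.map C.comul LinearMap.id ∘ₗ C.comul =
      TensorProduct.map C.comul LinearMap.id ∘ₗ C.comul := by
  rw [DGSpace.cyc, LinearMap.comp_assoc, h.swap_comul_id, ← h.coassoc, ← LinearMap.comp_assoc]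
  simp

/-- The co-Leibniz rule expresses `(Δ ⊗ 1) δ` through the cyclic rotations of `(δ ⊗ 1) Δ`. -/
theorem comul_id_cobracket (h : C.IsDCoalgebra) :
    TensorProduct.map C.comul LinearMap.id ∘ₗ C.cobracket =
      C.cyc ∘ₗ TensorProduct.map C.cobracket LinearMap.id ∘ₗ C.comul +
        koszulSign k d • (C.cyc ∘ₗ C.cyc ∘ₗ
          TensorProduct.map C.cobracket LinearMap.id ∘ₗ C.comul) := by
  refine LinearMap.ext fun x => (TensorProduct.assoc k C C C).injective ?_
  have h1 := LinearMap.congr_fun h.coleibniz x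
  have h2 := LinearMap.congr_fun h.swap_cobracket_id x
  have h3 := LinearMap.congr_fun (DGSpace.id_swap_comp_assoc C.toDGSpace)
    (TensorProduct.map C.cobracket LinearMap.id (C.comul x))
  have h4 : TensorProduct.map (DGSpace.swap C.toDGSpace C.toDGSpace) LinearMap.id
      (TensorProduct.map C.cobracket LinearMap.id (C.comul x)) =
      koszulSign k d • TensorProduct.map C.cobracket LinearMap.id (C.comul x) := by
    rw [TensorProduct.map_map, h.cobracket_swap, LinearMap.comp_id]
    have : (d.negOnePow • C.cobracket : C →ₗ[k] C ⊗[k] C) = koszulSign k d • C.cobracket :=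
      negOnePow_smul_eq _ _
    rw [this, TensorProduct.map_smul_left, LinearMap.smul_apply]
  simp only [LinearMap.comp_apply, LinearEquiv.coe_coe] at h1 h2 h3
  have h5 : ∀ t, TensorProduct.assoc k C C C (C.cyc t) =
      DGSpace.swap (C.toDGSpace.tensor C.toDGSpace) C.toDGSpace t := fun t => by
    simp [DGSpace.cyc]
  rw [LinearMap.comp_apply, h1]
  simp only [LinearMap.add_apply, LinearMap.comp_apply, LinearEquiv.coe_coe]
  rw [← h2, h3, h4]
  simp only [LinearMap.smul_apply, LinearMap.comp_apply, map_add, map_smul, h5]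

end IsDCoalgebra

section Tensor

variable {C E : DCoalgebraOps k d}

/-- Replaces `d - 1` by `1 - d`, which gives the same sign operator, so that the operator carries
the degree of the cobracket. -/
theorem tensor_cobracket (C E : DCoalgebraOps k d) : (C.tensor E).cobracket =
    DGSpace.interchange C.toDGSpace E.toDGSpace ∘ₗ (TensorProduct.map C.cobracket E.comul +
      TensorProduct.map (C.comul ∘ₗ C.sgn (1 - d)) E.cobracket) := by
  rw [C.sgn_congr (q := 1 - d) (r := d - 1) (by push_cast; grind)]

theorem comul_id_interchange (C : DCoalgebraOps k d) (hE : E.IsDCoalgebra) :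
    TensorProduct.map (C.tensor E).comul LinearMap.id ∘ₗ
        DGSpace.interchange C.toDGSpace E.toDGSpace =
      DGSpace.shuffle₃ C.toDGSpace E.toDGSpace ∘ₗ
        TensorProduct.map (TensorProduct.map C.comul LinearMap.id)
          (TensorProduct.map E.comul LinearMap.id) := by
  have := DGSpace.interchange_left C.toDGSpace E.toDGSpace C.comul hE.hasDegree_comul
  rwa [DGSpace.sgn_zero] at this

/-- In the second summand `sgn (1 - d)` acts on both copies of `C`: on one by the definition of the
cobracket of a tensor product, on the other because the cobracket of `E` is moved past it. -/
theorem cobracket_id_interchange (C : DCoalgebraOps k d) (hE : E.IsDCoalgebra) :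
    TensorProduct.map (C.tensor E).cobracket LinearMap.id ∘ₗ
        DGSpace.interchange C.toDGSpace E.toDGSpace =
      DGSpace.shuffle₃ C.toDGSpace E.toDGSpace ∘ₗ
        (TensorProduct.map (TensorProduct.map C.cobracket LinearMap.id)
          (TensorProduct.map E.comul LinearMap.id) +
        TensorProduct.map (TensorProduct.map C.comul LinearMap.id ∘ₗ
            TensorProduct.map (C.sgn (1 - d)) (C.sgn (1 - d)))
          (TensorProduct.map E.cobracket LinearMap.id)) := by
  have h1 := DGSpace.interchange_left C.toDGSpace E.toDGSpace C.cobracket hE.hasDegree_comul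
  have h2 := DGSpace.interchange_left C.toDGSpace E.toDGSpace (C.comul ∘ₗ C.sgn (1 - d))
    hE.hasDegree_cobracket
  rw [DGSpace.sgn_zero] at h1
  rw [tensor_cobracket, LinearMap.comp_add, TensorProduct.map_add_left, LinearMap.add_comp, h1, h2,
    ← LinearMap.comp_add, ← TensorProduct.map_comp, LinearMap.id_comp]

theorem id_comul_interchange (hC : C.IsDCoalgebra) (E : DCoalgebraOps k d) :
    TensorProduct.map LinearMap.id (C.tensor E).comul ∘ₗ
        DGSpace.interchange C.toDGSpace E.toDGSpace =
      DGSpace.shuffle₃' C.toDGSpace E.toDGSpace ∘ₗ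
        TensorProduct.map (TensorProduct.map LinearMap.id C.comul)
          (TensorProduct.map LinearMap.id E.comul) := by
  have := DGSpace.interchange_right C.toDGSpace E.toDGSpace 0 E.comul hC.hasDegree_comul
  rwa [DGSpace.sgn_zero, sub_zero, DGSpace.sgn_zero, DGSpace.sgn_zero] at this

theorem sgn_cobracket_interchange (hC : C.IsDCoalgebra) (E : DCoalgebraOps k d) :
    TensorProduct.map ((C.tensor E).sgn (1 - d)) (C.tensor E).cobracket ∘ₗ
        DGSpace.interchange C.toDGSpace E.toDGSpace =
      DGSpace.shuffle₃' C.toDGSpace E.toDGSpace ∘ₗ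
        (TensorProduct.map (TensorProduct.map (C.sgn (1 - d)) C.cobracket)
          (TensorProduct.map LinearMap.id E.comul) +
        TensorProduct.map (TensorProduct.map LinearMap.id C.comul ∘ₗ
            TensorProduct.map (C.sgn (1 - d)) (C.sgn (1 - d)))
          (TensorProduct.map (E.sgn (1 - d)) E.cobracket)) := by
  have h1 := DGSpace.interchange_right C.toDGSpace E.toDGSpace (1 - d) E.comul
    hC.hasDegree_cobracket
  have h2 := DGSpace.interchange_right C.toDGSpace E.toDGSpace (1 - d) E.cobracket
    (hC.hasDegree_comul.comp (C.hasDegree_sgn (1 - d)) (add_zero 0))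
  rw [sub_self, DGSpace.sgn_zero] at h1
  rw [sub_zero] at h2
  rw [tensor_cobracket, LinearMap.comp_add, TensorProduct.map_add_right, LinearMap.add_comp, h1, h2,
    ← LinearMap.comp_add, ← TensorProduct.map_comp, LinearMap.id_comp]

theorem tensor_comul_id_comul (C : DCoalgebraOps k d) (hE : E.IsDCoalgebra) :
    TensorProduct.map (C.tensor E).comul LinearMap.id ∘ₗ (C.tensor E).comul =
      DGSpace.shuffle₃ C.toDGSpace E.toDGSpace ∘ₗ
        TensorProduct.map (TensorProduct.map C.comul LinearMap.id ∘ₗ C.comul)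
          (TensorProduct.map E.comul LinearMap.id ∘ₗ E.comul) := by
  rw [← LinearMap.comp_assoc, comul_id_interchange C hE, LinearMap.comp_assoc,
    ← TensorProduct.map_comp]

theorem tensor_id_comul_comul (hC : C.IsDCoalgebra) (E : DCoalgebraOps k d) :
    TensorProduct.map LinearMap.id (C.tensor E).comul ∘ₗ (C.tensor E).comul =
      DGSpace.shuffle₃' C.toDGSpace E.toDGSpace ∘ₗ
        TensorProduct.map (TensorProduct.map LinearMap.id C.comul ∘ₗ C.comul)
          (TensorProduct.map LinearMap.id E.comul ∘ₗ E.comul) := by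
  rw [← LinearMap.comp_assoc, id_comul_interchange hC E, LinearMap.comp_assoc,
    ← TensorProduct.map_comp]

theorem tensor_comul_id_cobracket (C : DCoalgebraOps k d) (hE : E.IsDCoalgebra) :
    TensorProduct.map (C.tensor E).comul LinearMap.id ∘ₗ (C.tensor E).cobracket =
      DGSpace.shuffle₃ C.toDGSpace E.toDGSpace ∘ₗ
        (TensorProduct.map (TensorProduct.map C.comul LinearMap.id ∘ₗ C.cobracket)
          (TensorProduct.map E.comul LinearMap.id ∘ₗ E.comul) +
        TensorProduct.map ((TensorProduct.map C.comul LinearMap.id ∘ₗ C.comul) ∘ₗ C.sgn (1 - d))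
          (TensorProduct.map E.comul LinearMap.id ∘ₗ E.cobracket)) := by
  rw [tensor_cobracket, ← LinearMap.comp_assoc, comul_id_interchange C hE, LinearMap.comp_assoc,
    LinearMap.comp_add, ← TensorProduct.map_comp, ← TensorProduct.map_comp]
  rfl

theorem tensor_cobracket_id_comul (hC : C.IsDCoalgebra) (hE : E.IsDCoalgebra) :
    TensorProduct.map (C.tensor E).cobracket LinearMap.id ∘ₗ (C.tensor E).comul =
      DGSpace.shuffle₃ C.toDGSpace E.toDGSpace ∘ₗ
        (TensorProduct.map (TensorProduct.map C.cobracket LinearMap.id ∘ₗ C.comul)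
          (TensorProduct.map E.comul LinearMap.id ∘ₗ E.comul) +
        TensorProduct.map ((TensorProduct.map C.comul LinearMap.id ∘ₗ C.comul) ∘ₗ C.sgn (1 - d))
          (TensorProduct.map E.cobracket LinearMap.id ∘ₗ E.comul)) := by
  rw [← LinearMap.comp_assoc, cobracket_id_interchange C hE, LinearMap.comp_assoc,
    LinearMap.add_comp, ← TensorProduct.map_comp, ← TensorProduct.map_comp, LinearMap.comp_assoc,
    hC.sgn_comul]
  rfl

theorem tensor_cobracket_id_cobracket (hC : C.IsDCoalgebra) (hE : E.IsDCoalgebra) :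
    TensorProduct.map (C.tensor E).cobracket LinearMap.id ∘ₗ (C.tensor E).cobracket =
      DGSpace.shuffle₃ C.toDGSpace E.toDGSpace ∘ₗ
        (TensorProduct.map (TensorProduct.map C.cobracket LinearMap.id ∘ₗ C.cobracket)
          (TensorProduct.map E.comul LinearMap.id ∘ₗ E.comul) +
        koszulSign k (1 - d) • TensorProduct.map
          ((TensorProduct.map C.comul LinearMap.id ∘ₗ C.cobracket) ∘ₗ C.sgn (1 - d))
          (TensorProduct.map E.cobracket LinearMap.id ∘ₗ E.comul) +
        (TensorProduct.map ((TensorProduct.map C.cobracket LinearMap.id ∘ₗ C.comul) ∘ₗ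
            C.sgn (1 - d)) (TensorProduct.map E.comul LinearMap.id ∘ₗ E.cobracket) +
        TensorProduct.map (TensorProduct.map C.comul LinearMap.id ∘ₗ C.comul)
          (TensorProduct.map E.cobracket LinearMap.id ∘ₗ E.cobracket))) := by
  -- Pulling the sign operators through the cobracket costs the exponent `(1 - d)²`, which has the
  -- parity of `1 - d`.
  have h1 : (TensorProduct.map C.comul LinearMap.id ∘ₗ
      TensorProduct.map (C.sgn (1 - d)) (C.sgn (1 - d))) ∘ₗ C.cobracket =
      koszulSign k (1 - d) • ((TensorProduct.map C.comul LinearMap.id ∘ₗ C.cobracket) ∘ₗ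
        C.sgn (1 - d)) := by
    rw [LinearMap.comp_assoc, hC.sgn_cobracket, LinearMap.comp_smul,
      koszulSign_congr (n := 1 - d) (by push_cast; exact ZMod.two_mul_self_eq _)]
    rfl
  -- Pulled through the coproduct, the sign operators meet the one already present, and their
  -- product is the identity.
  have h2 : (TensorProduct.map C.comul LinearMap.id ∘ₗ
      TensorProduct.map (C.sgn (1 - d)) (C.sgn (1 - d))) ∘ₗ C.comul ∘ₗ C.sgn (1 - d) =
      TensorProduct.map C.comul LinearMap.id ∘ₗ C.comul := by
    rw [LinearMap.comp_assoc, ← LinearMap.comp_assoc (C.sgn (1 - d)), hC.sgn_comul,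
      LinearMap.comp_assoc, C.sgn_sgn, LinearMap.comp_id]
  have h3 := cobracket_id_interchange C hE
  generalize TensorProduct.map C.comul LinearMap.id ∘ₗ
      TensorProduct.map (C.sgn (1 - d)) (C.sgn (1 - d)) = P at h1 h2 h3
  rw [tensor_cobracket C E] at h3 ⊢
  rw [← LinearMap.comp_assoc, h3, LinearMap.comp_assoc, LinearMap.comp_add, LinearMap.add_comp,
    LinearMap.add_comp, ← TensorProduct.map_comp, ← TensorProduct.map_comp,
    ← TensorProduct.map_comp, ← TensorProduct.map_comp, h1, h2, TensorProduct.map_smul_left]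
  rfl

theorem tensor_coassoc (hC : C.IsDCoalgebra) (hE : E.IsDCoalgebra) :
    (TensorProduct.assoc k (C.tensor E) (C.tensor E) (C.tensor E)).toLinearMap
      ∘ₗ TensorProduct.map (C.tensor E).comul LinearMap.id ∘ₗ (C.tensor E).comul =
    TensorProduct.map LinearMap.id (C.tensor E).comul ∘ₗ (C.tensor E).comul := by
  rw [tensor_comul_id_comul C hE, tensor_id_comul_comul hC E, ← LinearMap.comp_assoc,
    DGSpace.assoc_comp_shuffle₃, LinearMap.comp_assoc, ← TensorProduct.map_comp, hC.coassoc,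
    hE.coassoc]

/-- Once both sides are written through `shuffle₃'`, the summands containing the iterated coproduct
of `E` reduce to co-Leibniz for `C`, and those containing the iterated coproduct of `C` to
co-Leibniz for `E`. Coassociativity and cocommutativity normalise the iterated coproducts. -/
theorem tensor_coleibniz (hC : C.IsDCoalgebra) (hE : E.IsDCoalgebra) :
    (TensorProduct.assoc k (C.tensor E) (C.tensor E) (C.tensor E)).toLinearMap ∘ₗ
        TensorProduct.map (C.tensor E).comul LinearMap.id ∘ₗ (C.tensor E).cobracket =
      TensorProduct.map ((C.tensor E).sgn (1 - d)) (C.tensor E).cobracket ∘ₗ (C.tensor E).comul +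
      TensorProduct.map LinearMap.id (DGSpace.swap (C.tensor E).toDGSpace (C.tensor E).toDGSpace) ∘ₗ
        (TensorProduct.assoc k (C.tensor E) (C.tensor E) (C.tensor E)).toLinearMap ∘ₗ
        TensorProduct.map (C.tensor E).cobracket LinearMap.id ∘ₗ (C.tensor E).comul := by
  have h1 : TensorProduct.map ((C.tensor E).sgn (1 - d)) (C.tensor E).cobracket ∘ₗ
      (C.tensor E).comul = DGSpace.shuffle₃' C.toDGSpace E.toDGSpace ∘ₗ
        (TensorProduct.map (TensorProduct.map (C.sgn (1 - d)) C.cobracket ∘ₗ C.comul)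
          (TensorProduct.map LinearMap.id E.comul ∘ₗ E.comul) +
        TensorProduct.map ((TensorProduct.map LinearMap.id C.comul ∘ₗ C.comul) ∘ₗ C.sgn (1 - d))
          (TensorProduct.map (E.sgn (1 - d)) E.cobracket ∘ₗ E.comul)) := by
    rw [← LinearMap.comp_assoc, sgn_cobracket_interchange hC E, LinearMap.comp_assoc,
      LinearMap.add_comp, ← TensorProduct.map_comp, ← TensorProduct.map_comp, LinearMap.comp_assoc,
      hC.sgn_comul]
    rfl
  have h2 : ∀ T : C ⊗[k] E →ₗ[k] ((C ⊗[k] C) ⊗[k] C) ⊗[k] ((E ⊗[k] E) ⊗[k] E),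
      (TensorProduct.assoc k (C.tensor E) (C.tensor E) (C.tensor E)).toLinearMap ∘ₗ
        DGSpace.shuffle₃ C.toDGSpace E.toDGSpace ∘ₗ T =
      DGSpace.shuffle₃' C.toDGSpace E.toDGSpace ∘ₗ
        TensorProduct.map (TensorProduct.assoc k C C C).toLinearMap
          (TensorProduct.assoc k E E E).toLinearMap ∘ₗ T := fun T => by
    rw [← LinearMap.comp_assoc, DGSpace.assoc_comp_shuffle₃, LinearMap.comp_assoc]
  have h3 : ∀ T : C ⊗[k] E →ₗ[k] (C ⊗[k] (C ⊗[k] C)) ⊗[k] (E ⊗[k] (E ⊗[k] E)),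
      TensorProduct.map LinearMap.id
          (DGSpace.swap (C.tensor E).toDGSpace (C.tensor E).toDGSpace) ∘ₗ
        DGSpace.shuffle₃' C.toDGSpace E.toDGSpace ∘ₗ T =
      DGSpace.shuffle₃' C.toDGSpace E.toDGSpace ∘ₗ
        TensorProduct.map (TensorProduct.map LinearMap.id (C.swap C.toDGSpace))
          (TensorProduct.map LinearMap.id (E.swap E.toDGSpace)) ∘ₗ T := fun T => by
    have := DGSpace.id_swap_comp_shuffle₃' C.toDGSpace E.toDGSpace
    rw [← LinearMap.comp_assoc, this, LinearMap.comp_assoc]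
  rw [h1, tensor_comul_id_cobracket C hE, tensor_cobracket_id_comul hC hE, h2, h2, h3,
    ← LinearMap.comp_add]
  congr 1
  simp only [LinearMap.comp_add, ← TensorProduct.map_comp]
  simp only [← LinearMap.comp_assoc (C.sgn (1 - d)), hC.coassoc, hE.coassoc, hC.coleibniz,
    hE.coleibniz, hC.swap_id_coassoc, hE.swap_id_coassoc, TensorProduct.map_add_left,
    TensorProduct.map_add_right]
  abel

/-- Of the four summands of `(δ ⊗ 1) δ`, two pair a co-Jacobi term with a rotation-invariant
iterated coproduct. In the mixed two, `comul_id_cobracket` writes `(Δ ⊗ 1) δ` as rotations of `(δ ⊗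
1) Δ`, and `LinearMap.rotation_sum_eq_zero` gives the cancellation. -/
theorem tensor_cojacobi (hC : C.IsDCoalgebra) (hE : E.IsDCoalgebra) :
    (LinearMap.id + (C.tensor E).cyc + (C.tensor E).cyc ∘ₗ (C.tensor E).cyc) ∘ₗ
      TensorProduct.map (C.tensor E).cobracket LinearMap.id ∘ₗ (C.tensor E).cobracket = 0 := by
  have hcyc := DGSpace.cyc_comp_shuffle₃ C.toDGSpace E.toDGSpace
  have hcyc2 : (LinearMap.id + (C.tensor E).cyc + (C.tensor E).cyc ∘ₗ (C.tensor E).cyc) ∘ₗ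
      DGSpace.shuffle₃ C.toDGSpace E.toDGSpace = DGSpace.shuffle₃ C.toDGSpace E.toDGSpace ∘ₗ
      (LinearMap.id + TensorProduct.map C.cyc E.cyc +
        TensorProduct.map (C.cyc ∘ₗ C.cyc) (E.cyc ∘ₗ E.cyc)) := by
    rw [LinearMap.add_comp, LinearMap.add_comp, hcyc, LinearMap.comp_assoc, hcyc,
      ← LinearMap.comp_assoc, hcyc, LinearMap.comp_assoc, ← TensorProduct.map_comp,
      LinearMap.comp_add, LinearMap.comp_add]
    rfl
  rw [tensor_cobracket_id_cobracket hC hE, hC.comul_id_cobracket, hE.comul_id_cobracket,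
    ← LinearMap.comp_assoc, hcyc2, LinearMap.comp_assoc]
  refine (congrArg _ (LinearMap.rotation_sum_eq_zero _ _ C.cyc_cyc_cyc E.cyc_cyc_cyc
    (koszulSign k d) (koszulSign k (1 - d)) (koszulSign_mul_self d) ?_ hC.cojacobi hE.cojacobi
    hC.cyc_comul_id hE.cyc_comul_id _ _ _)).trans (LinearMap.comp_zero _)
  rw [sub_eq_add_neg, koszulSign_add, koszulSign_one,
    koszulSign_congr (n := d) (by push_cast; grind)]
  ring

end Tensor

end DCoalgebraOps

namespace DCoalgebraOps

variable {k : Type u} [Field k] {d : ℤ} {C E : DCoalgebraOps k d}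

theorem IsDCoalgebra.cobracket_comp_D (h : C.IsDCoalgebra) : C.cobracket ∘ₗ C.D =
    koszulSign k (1 - d) • ((C.toDGSpace.tensor C.toDGSpace).D ∘ₗ C.cobracket) :=
  LinearMap.ext fun x => by
    rw [LinearMap.comp_apply, h.cobracket_D, negOnePow_smul_eq (k := k),
      koszulSign_congr (n := 1 - d) (by push_cast; grind)]
    rfl

theorem IsDCoalgebra.comul_comp_D (h : C.IsDCoalgebra) :
    C.comul ∘ₗ C.D = (C.toDGSpace.tensor C.toDGSpace).D ∘ₗ C.comul :=
  LinearMap.ext h.comul_D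

theorem IsDCoalgebra.swap_comp_cobracket (h : C.IsDCoalgebra) :
    DGSpace.swap C.toDGSpace C.toDGSpace ∘ₗ C.cobracket = koszulSign k d • C.cobracket := by
  rw [h.cobracket_swap]
  exact negOnePow_smul_eq _ _

theorem IsDCoalgebra.counit_D_comp (h : C.IsDCoalgebra) : C.counit ∘ₗ C.D = 0 :=
  LinearMap.ext h.counit_D

theorem tensor_hasDegree_comul (hC : C.IsDCoalgebra) (hE : E.IsDCoalgebra) :
    DGSpace.HasDegree (C.tensor E).toDGSpace
      ((C.tensor E).toDGSpace.tensor (C.tensor E).toDGSpace) 0 (C.tensor E).comul :=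
  (DGSpace.hasDegree_interchange₄ C.toDGSpace C.toDGSpace E.toDGSpace E.toDGSpace).comp
    (DGSpace.hasDegree_map hC.hasDegree_comul hE.hasDegree_comul (add_zero 0)) (add_zero 0)

theorem tensor_hasDegree_cobracket (hC : C.IsDCoalgebra) (hE : E.IsDCoalgebra) :
    DGSpace.HasDegree (C.tensor E).toDGSpace
      ((C.tensor E).toDGSpace.tensor (C.tensor E).toDGSpace) (1 - d) (C.tensor E).cobracket :=
  (DGSpace.hasDegree_interchange₄ C.toDGSpace C.toDGSpace E.toDGSpace E.toDGSpace).comp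
    (q := 1 - d)
    ((DGSpace.hasDegree_map hC.hasDegree_cobracket hE.hasDegree_comul (add_zero _)).add
      (DGSpace.hasDegree_map (hC.hasDegree_comul.comp (C.hasDegree_sgn (d - 1)) (add_zero 0))
        hE.hasDegree_cobracket (zero_add _))) (by ring)

theorem tensor_comul_D (hC : C.IsDCoalgebra) (hE : E.IsDCoalgebra) :
    (C.tensor E).comul ∘ₗ (C.tensor E).D =
      ((C.tensor E).toDGSpace.tensor (C.tensor E).toDGSpace).D ∘ₗ (C.tensor E).comul := by
  have h := DGSpace.interchange₄_comp_D C.toDGSpace C.toDGSpace E.toDGSpace E.toDGSpace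
  have h1 := hC.sgn_comul 1
  rw [← DGSpace.sgn_tensor] at h1
  calc _ = DGSpace.interchange C.toDGSpace E.toDGSpace ∘ₗ TensorProduct.map C.comul E.comul ∘ₗ
        (TensorProduct.map C.D LinearMap.id + TensorProduct.map (C.sgn 1) E.D) := rfl
    _ = DGSpace.interchange C.toDGSpace E.toDGSpace ∘ₗ
        ((C.toDGSpace.tensor C.toDGSpace).tensor (E.toDGSpace.tensor E.toDGSpace)).D ∘ₗ
          TensorProduct.map C.comul E.comul := by
        congr 1
        rw [LinearMap.comp_add, LinearMap.add_comp, ← TensorProduct.map_comp,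
          ← TensorProduct.map_comp, hC.comul_comp_D, hE.comul_comp_D, ← h1,
          ← TensorProduct.map_comp, ← TensorProduct.map_comp]
        rfl
    _ = _ := by rw [← LinearMap.comp_assoc, DGSpace.interchange_eq, ← h]; rfl

theorem tensor_cobracket_D (hC : C.IsDCoalgebra) (hE : E.IsDCoalgebra) :
    (C.tensor E).cobracket ∘ₗ (C.tensor E).D = koszulSign k (1 - d) •
      (((C.tensor E).toDGSpace.tensor (C.tensor E).toDGSpace).D ∘ₗ (C.tensor E).cobracket) := by
  have h := DGSpace.interchange₄_comp_D C.toDGSpace C.toDGSpace E.toDGSpace E.toDGSpace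
  have h1 := hC.sgn_comul 1
  rw [← DGSpace.sgn_tensor] at h1
  have h2 := hC.sgn_cobracket 1
  rw [← DGSpace.sgn_tensor, one_mul] at h2
  have h2' : C.cobracket ∘ₗ C.sgn 1 = koszulSign k (1 - d) •
      ((C.toDGSpace.tensor C.toDGSpace).sgn 1 ∘ₗ C.cobracket) := by
    rw [h2, smul_smul, koszulSign_mul_self, one_smul]
  have h3 : (C.comul ∘ₗ C.sgn (1 - d)) ∘ₗ C.D = koszulSign k (1 - d) •
      ((C.toDGSpace.tensor C.toDGSpace).D ∘ₗ C.comul ∘ₗ C.sgn (1 - d)) := by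
    rw [LinearMap.comp_assoc, C.hasDegree_D.sgn_comp, LinearMap.comp_smul, mul_one,
      ← LinearMap.comp_assoc, hC.comul_comp_D]
    rfl
  have h4 : (C.comul ∘ₗ C.sgn (1 - d)) ∘ₗ C.sgn 1 =
      (C.toDGSpace.tensor C.toDGSpace).sgn 1 ∘ₗ C.comul ∘ₗ C.sgn (1 - d) := by
    have : C.sgn (1 - d) ∘ₗ C.sgn 1 = C.sgn 1 ∘ₗ C.sgn (1 - d) :=
      ((C.hasDegree_sgn 1).sgn_comp_zero _)
    rw [LinearMap.comp_assoc, this, ← LinearMap.comp_assoc, ← h1]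
    rfl
  have h5 : (TensorProduct.map C.cobracket E.comul +
      TensorProduct.map (C.comul ∘ₗ C.sgn (1 - d)) E.cobracket) ∘ₗ
      (TensorProduct.map C.D LinearMap.id + TensorProduct.map (C.sgn 1) E.D) =
      koszulSign k (1 - d) •
      (((C.toDGSpace.tensor C.toDGSpace).tensor (E.toDGSpace.tensor E.toDGSpace)).D ∘ₗ
        (TensorProduct.map C.cobracket E.comul +
          TensorProduct.map (C.comul ∘ₗ C.sgn (1 - d)) E.cobracket)) := by
    rw [LinearMap.comp_add, LinearMap.comp_add, LinearMap.add_comp, LinearMap.add_comp,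
      LinearMap.add_comp, LinearMap.add_comp, ← TensorProduct.map_comp, ← TensorProduct.map_comp,
      ← TensorProduct.map_comp, ← TensorProduct.map_comp, ← TensorProduct.map_comp,
      ← TensorProduct.map_comp, ← TensorProduct.map_comp, ← TensorProduct.map_comp,
      hC.cobracket_comp_D, h2', h3, h4, hE.comul_comp_D, hE.cobracket_comp_D,
      TensorProduct.map_smul_left, TensorProduct.map_smul_left, TensorProduct.map_smul_left,
      TensorProduct.map_smul_right]
    simp only [smul_add, LinearMap.comp_id, LinearMap.id_comp]
    abel
  rw [tensor_cobracket C E, LinearMap.comp_assoc, h5, LinearMap.comp_smul, ← LinearMap.comp_assoc,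
    DGSpace.interchange_eq, ← h]
  rfl

/-- The interchange sign is invisible here: the counit kills `x'` unless its degree is zero, and
then the sign is trivial. -/
theorem tensor_counit_interchange (C : DCoalgebraOps k d) (hE : E.IsDCoalgebra) :
    TensorProduct.map (C.tensor E).counit LinearMap.id ∘ₗ
        DGSpace.interchange C.toDGSpace E.toDGSpace =
      (TensorProduct.lid k (C ⊗[k] E)).symm.toLinearMap ∘ₗ
        TensorProduct.map ((TensorProduct.lid k C).toLinearMap ∘ₗ
            TensorProduct.map C.counit LinearMap.id)
          ((TensorProduct.lid k E).toLinearMap ∘ₗ TensorProduct.map E.counit LinearMap.id) := by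
  refine DGSpace.tensor_hom_ext₄ C.toDGSpace C.toDGSpace E.toDGSpace E.toDGSpace
    fun i x hx j y hy i' x' hx' j' y' hy' => ?_
  rw [LinearMap.comp_apply, DGSpace.interchange_eq, DGSpace.interchange₄_tmul _ _ _ _ x y' hy hx']
  simp only [LinearMap.comp_apply, TensorProduct.map_tmul, map_smul, LinearMap.id_apply,
    LinearEquiv.coe_coe, TensorProduct.lid_tmul, LinearMap.mul'_apply,
    TensorProduct.lid_symm_apply]
  rcases eq_or_ne i' 0 with rfl | hi
  · rw [mul_zero, koszulSign_zero, one_smul, TensorProduct.smul_tmul_smul,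
      ← mul_one (C.counit x * E.counit x'), ← smul_eq_mul _ (1 : k), TensorProduct.smul_tmul,
      smul_eq_mul, mul_one]
  · simp [hE.counit_eq_zero i' x' hi hx']

theorem IsDCoalgebra.tensor (hC : C.IsDCoalgebra) (hE : E.IsDCoalgebra) :
    (C.tensor E).IsDCoalgebra where
  comul_mem := DGSpace.hasDegree_zero_iff.1 (tensor_hasDegree_comul hC hE)
  counit_eq_zero n x hn := by
    suffices h : DGSpace.tensorGr C.toDGSpace E.toDGSpace n ≤ LinearMap.ker (C.tensor E).counit from
      fun hx => h hx
    refine DGSpace.tensorGr_le _ _ fun i j hij x hx y hy => ?_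
    simp only [LinearMap.mem_ker, LinearMap.comp_apply, TensorProduct.map_tmul,
      LinearMap.mul'_apply]
    rcases eq_or_ne i 0 with rfl | hi
    · rw [hE.counit_eq_zero j y (by omega) hy, mul_zero]
    · rw [hC.counit_eq_zero i x hi hx, zero_mul]
  cobracket_mem := tensor_hasDegree_cobracket hC hE
  comul_D := LinearMap.congr_fun (tensor_comul_D hC hE)
  counit_D x := by
    suffices h : (C.tensor E).counit ∘ₗ (C.tensor E).D = 0 from LinearMap.congr_fun h x
    change LinearMap.mul' k k ∘ₗ TensorProduct.map C.counit E.counit ∘ₗ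
      (TensorProduct.map C.D LinearMap.id + TensorProduct.map (C.sgn 1) E.D) = 0
    rw [LinearMap.comp_add, ← TensorProduct.map_comp, ← TensorProduct.map_comp, hC.counit_D_comp,
      hE.counit_D_comp, TensorProduct.map_zero_left, TensorProduct.map_zero_right, add_zero,
      LinearMap.comp_zero]
  cobracket_D x := by
    rw [negOnePow_smul_eq (k := k), koszulSign_congr (n := 1 - d) (by push_cast; grind)]
    exact LinearMap.congr_fun (tensor_cobracket_D hC hE) x
  coassoc := tensor_coassoc hC hE
  cocomm := by
    rw [← LinearMap.comp_assoc, DGSpace.interchange_eq]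
    have := DGSpace.swap_comp_interchange₄ C.toDGSpace C.toDGSpace E.toDGSpace E.toDGSpace
    refine (congrArg (· ∘ₗ _) this).trans ?_
    rw [LinearMap.comp_assoc, ← TensorProduct.map_comp, hC.cocomm, hE.cocomm]
    rfl
  counit_comul := by
    have h := tensor_counit_interchange C hE
    rw [← LinearMap.comp_assoc (DGSpace.interchange C.toDGSpace E.toDGSpace ∘ₗ
      TensorProduct.map C.comul E.comul), LinearMap.comp_assoc, ← LinearMap.comp_assoc
      (TensorProduct.map C.comul E.comul), h, LinearMap.comp_assoc, ← TensorProduct.map_comp,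
      LinearMap.comp_assoc, LinearMap.comp_assoc, hC.counit_comul, hE.counit_comul,
      TensorProduct.map_id]
    exact LinearMap.ext fun x => by simp
  cobracket_swap := by
    have := DGSpace.swap_comp_interchange₄ C.toDGSpace C.toDGSpace E.toDGSpace E.toDGSpace
    have h0 : ∀ f : (C ⊗[k] E) →ₗ[k] (C ⊗[k] E) ⊗[k] (C ⊗[k] E),
      d.negOnePow • f = koszulSign k d • f := fun f => negOnePow_smul_eq _ _
    rw [tensor_cobracket, h0, ← LinearMap.comp_assoc, DGSpace.interchange_eq]
    refine (congrArg (· ∘ₗ _) this).trans ?_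
    rw [LinearMap.comp_assoc, LinearMap.comp_add, ← TensorProduct.map_comp,
      ← TensorProduct.map_comp, ← LinearMap.comp_assoc, hC.cocomm, hE.cocomm,
      hC.swap_comp_cobracket, hE.swap_comp_cobracket, TensorProduct.map_smul_left,
      TensorProduct.map_smul_right, ← smul_add, LinearMap.comp_smul]
  cojacobi := tensor_cojacobi hC hE
  coleibniz := tensor_coleibniz hC hE
  counit_cobracket := by
    have h := tensor_counit_interchange C hE
    have h1 := hC.counit_cobracket
    have h2 := hE.counit_cobracket
    rw [← LinearMap.comp_assoc, h, LinearMap.comp_assoc, LinearMap.comp_add,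
      ← TensorProduct.map_comp, ← TensorProduct.map_comp, LinearMap.comp_assoc, h1,
      LinearMap.comp_assoc E.cobracket, h2, LinearMap.comp_zero, LinearMap.comp_zero,
      TensorProduct.map_zero_left, TensorProduct.map_zero_right, add_zero, LinearMap.comp_zero]

end DCoalgebraOps

/-! ### The tensor product of coproartinian filtrations -/

namespace DGSpace

variable {k : Type u} [Field k]

/-- The subspace `F ⊗ G` of `M ⊗ N`. -/
def tensorSub (M N : DGSpace k) (F : Submodule k M) (G : Submodule k N) : Submodule k (M ⊗[k] N) :=
  LinearMap.range (TensorProduct.map F.subtype G.subtype)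

theorem tmul_mem_tensorSub (M N : DGSpace k) {F : Submodule k M} {G : Submodule k N} {x : M} {y : N}
    (hx : x ∈ F) (hy : y ∈ G) : x ⊗ₜ[k] y ∈ tensorSub M N F G :=
  ⟨⟨x, hx⟩ ⊗ₜ ⟨y, hy⟩, by simp⟩

theorem tensorSub_le (M N : DGSpace k) {F : Submodule k M} {G : Submodule k N}
    {P : Submodule k (M ⊗[k] N)} (h : ∀ x ∈ F, ∀ y ∈ G, x ⊗ₜ[k] y ∈ P) : tensorSub M N F G ≤ P := by
  rintro _ ⟨t, rfl⟩
  induction t with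
  | zero => simp
  | tmul x y => exact h x x.2 y y.2
  | add a b ha hb => rw [map_add]; exact P.add_mem ha hb

theorem tensorSub_mono (M N : DGSpace k) {F F' : Submodule k M} {G G' : Submodule k N}
    (hF : F ≤ F') (hG : G ≤ G') : tensorSub M N F G ≤ tensorSub M N F' G' :=
  tensorSub_le M N fun _ hx _ hy => tmul_mem_tensorSub M N (hF hx) (hG hy)

theorem proj_mem_tensorSub (M N : DGSpace k) {F : Submodule k M} {G : Submodule k N}
    (hF : ∀ n, ∀ x ∈ F, M.proj n x ∈ F) (hG : ∀ n, ∀ x ∈ G, N.proj n x ∈ G) (n : ℤ) :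
    ∀ t ∈ tensorSub M N F G, (M.tensor N).proj n t ∈ tensorSub M N F G := by
  suffices h : tensorSub M N F G ≤ (tensorSub M N F G).comap ((M.tensor N).proj n) from h
  refine tensorSub_le M N fun x hx y hy => ?_
  have h1 : ∀ i j, M.proj i x ⊗ₜ[k] N.proj j y ∈
      (tensorSub M N F G).comap ((M.tensor N).proj n) := fun i j => by
    have h2 := tmul_mem M N (M.proj_mem i x) (N.proj_mem j y)
    rw [Submodule.mem_comap]
    rcases eq_or_ne (i + j) n with rfl | h
    · rw [proj_of_mem _ h2]
      exact tmul_mem_tensorSub M N (hF i x hx) (hG j y hy)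
    · rw [proj_of_mem_ne _ h2 h]
      exact Submodule.zero_mem _
  have h2 : ∀ j, x ⊗ₜ[k] N.proj j y ∈ (tensorSub M N F G).comap ((M.tensor N).proj n) := fun j =>
    M.mem_of_proj_mem (((tensorSub M N F G).comap ((M.tensor N).proj n)).comap
      ((TensorProduct.mk k M N).flip (N.proj j y))) fun i => h1 i j
  exact N.mem_of_proj_mem (((tensorSub M N F G).comap ((M.tensor N).proj n)).comap
      (TensorProduct.mk k M N x)) h2

theorem sgn_mem (M : DGSpace k) {F : Submodule k M} (hF : ∀ n, ∀ x ∈ F, M.proj n x ∈ F) (q : ℤ)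
    {x : M} (hx : x ∈ F) : M.sgn q x ∈ F :=
  M.mem_of_proj_mem (F.comap (M.sgn q)) fun n => by
    rw [Submodule.mem_comap, M.sgn_apply' q (M.proj_mem n x)]
    exact F.smul_mem _ (hF n x hx)

/-- The interchange is a scalar multiple of the plain permutation only on homogeneous middle
factors, so `G` and `F'` must contain the components of their elements. -/
theorem interchange₄_mem (A B A' B' : DGSpace k) {F : Submodule k A} {G : Submodule k B}
    {F' : Submodule k A'} {G' : Submodule k B'} (hG : ∀ n, ∀ x ∈ G, B.proj n x ∈ G)
    (hF' : ∀ n, ∀ x ∈ F', A'.proj n x ∈ F') {t : A ⊗[k] B} {t' : A' ⊗[k] B'}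
    (ht : t ∈ tensorSub A B F G) (ht' : t' ∈ tensorSub A' B' F' G') :
    interchange₄ A B A' B' (t ⊗ₜ t') ∈
      tensorSub (A.tensor A') (B.tensor B') (tensorSub A A' F F') (tensorSub B B' G G') := by
  set P := tensorSub (A.tensor A') (B.tensor B') (tensorSub A A' F F') (tensorSub B B' G G')
  have h1 : ∀ a ∈ F, ∀ b ∈ G, ∀ a' ∈ F', ∀ b' ∈ G',
      interchange₄ A B A' B' ((a ⊗ₜ b) ⊗ₜ (a' ⊗ₜ b')) ∈ P := by
    intro a ha b hb a' ha' b' hb'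
    refine B.mem_of_proj_mem (P.comap (interchange₄ A B A' B' ∘ₗ
      (TensorProduct.mk k (A ⊗[k] B) (A' ⊗[k] B')).flip (a' ⊗ₜ b') ∘ₗ TensorProduct.mk k A B a))
      fun i => ?_
    refine A'.mem_of_proj_mem (P.comap (interchange₄ A B A' B' ∘ₗ
      TensorProduct.mk k (A ⊗[k] B) (A' ⊗[k] B') (a ⊗ₜ B.proj i b) ∘ₗ
      (TensorProduct.mk k A' B').flip b')) fun j => ?_
    change interchange₄ A B A' B' ((a ⊗ₜ B.proj i b) ⊗ₜ (A'.proj j a' ⊗ₜ b')) ∈ P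
    rw [interchange₄_tmul A B A' B' a b' (B.proj_mem i b) (A'.proj_mem j a')]
    exact P.smul_mem _ (tmul_mem_tensorSub _ _ (tmul_mem_tensorSub A A' ha (hF' j a' ha'))
      (tmul_mem_tensorSub B B' (hG i b hb) hb'))
  have h2 : tensorSub A B F G ≤ P.comap (interchange₄ A B A' B' ∘ₗ
      (TensorProduct.mk k (A ⊗[k] B) (A' ⊗[k] B')).flip t') :=
    tensorSub_le A B fun a ha b hb => by
      have h3 : tensorSub A' B' F' G' ≤ P.comap (interchange₄ A B A' B' ∘ₗ
          TensorProduct.mk k (A ⊗[k] B) (A' ⊗[k] B') (a ⊗ₜ b)) :=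
        tensorSub_le A' B' fun a' ha' b' hb' => h1 a ha b hb a' ha' b' hb'
      exact h3 ht'
  exact h2 ht

theorem interchange₄_unit_left (A A' B' : DGSpace k) {e : A} (he : e ∈ A.gr 0) (t : A' ⊗[k] B') :
    interchange₄ A A A' B' ((e ⊗ₜ e) ⊗ₜ t) =
      TensorProduct.map (TensorProduct.mk k A A' e) (TensorProduct.mk k A B' e) t := by
  suffices h : interchange₄ A A A' B' ∘ₗ TensorProduct.mk k (A ⊗[k] A) (A' ⊗[k] B') (e ⊗ₜ e) =
      TensorProduct.map (TensorProduct.mk k A A' e) (TensorProduct.mk k A B' e) from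
    LinearMap.congr_fun h t
  refine tensor_hom_ext A' B' fun i x hx j y hy => ?_
  rw [LinearMap.comp_apply, TensorProduct.mk_apply, interchange₄_tmul A A A' B' e y he hx, zero_mul,
    koszulSign_zero, one_smul]
  rfl

theorem interchange₄_unit_right (A B A' : DGSpace k) {e : A'} (he : e ∈ A'.gr 0) (t : A ⊗[k] B) :
    interchange₄ A B A' A' (t ⊗ₜ (e ⊗ₜ e)) =
      TensorProduct.map ((TensorProduct.mk k A A').flip e) ((TensorProduct.mk k B A').flip e) t := by
  suffices h : interchange₄ A B A' A' ∘ₗ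
      (TensorProduct.mk k (A ⊗[k] B) (A' ⊗[k] A')).flip (e ⊗ₜ e) =
      TensorProduct.map ((TensorProduct.mk k A A').flip e) ((TensorProduct.mk k B A').flip e) from
    LinearMap.congr_fun h t
  refine tensor_hom_ext A B fun i x hx j y hy => ?_
  rw [LinearMap.comp_apply, LinearMap.flip_apply, TensorProduct.mk_apply,
    interchange₄_tmul A B A' A' x e hy he, mul_zero, koszulSign_zero, one_smul]
  rfl

end DGSpace

namespace DCoalgebraOps

variable {k : Type u} [Field k] {d : ℤ} {C E : DCoalgebraOps k d}

theorem tensor_comul_apply (x : C) (y : E) : (C.tensor E).comul (x ⊗ₜ y) =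
    DGSpace.interchange C.toDGSpace E.toDGSpace (C.comul x ⊗ₜ E.comul y) := rfl

theorem tensor_cobracket_apply (x : C) (y : E) : (C.tensor E).cobracket (x ⊗ₜ y) =
    DGSpace.interchange C.toDGSpace E.toDGSpace (C.cobracket x ⊗ₜ E.comul y) +
      DGSpace.interchange C.toDGSpace E.toDGSpace
        (C.comul (C.sgn (d - 1) x) ⊗ₜ E.cobracket y) := by
  rw [← map_add]
  rfl

/-- The tensor product of two filtrations. -/
def tensorFiltration (F : ℕ → Submodule k C) (G : ℕ → Submodule k E) (n : ℕ) :
    Submodule k (C ⊗[k] E) :=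
  ⨆ (i : ℕ) (j : ℕ) (_ : i + j = n), DGSpace.tensorSub C.toDGSpace E.toDGSpace (F i) (G j)

section Filtration

variable {F : ℕ → Submodule k C} {G : ℕ → Submodule k E}

theorem tensorFiltration_le {n : ℕ} {P : Submodule k (C ⊗[k] E)}
    (h : ∀ i j, i + j = n → ∀ x ∈ F i, ∀ y ∈ G j, x ⊗ₜ[k] y ∈ P) : tensorFiltration F G n ≤ P :=
  iSup_le fun i => iSup_le fun j => iSup_le fun hij =>
    DGSpace.tensorSub_le C.toDGSpace E.toDGSpace (h i j hij)

theorem tensorSub_le_tensorFiltration (hF : Monotone F) {i j n : ℕ} (h : i + j ≤ n) :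
    DGSpace.tensorSub C.toDGSpace E.toDGSpace (F i) (G j) ≤ tensorFiltration F G n :=
  (DGSpace.tensorSub_mono C.toDGSpace E.toDGSpace (hF (show i ≤ n - j by omega)) le_rfl).trans
    (le_iSup_of_le (n - j) (le_iSup_of_le j (le_iSup_of_le (by omega) le_rfl)))

end Filtration

/-- Tensor degrees add. In the reduced coproduct of `x ⊗ y` each remaining term either contains a
reduced coproduct, which lowers the level of one argument by one, or splits `x` and `y` between the
two factors; in both cases the total level drops. -/
theorem IsCoartFiltration.tensor {F : ℕ → Submodule k C} {G : ℕ → Submodule k E} {e : C} {e' : E}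
    (hC : C.IsDCoalgebra) (hE : E.IsDCoalgebra) (hF : C.IsCoartFiltration F e)
    (hG : E.IsCoartFiltration G e') :
    (C.tensor E).IsCoartFiltration (tensorFiltration F G) (e ⊗ₜ e') := by
  have mem : ∀ {i j n : ℕ} {x : C} {y : E}, i + j ≤ n → x ∈ F i → y ∈ G j →
      x ⊗ₜ[k] y ∈ tensorFiltration F G n := fun h hx hy =>
    tensorSub_le_tensorFiltration hF.mono h (DGSpace.tmul_mem_tensorSub _ _ hx hy)
  have inter : ∀ {i j n : ℕ}, i + j ≤ n → ∀ t ∈ C.square (F i), ∀ t' ∈ E.square (G j),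
      DGSpace.interchange C.toDGSpace E.toDGSpace (t ⊗ₜ t') ∈
        (C.tensor E).square (tensorFiltration F G n) := fun {i j n} h t ht t' ht' => by
    have h1 := DGSpace.interchange₄_mem C.toDGSpace C.toDGSpace E.toDGSpace E.toDGSpace
      (fun n x hx => hF.proj_mem i n hx) (fun n x hx => hG.proj_mem j n hx) ht ht'
    exact DGSpace.tensorSub_mono _ _ (tensorSub_le_tensorFiltration hF.mono h)
      (tensorSub_le_tensorFiltration hF.mono h) h1
  have mono : Monotone (tensorFiltration F G) := fun m n hmn =>
    tensorFiltration_le fun i j hij x hx y hy => mem (by omega) hx hy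
  have he := hF.mem_gr_zero hC
  have he' := hG.mem_gr_zero hE
  have hee : (e ⊗ₜ[k] e) ∈ C.square (F 0) := C.tmul_mem_square (hF.one_mem 0) (hF.one_mem 0)
  have hee' : (e' ⊗ₜ[k] e') ∈ E.square (G 0) := E.tmul_mem_square (hG.one_mem 0) (hG.one_mem 0)
  have hcom : ∀ {i : ℕ} {x : C}, x ∈ F i → C.comul x ∈ C.square (F i) := fun {i} {x} hx =>
    (hF.subcoalgebra i).comul_mem x hx
  have hcom' : ∀ {i : ℕ} {x : E}, x ∈ G i → E.comul x ∈ E.square (G i) := fun {i} {x} hx =>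
    (hG.subcoalgebra i).comul_mem x hx
  refine (hC.tensor hE).isCoartFiltration mono ?_ ?_ ?_ ?_ ?_ ?_ ?_
  · intro t
    induction t using TensorProduct.induction_on with
    | zero => exact ⟨0, Submodule.zero_mem _⟩
    | tmul x y =>
      obtain ⟨i, hi⟩ := hF.exhaustive x
      obtain ⟨j, hj⟩ := hG.exhaustive y
      exact ⟨i + j, mem le_rfl hi hj⟩
    | add a b ha hb =>
      obtain ⟨m, hm⟩ := ha
      obtain ⟨n, hn⟩ := hb
      exact ⟨max m n, Submodule.add_mem _ (mono (le_max_left m n) hm)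
        (mono (le_max_right m n) hn)⟩
  · intro n m
    suffices h : tensorFiltration F G n ≤
        (tensorFiltration F G n).comap ((C.tensor E).proj m) from h
    refine tensorFiltration_le fun i j hij x hx y hy => ?_
    exact tensorSub_le_tensorFiltration hF.mono hij.le
      (DGSpace.proj_mem_tensorSub C.toDGSpace E.toDGSpace (fun n x hx => hF.proj_mem i n hx)
        (fun n x hx => hG.proj_mem j n hx) m _ (DGSpace.tmul_mem_tensorSub _ _ hx hy))
  · intro n
    suffices h : tensorFiltration F G n ≤
        (tensorFiltration F G n).comap (C.tensor E).D from h
    refine tensorFiltration_le fun i j hij x hx y hy => ?_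
    exact Submodule.add_mem _ (mem hij.le ((hF.subcoalgebra i).D_mem x hx) hy)
      (mem hij.le (C.sgn_mem (fun n x hx => hF.proj_mem i n hx) 1 hx)
        ((hG.subcoalgebra j).D_mem y hy))
  · refine le_antisymm (tensorFiltration_le fun i j hij x hx y hy => ?_) ?_
    · obtain ⟨rfl, rfl⟩ : i = 0 ∧ j = 0 := by omega
      rw [hF.zero_eq] at hx
      rw [hG.zero_eq] at hy
      obtain ⟨a, rfl⟩ := Submodule.mem_span_singleton.1 hx
      obtain ⟨b, rfl⟩ := Submodule.mem_span_singleton.1 hy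
      rw [TensorProduct.smul_tmul_smul]
      exact Submodule.smul_mem _ _ (Submodule.mem_span_singleton_self _)
    · rw [Submodule.span_singleton_le_iff_mem]
      exact mem le_rfl (hF.one_mem 0) (hG.one_mem 0)
  · simp [hF.counit_one, hG.counit_one]
  · intro n
    suffices h : tensorFiltration F G (n + 1) ≤ ((C.tensor E).square (tensorFiltration F G n)).comap
        ((C.tensor E).reducedComul (e ⊗ₜ e')) from h
    refine tensorFiltration_le fun i j hij x hx y hy => ?_
    have h1 : ∀ y : E, (e ⊗ₜ[k] e') ⊗ₜ[k] (x ⊗ₜ[k] y) =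
        DGSpace.interchange C.toDGSpace E.toDGSpace ((e ⊗ₜ x) ⊗ₜ (e' ⊗ₜ y)) := fun y => by
      refine C.mem_of_proj_mem (LinearMap.eqLocus
        (TensorProduct.mk k (C ⊗[k] E) (C ⊗[k] E) (e ⊗ₜ e') ∘ₗ (TensorProduct.mk k C E).flip y)
        (DGSpace.interchange C.toDGSpace E.toDGSpace ∘ₗ
          (TensorProduct.mk k (C ⊗[k] C) (E ⊗[k] E)).flip (e' ⊗ₜ y) ∘ₗ
            TensorProduct.mk k C C e)) fun l => ?_
      change _ = DGSpace.interchange C.toDGSpace E.toDGSpace ((e ⊗ₜ C.proj l x) ⊗ₜ (e' ⊗ₜ y))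
      rw [DGSpace.interchange_eq, DGSpace.interchange₄_tmul _ _ _ _ e y (C.proj_mem l x) he',
        mul_zero, koszulSign_zero, one_smul]
      rfl
    have h2 : (x ⊗ₜ[k] y) ⊗ₜ[k] (e ⊗ₜ[k] e') =
        DGSpace.interchange C.toDGSpace E.toDGSpace ((x ⊗ₜ e) ⊗ₜ (y ⊗ₜ e')) := by
      refine E.mem_of_proj_mem (LinearMap.eqLocus
        ((TensorProduct.mk k (C ⊗[k] E) (C ⊗[k] E)).flip (e ⊗ₜ e') ∘ₗ TensorProduct.mk k C E x)
        (DGSpace.interchange C.toDGSpace E.toDGSpace ∘ₗ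
          (TensorProduct.mk k (C ⊗[k] C) (E ⊗[k] E)) (x ⊗ₜ e) ∘ₗ
            (TensorProduct.mk k E E).flip e')) fun l => ?_
      change _ = DGSpace.interchange C.toDGSpace E.toDGSpace ((x ⊗ₜ e) ⊗ₜ (E.proj l y ⊗ₜ e'))
      rw [DGSpace.interchange_eq, DGSpace.interchange₄_tmul _ _ _ _ x e' he (E.proj_mem l y),
        zero_mul, koszulSign_zero, one_smul]
      rfl
    have hx' : C.comul x = C.reducedComul e x + e ⊗ₜ x + x ⊗ₜ e := by
      rw [reducedComul_apply]; abel
    have hy' : E.comul y = E.reducedComul e' y + e' ⊗ₜ y + y ⊗ₜ e' := by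
      rw [reducedComul_apply]; abel
    rw [Submodule.mem_comap, reducedComul_apply, h1, h2, tensor_comul_apply, ← map_sub, ← map_sub]
    -- If one of `x`, `y` is a multiple of the grouplike element, the whole drop must come from the
    -- reduced coproduct of the other one; the cross terms used below would not lie in level `n`.
    rcases Nat.eq_zero_or_pos i with rfl | hi
    · rw [hF.zero_eq] at hx
      obtain ⟨c, rfl⟩ := Submodule.mem_span_singleton.1 hx
      obtain rfl : j = n + 1 := by omega
      rw [map_smul, hF.comul_grouplike hC, hy']
      have := inter (n := n) (by omega) _ (Submodule.smul_mem _ c hee) _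
        (hG.reducedComul_mem hE n hy)
      convert this using 2
      simp only [TensorProduct.tmul_add, TensorProduct.tmul_smul, ← TensorProduct.smul_tmul']
      abel
    rcases Nat.eq_zero_or_pos j with rfl | hj
    · rw [hG.zero_eq] at hy
      obtain ⟨c, rfl⟩ := Submodule.mem_span_singleton.1 hy
      obtain rfl : i = n + 1 := by omega
      rw [map_smul, hG.comul_grouplike hE, hx']
      have := inter (n := n) (by omega) _ (hF.reducedComul_mem hC n hx) _
        (Submodule.smul_mem _ c hee')
      convert this using 2
      simp only [TensorProduct.add_tmul, TensorProduct.tmul_smul, ← TensorProduct.smul_tmul',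
        smul_add]
      abel
    obtain ⟨i, rfl⟩ : ∃ i', i = i' + 1 := ⟨i - 1, by omega⟩
    obtain ⟨j, rfl⟩ : ∃ j', j = j' + 1 := ⟨j - 1, by omega⟩
    -- With `n = i + j + 1`, the first two summands lose one level through a reduced coproduct. The
    -- last two are, after interchange and up to signs on components, `(e ⊗ y) ⊗ (x ⊗ e')` and `(x ⊗
    -- e') ⊗ (e ⊗ y)`, whose factors have levels `i + 1` and `j + 1`, at most `n`.
    have h3 : C.comul x ⊗ₜ[k] E.comul y - (e ⊗ₜ x) ⊗ₜ (e' ⊗ₜ y) - (x ⊗ₜ e) ⊗ₜ (y ⊗ₜ e') =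
        C.reducedComul e x ⊗ₜ E.comul y +
          (e ⊗ₜ x + x ⊗ₜ e) ⊗ₜ E.reducedComul e' y +
          ((e ⊗ₜ x) ⊗ₜ (y ⊗ₜ e') + (x ⊗ₜ e) ⊗ₜ (e' ⊗ₜ y)) := by
      rw [hx', hy']
      simp only [TensorProduct.tmul_add, TensorProduct.add_tmul]
      abel
    have h4 : ∀ {x : C} {y : E}, x ∈ F (i + 1) → y ∈ G (j + 1) →
        x ⊗ₜ[k] e' ∈ tensorFiltration F G n ∧ e ⊗ₜ[k] y ∈ tensorFiltration F G n := fun hx hy =>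
      ⟨mem (i := i + 1) (j := 0) (by omega) hx (hG.one_mem 0),
        mem (i := 0) (j := j + 1) (by omega) (hF.one_mem 0) hy⟩
    rw [h3, map_add, map_add]
    refine Submodule.add_mem _ (Submodule.add_mem _ ?_ ?_) ?_
    · exact inter (by omega) _ (hF.reducedComul_mem hC i hx) _ (hcom' hy)
    · exact inter (i := i + 1) (by omega) _ (Submodule.add_mem _
        (C.tmul_mem_square (hF.one_mem _) hx) (C.tmul_mem_square hx (hF.one_mem _))) _
        (hG.reducedComul_mem hE j hy)
    · rw [map_add]
      refine Submodule.add_mem _ ?_ ?_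
      · have := DGSpace.interchange₄_mem C.toDGSpace C.toDGSpace E.toDGSpace E.toDGSpace
          (fun n x hx => hF.proj_mem (i + 1) n hx) (fun n x hx => hG.proj_mem (j + 1) n hx)
          (DGSpace.tmul_mem_tensorSub C.toDGSpace C.toDGSpace (hF.one_mem 0) hx)
          (DGSpace.tmul_mem_tensorSub E.toDGSpace E.toDGSpace hy (hG.one_mem 0))
        exact DGSpace.tensorSub_mono _ _ (tensorSub_le_tensorFiltration hF.mono (by omega))
          (tensorSub_le_tensorFiltration hF.mono (by omega)) this
      · have := DGSpace.interchange₄_mem C.toDGSpace C.toDGSpace E.toDGSpace E.toDGSpace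
          (fun n x hx => hF.proj_mem 0 n hx) (fun n x hx => hG.proj_mem 0 n hx)
          (DGSpace.tmul_mem_tensorSub C.toDGSpace C.toDGSpace hx (hF.one_mem 0))
          (DGSpace.tmul_mem_tensorSub E.toDGSpace E.toDGSpace (hG.one_mem 0) hy)
        exact DGSpace.tensorSub_mono _ _ (tensorSub_le_tensorFiltration hF.mono (by omega))
          (tensorSub_le_tensorFiltration hF.mono (by omega)) this
  · intro n
    suffices h : tensorFiltration F G (n + 1) ≤ ((C.tensor E).square (tensorFiltration F G n)).comap
        (C.tensor E).cobracket from h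
    refine tensorFiltration_le fun i j hij x hx y hy => ?_
    rw [Submodule.mem_comap, tensor_cobracket_apply]
    refine Submodule.add_mem _ ?_ ?_
    · rcases Nat.eq_zero_or_pos i with rfl | hi
      · rw [hF.cobracket_one x (hF.mono zero_le_one hx), TensorProduct.zero_tmul, map_zero]
        exact Submodule.zero_mem _
      · obtain ⟨i, rfl⟩ : ∃ i', i = i' + 1 := ⟨i - 1, by omega⟩
        exact inter (by omega) _ (hF.cobracket_mem' i hx) _ (hcom' hy)
    · rcases Nat.eq_zero_or_pos j with rfl | hj
      · rw [hG.cobracket_one y (hG.mono zero_le_one hy), TensorProduct.tmul_zero, map_zero]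
        exact Submodule.zero_mem _
      · obtain ⟨j, rfl⟩ : ∃ j', j = j' + 1 := ⟨j - 1, by omega⟩
        exact inter (by omega) _ (hcom (C.sgn_mem (fun n x hx => hF.proj_mem i n hx) (d - 1) hx)) _
          (hG.cobracket_mem' j hy)

theorem IsCoproartinian.tensor (hC : C.IsCoproartinian) (hE : E.IsCoproartinian) :
    (C.tensor E).IsCoproartinian := by
  obtain ⟨F, e, hF⟩ := hC.exists_filtration
  obtain ⟨G, e', hG⟩ := hE.exists_filtration
  exact ⟨hC.isDCoalgebra.tensor hE.isDCoalgebra, _, _,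
    hF.tensor hC.isDCoalgebra hE.isDCoalgebra hG⟩

theorem IsCoproartinian.isGrouplike_tmul (hC : C.IsCoproartinian) {e : C} {e' : E}
    (he : C.IsGrouplike e) (he' : E.IsGrouplike e') : (C.tensor E).IsGrouplike (e ⊗ₜ e') := by
  refine ⟨?_, by simp [he.2, he'.2]⟩
  rw [tensor_comul_apply, he.1, he'.1, DGSpace.interchange_eq,
    DGSpace.interchange₄_unit_left _ _ _ (hC.grouplike_mem_gr he), TensorProduct.map_tmul]
  rfl

end DCoalgebraOps

/-! ### Morphisms of tensor products: functoriality, associator, units -/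

namespace DCoalgebraOps

variable {k : Type u} [Field k] {d : ℤ} {C E C' E' G : DCoalgebraOps k d}

theorem IsGradedHom.tensor {f : C →ₗ[k] C'} {g : E →ₗ[k] E'} (hf : C.IsGradedHom C' f)
    (hg : E.IsGradedHom E' g) : (C.tensor E).IsGradedHom (C'.tensor E') (TensorProduct.map f g) := by
  have h := DGSpace.interchange₄_comp_map (A := C.toDGSpace) (B := C.toDGSpace)
    (A' := E.toDGSpace) (B' := E.toDGSpace) (A₁ := C'.toDGSpace) (B₁ := C'.toDGSpace)
    (A₁' := E'.toDGSpace) (B₁' := E'.toDGSpace) f g hf.hasDegree hg.hasDegree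
  refine ⟨DGSpace.hasDegree_zero_iff.1 (DGSpace.hasDegree_map hf.hasDegree hg.hasDegree
    (add_zero 0)), fun t => ?_, fun t => ?_, fun t => ?_⟩
  · suffices h : (C'.tensor E').counit ∘ₗ TensorProduct.map f g = (C.tensor E).counit from
      LinearMap.congr_fun h t
    rw [LinearMap.comp_assoc, ← TensorProduct.map_comp, hf.counit_comp, hg.counit_comp]
  · suffices h : (C'.tensor E').comul ∘ₗ TensorProduct.map f g =
        TensorProduct.map (TensorProduct.map f g) (TensorProduct.map f g) ∘ₗ (C.tensor E).comul from
      LinearMap.congr_fun h t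
    rw [← LinearMap.comp_assoc, DGSpace.interchange_eq C.toDGSpace]
    refine Eq.trans ?_ (congrArg (· ∘ₗ _) h)
    rw [LinearMap.comp_assoc, LinearMap.comp_assoc, ← TensorProduct.map_comp,
      ← TensorProduct.map_comp, hf.comul_comp, hg.comul_comp]
    rfl
  · suffices h : (C'.tensor E').cobracket ∘ₗ TensorProduct.map f g =
        TensorProduct.map (TensorProduct.map f g) (TensorProduct.map f g) ∘ₗ
          (C.tensor E).cobracket from LinearMap.congr_fun h t
    rw [← LinearMap.comp_assoc, DGSpace.interchange_eq C.toDGSpace]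
    refine Eq.trans ?_ (congrArg (· ∘ₗ _) h)
    rw [LinearMap.comp_assoc, LinearMap.comp_assoc, LinearMap.add_comp, LinearMap.comp_add _ _
      (TensorProduct.map (TensorProduct.map f f) (TensorProduct.map g g)),
      ← TensorProduct.map_comp, ← TensorProduct.map_comp, ← TensorProduct.map_comp,
      ← TensorProduct.map_comp, hf.cobracket_comp, hg.comul_comp, hg.cobracket_comp,
      LinearMap.comp_assoc, hf.hasDegree.sgn_comp_zero, ← LinearMap.comp_assoc, hf.comul_comp,
      LinearMap.comp_assoc]
    rfl

theorem IsHom.tensor {f : C →ₗ[k] C'} {g : E →ₗ[k] E'} (hf : C.IsHom C' f)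
    (hg : E.IsHom E' g) : (C.tensor E).IsHom (C'.tensor E') (TensorProduct.map f g) := by
  refine ⟨hf.toIsGradedHom.tensor hg.toIsGradedHom, fun t => ?_⟩
  suffices h : TensorProduct.map f g ∘ₗ (C.tensor E).D =
      (C'.tensor E').D ∘ₗ TensorProduct.map f g from LinearMap.congr_fun h t
  have h1 : f ∘ₗ C.D = C'.D ∘ₗ f := LinearMap.ext hf.map_D
  have h2 : g ∘ₗ E.D = E'.D ∘ₗ g := LinearMap.ext hg.map_D
  rw [LinearMap.comp_add, LinearMap.add_comp, ← TensorProduct.map_comp, ← TensorProduct.map_comp,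
    ← TensorProduct.map_comp, ← TensorProduct.map_comp, h1, h2, hf.hasDegree.sgn_comp_zero,
    LinearMap.id_comp, LinearMap.comp_id]

/-- Both routes perform the same signed permutation of six factors. This coherence is what makes the
associator compatible with the coproduct and the cobracket. -/
theorem assoc_comp_interchange (M N L : DGSpace k) :
    TensorProduct.map (TensorProduct.assoc k M N L).toLinearMap
        (TensorProduct.assoc k M N L).toLinearMap ∘ₗ
      DGSpace.interchange (M.tensor N) L ∘ₗ
        TensorProduct.map (DGSpace.interchange M N) LinearMap.id =
    DGSpace.interchange M (N.tensor L) ∘ₗ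
      TensorProduct.map LinearMap.id (DGSpace.interchange N L) ∘ₗ
        (TensorProduct.assoc k (M ⊗[k] M) (N ⊗[k] N) (L ⊗[k] L)).toLinearMap := by
  refine TensorProduct.ext (DGSpace.tensor_hom_ext₄ M M N N fun a x hx b y hy a' x' hx' b' y' hy' =>
    DGSpace.tensor_hom_ext L L fun c z hz c' z' hz' => ?_)
  simp only [LinearMap.compr₂ₛₗ_apply, TensorProduct.mk_apply, LinearMap.comp_apply,
    LinearEquiv.coe_coe, TensorProduct.assoc_tmul, TensorProduct.map_tmul, DGSpace.interchange_eq,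
    LinearMap.id_apply, DGSpace.interchange₄_tmul M M N N x y' hy hx',
    DGSpace.interchange₄_tmul N N L L x' z' hy' hz, ← TensorProduct.smul_tmul',
    TensorProduct.tmul_smul, map_smul,
    DGSpace.interchange₄_tmul (M.tensor N) (M.tensor N) L L _ z' (DGSpace.tmul_mem M N hy hy') hz,
    DGSpace.interchange₄_tmul M M (N.tensor L) (N.tensor L) x _ hy (DGSpace.tmul_mem N L hx' hz),
    smul_smul, ← koszulSign_add]
  congr 1
  exact koszulSign_congr (by push_cast; grind)

theorem isHom_assoc (C E G : DCoalgebraOps k d) :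
    ((C.tensor E).tensor G).IsHom (C.tensor (E.tensor G))
    (TensorProduct.assoc k C E G).toLinearMap := by
  have hA := assoc_comp_interchange C.toDGSpace E.toDGSpace G.toDGSpace
  have hsgn := DGSpace.sgn_tensor C.toDGSpace E.toDGSpace
  refine ⟨⟨?_, fun t => ?_, fun t => ?_, fun t => ?_⟩, fun t => ?_⟩
  · refine DGSpace.hasDegree_zero_iff.1 (DGSpace.hasDegree_iff_proj_comp.2 fun n => ?_)
    refine DGSpace.tensor_hom_ext₃ C.toDGSpace E.toDGSpace G.toDGSpace
      fun i x hx j y hy l z hz => ?_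
    have h1 := DGSpace.tmul_mem (C.toDGSpace.tensor E.toDGSpace) G.toDGSpace
      (DGSpace.tmul_mem C.toDGSpace E.toDGSpace hx hy) hz
    have h2 := DGSpace.tmul_mem C.toDGSpace (E.toDGSpace.tensor G.toDGSpace) hx
      (DGSpace.tmul_mem E.toDGSpace G.toDGSpace hy hz)
    rw [LinearMap.comp_apply, LinearMap.comp_apply, LinearEquiv.coe_coe, TensorProduct.assoc_tmul]
    rcases eq_or_ne (i + j + l) n with h | h
    · subst h
      rw [DGSpace.proj_of_mem _ h1, TensorProduct.assoc_tmul, DGSpace.proj_of_mem]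
      rw [add_zero, add_assoc]
      exact h2
    · rw [DGSpace.proj_of_mem_ne _ h1 h, DGSpace.proj_of_mem_ne _ h2 (by omega), map_zero]
  · suffices h : (C.tensor (E.tensor G)).counit ∘ₗ (TensorProduct.assoc k C E G).toLinearMap =
      ((C.tensor E).tensor G).counit from LinearMap.congr_fun h t
    refine TensorProduct.ext_threefold fun x y z => ?_
    simp [mul_assoc]
  · suffices h : (C.tensor (E.tensor G)).comul ∘ₗ (TensorProduct.assoc k C E G).toLinearMap =
        TensorProduct.map (TensorProduct.assoc k C E G).toLinearMap
          (TensorProduct.assoc k C E G).toLinearMap ∘ₗ ((C.tensor E).tensor G).comul from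
      LinearMap.congr_fun h t
    refine TensorProduct.ext_threefold fun x y z => ?_
    exact (LinearMap.congr_fun hA ((C.comul x ⊗ₜ E.comul y) ⊗ₜ G.comul z)).symm
  · suffices h : (C.tensor (E.tensor G)).cobracket ∘ₗ (TensorProduct.assoc k C E G).toLinearMap =
        TensorProduct.map (TensorProduct.assoc k C E G).toLinearMap
          (TensorProduct.assoc k C E G).toLinearMap ∘ₗ ((C.tensor E).tensor G).cobracket from
      LinearMap.congr_fun h t
    refine TensorProduct.ext_threefold fun x y z => ?_
    have h1 := fun a b c => LinearMap.congr_fun hA ((a ⊗ₜ b) ⊗ₜ c)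
    simp only [LinearMap.comp_apply, LinearEquiv.coe_coe, TensorProduct.assoc_tmul,
      TensorProduct.map_tmul, LinearMap.id_apply] at h1
    simp only [LinearMap.comp_apply, LinearEquiv.coe_coe, TensorProduct.assoc_tmul,
      TensorProduct.map_tmul, LinearMap.add_apply, hsgn, map_add, TensorProduct.add_tmul,
      TensorProduct.tmul_add, h1, add_assoc]
  · suffices h : (TensorProduct.assoc k C E G).toLinearMap ∘ₗ ((C.tensor E).tensor G).D =
        (C.tensor (E.tensor G)).D ∘ₗ (TensorProduct.assoc k C E G).toLinearMap from
      LinearMap.congr_fun h t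
    refine TensorProduct.ext_threefold fun x y z => ?_
    simp only [LinearMap.comp_apply, LinearEquiv.coe_coe, TensorProduct.assoc_tmul,
      TensorProduct.map_tmul, LinearMap.add_apply, hsgn, map_add, TensorProduct.add_tmul,
      TensorProduct.tmul_add, LinearMap.id_apply, add_assoc]

/-- The inclusion `x ↦ e ⊗ x`. -/
theorem isHom_unit_tmul (hC : C.IsCoproartinian) {e : C} (he : C.IsGrouplike e)
    (E : DCoalgebraOps k d) : E.IsHom (C.tensor E) (TensorProduct.mk k C E e) := by
  have he0 := hC.grouplike_mem_gr he
  have hs : ∀ q, C.sgn q e = e := fun q => by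
    rw [C.sgn_apply' q he0, mul_zero, koszulSign_zero, one_smul]
  refine ⟨⟨fun n x hx => ?_, fun x => ?_, fun x => ?_, fun x => ?_⟩, fun x => ?_⟩
  · rw [← zero_add n]
    exact DGSpace.tmul_mem C.toDGSpace E.toDGSpace he0 hx
  · simp [he.2]
  · rw [TensorProduct.mk_apply, tensor_comul_apply, he.1]
    exact DGSpace.interchange₄_unit_left _ _ _ he0 _
  · rw [TensorProduct.mk_apply, tensor_cobracket_apply, hC.cobracket_grouplike he,
      TensorProduct.zero_tmul, map_zero, zero_add, hs, he.1]
    exact DGSpace.interchange₄_unit_left _ _ _ he0 _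
  · simp [hC.D_grouplike he, hs]

/-- The inclusion `x ↦ x ⊗ e`. -/
theorem isHom_tmul_unit (hE : E.IsCoproartinian) {e : E} (he : E.IsGrouplike e)
    (C : DCoalgebraOps k d) : C.IsHom (C.tensor E) ((TensorProduct.mk k C E).flip e) := by
  have he0 := hE.grouplike_mem_gr he
  refine ⟨⟨fun n x hx => ?_, fun x => ?_, fun x => ?_, fun x => ?_⟩, fun x => ?_⟩
  · rw [← add_zero n]
    exact DGSpace.tmul_mem C.toDGSpace E.toDGSpace hx he0
  · simp [he.2]
  · rw [LinearMap.flip_apply, TensorProduct.mk_apply, tensor_comul_apply, he.1]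
    exact DGSpace.interchange₄_unit_right _ _ _ he0 _
  · rw [LinearMap.flip_apply, TensorProduct.mk_apply, tensor_cobracket_apply,
      hE.cobracket_grouplike he, TensorProduct.tmul_zero, map_zero, add_zero, he.1]
    exact DGSpace.interchange₄_unit_right _ _ _ he0 _
  · simp [hE.D_grouplike he]

/-- The projection `x ⊗ s ↦ ε(s) x`. -/
theorem isHom_tensor_counit (C : DCoalgebraOps k d) (hE : E.IsDCoalgebra) :
    (C.tensor E).IsHom C ((TensorProduct.rid k C).toLinearMap ∘ₗ
      TensorProduct.map LinearMap.id E.counit) := by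
  generalize hP : (TensorProduct.rid k C).toLinearMap ∘ₗ
      TensorProduct.map LinearMap.id E.counit = P
  have hPt : ∀ x y, P (x ⊗ₜ y) = E.counit y • x := fun x y => by simp [← hP]
  -- As for the counit of a tensor product, the interchange sign occurs only where the counit
  -- already vanishes.
  have hI : ∀ (t : C ⊗[k] C) (t' : E ⊗[k] E), TensorProduct.map P P
      (DGSpace.interchange C.toDGSpace E.toDGSpace (t ⊗ₜ t')) =
      E.counit (TensorProduct.lid k E (TensorProduct.map E.counit LinearMap.id t')) • t := by
    intro t t'
    suffices h : TensorProduct.map P P ∘ₗ DGSpace.interchange C.toDGSpace E.toDGSpace =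
        (TensorProduct.rid k (C ⊗[k] C)).toLinearMap ∘ₗ TensorProduct.map LinearMap.id
          (E.counit ∘ₗ (TensorProduct.lid k E).toLinearMap ∘ₗ
            TensorProduct.map E.counit LinearMap.id) by
      have := LinearMap.congr_fun h (t ⊗ₜ t')
      simpa using this
    refine DGSpace.tensor_hom_ext₄ C.toDGSpace C.toDGSpace E.toDGSpace E.toDGSpace
      fun i x hx j y hy i' x' hx' j' y' hy' => ?_
    rw [LinearMap.comp_apply, DGSpace.interchange_eq,
      DGSpace.interchange₄_tmul _ _ _ _ x y' hy hx']
    simp only [map_smul, TensorProduct.map_tmul, hPt, LinearMap.comp_apply, LinearMap.id_apply,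
      LinearEquiv.coe_coe, TensorProduct.lid_tmul, TensorProduct.rid_tmul, smul_eq_mul,
      TensorProduct.smul_tmul_smul]
    rcases eq_or_ne i' 0 with rfl | hi
    · rw [mul_zero, koszulSign_zero, one_smul]
    · simp [hE.counit_eq_zero i' x' hi hx']
  have h1 : ∀ y, TensorProduct.lid k E (TensorProduct.map E.counit LinearMap.id (E.comul y)) = y :=
    LinearMap.congr_fun hE.counit_comul
  have h2 : ∀ y, TensorProduct.map E.counit LinearMap.id (E.cobracket y) = (0 : k ⊗[k] E) :=
    LinearMap.congr_fun hE.counit_cobracket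
  refine ⟨⟨fun n => ?_, fun t => ?_, fun t => ?_, fun t => ?_⟩, fun t => ?_⟩
  · suffices h : DGSpace.tensorGr C.toDGSpace E.toDGSpace n ≤ (C.gr n).comap P from h
    refine DGSpace.tensorGr_le _ _ fun i j hij x hx y hy => ?_
    rw [Submodule.mem_comap, hPt]
    rcases eq_or_ne j 0 with rfl | hj
    · obtain rfl : i = n := by omega
      exact Submodule.smul_mem _ _ hx
    · rw [hE.counit_eq_zero j y hj hy, zero_smul]
      exact Submodule.zero_mem _
  · suffices h : C.counit ∘ₗ P = (C.tensor E).counit from LinearMap.congr_fun h t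
    refine TensorProduct.ext' fun x y => ?_
    simp [hPt, mul_comm]
  · suffices h : C.comul ∘ₗ P = TensorProduct.map P P ∘ₗ (C.tensor E).comul from
      LinearMap.congr_fun h t
    refine TensorProduct.ext' fun x y => ?_
    rw [LinearMap.comp_apply, LinearMap.comp_apply, tensor_comul_apply, hI, h1, hPt, map_smul]
  · suffices h : C.cobracket ∘ₗ P = TensorProduct.map P P ∘ₗ (C.tensor E).cobracket from
      LinearMap.congr_fun h t
    refine TensorProduct.ext' fun x y => ?_
    rw [LinearMap.comp_apply, LinearMap.comp_apply, tensor_cobracket_apply, map_add, hI, hI, h1, h2,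
      hPt, map_smul, map_zero, map_zero, zero_smul, add_zero]
  · suffices h : P ∘ₗ (C.tensor E).D = C.D ∘ₗ P from LinearMap.congr_fun h t
    refine TensorProduct.ext' fun x y => ?_
    simp [hPt, hE.counit_D]

end DCoalgebraOps

/-! ### Morphisms tested on jointly surjective families, and the dual numbers -/

theorem LinearMap.ext_of_iSup_range {k : Type*} [Field k] {ι : Type*} {A : ι → Type*} {B P : Type*}
    [∀ i, AddCommGroup (A i)] [∀ i, Module k (A i)] [AddCommGroup B] [Module k B] [AddCommGroup P]
    [Module k P] {g : ∀ i, A i →ₗ[k] B} (hg : ⨆ i, LinearMap.range (g i) = ⊤) {f f' : B →ₗ[k] P}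
    (h : ∀ i, f ∘ₗ g i = f' ∘ₗ g i) : f = f' := by
  refine LinearMap.eqLocus_eq_top.1 (eq_top_iff.2 (hg ▸ iSup_le fun i => ?_))
  rintro _ ⟨x, rfl⟩
  exact LinearMap.congr_fun (h i) x

namespace DCoalgebraOps

variable {k : Type u} [Field k] {d : ℤ}

/-- Every clause is an equality of linear maps on `T`, hence may be tested on the ranges of the `g
i`; homogeneity is first rewritten as commutation with projections. -/
theorem isHom_of_jointly_surjective {ι : Type*} {S : ι → DCoalgebraOps k d}
    {T E : DCoalgebraOps k d} {g : ∀ i, S i →ₗ[k] T} {f : T →ₗ[k] E}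
    (hg : ∀ i, (S i).IsHom T (g i)) (hs : ⨆ i, LinearMap.range (g i) = ⊤)
    (hf : ∀ i, (S i).IsHom E (f ∘ₗ g i)) : T.IsHom E f := by
  refine ⟨⟨?_, fun x => ?_, fun x => ?_, fun x => ?_⟩, fun x => ?_⟩
  · refine DGSpace.hasDegree_zero_iff.1 (DGSpace.hasDegree_iff_proj_comp.2 fun n =>
      LinearMap.ext_of_iSup_range hs fun i => LinearMap.ext fun x => ?_)
    have h1 := (hf i).proj_nat n x
    have h2 := (hg i).proj_nat n x
    rw [LinearMap.comp_apply] at h1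
    rw [add_zero]
    simp only [LinearMap.comp_apply]
    rw [h1, h2, LinearMap.comp_apply]
  · suffices h : E.counit ∘ₗ f = T.counit from LinearMap.congr_fun h x
    refine LinearMap.ext_of_iSup_range hs fun i => LinearMap.ext fun x => ?_
    exact ((hf i).map_counit x).trans ((hg i).map_counit x).symm
  · suffices h : E.comul ∘ₗ f = TensorProduct.map f f ∘ₗ T.comul from LinearMap.congr_fun h x
    refine LinearMap.ext_of_iSup_range hs fun i => LinearMap.ext fun x => ?_
    rw [LinearMap.comp_assoc, LinearMap.comp_apply, (hf i).map_comul, TensorProduct.map_comp,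
      LinearMap.comp_apply, ← (hg i).map_comul]
    rfl
  · suffices h : E.cobracket ∘ₗ f = TensorProduct.map f f ∘ₗ T.cobracket from
      LinearMap.congr_fun h x
    refine LinearMap.ext_of_iSup_range hs fun i => LinearMap.ext fun x => ?_
    rw [LinearMap.comp_assoc, LinearMap.comp_apply, (hf i).map_cobracket, TensorProduct.map_comp,
      LinearMap.comp_apply, ← (hg i).map_cobracket]
    rfl
  · suffices h : f ∘ₗ T.D = E.D ∘ₗ f from LinearMap.congr_fun h x
    refine LinearMap.ext_of_iSup_range hs fun i => LinearMap.ext fun x => ?_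
    rw [LinearMap.comp_apply, LinearMap.comp_apply, ← (hg i).map_D]
    exact (hf i).map_D x

section Dual

/-- The coproduct of `dualNumbers`. -/
def dualComul (k : Type u) [Field k] : k × k →ₗ[k] (k × k) ⊗[k] (k × k) :=
  LinearMap.coprod (LinearMap.toSpanSingleton k _ ((1, 0) ⊗ₜ (1, 0)))
    (LinearMap.toSpanSingleton k _ ((1, 0) ⊗ₜ (0, 1) + (0, 1) ⊗ₜ (1, 0)))

/-- The coalgebra spanned by a grouplike element and a primitive element of degree `n`. -/
def dualNumbers (k : Type u) [Field k] (d n : ℤ) : DCoalgebraOps k d where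
  carrier := k × k
  gr m := Submodule.prod (if m = 0 then ⊤ else ⊥) (if m = n then ⊤ else ⊥)
  internal := by
    refine DGSpace.isInternal_of_proj _ (fun m => LinearMap.prodMap
      (if m = 0 then LinearMap.id else 0) (if m = n then LinearMap.id else 0)) ?_ ?_ ?_
    · rintro m ⟨a, b⟩ ⟨ha, hb⟩
      refine Prod.ext ?_ ?_
      · by_cases h : m = 0 <;> simp_all
      · by_cases h : m = n <;> simp_all
    · rintro l m hlm ⟨a, b⟩ ⟨ha, hb⟩
      refine Prod.ext ?_ ?_
      · by_cases h : l = 0 <;> by_cases h' : m = 0 <;> simp_all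
      · by_cases h : l = n <;> by_cases h' : m = n <;> simp_all
    · rw [eq_top_iff]
      rintro ⟨a, b⟩ -
      have h1 : (a, (0 : k)) ∈ ⨆ m : ℤ, Submodule.prod (if m = 0 then ⊤ else ⊥ : Submodule k k)
          (if m = n then ⊤ else ⊥ : Submodule k k) := Submodule.mem_iSup_of_mem 0 (by simp)
      have h2 : ((0 : k), b) ∈ ⨆ m : ℤ, Submodule.prod (if m = 0 then ⊤ else ⊥ : Submodule k k)
          (if m = n then ⊤ else ⊥ : Submodule k k) := Submodule.mem_iSup_of_mem n (by simp)
      simpa using Submodule.add_mem _ h1 h2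
  D := 0
  D_mem m x hx := Submodule.zero_mem _
  D_D x := rfl
  comul := dualComul k
  counit := LinearMap.fst k k k
  cobracket := 0

variable (k d) (n : ℤ)

/-- The grouplike element of `dualNumbers`. -/
def dualOne : dualNumbers k d n := ((1, 0) : k × k)

/-- The primitive element of `dualNumbers`. -/
def dualEta : dualNumbers k d n := ((0, 1) : k × k)

theorem dualOne_mem : dualOne k d n ∈ (dualNumbers k d n).gr 0 := by
  change ((1, 0) : k × k) ∈ Submodule.prod (if (0 : ℤ) = 0 then ⊤ else ⊥ : Submodule k k)
    (if 0 = n then ⊤ else ⊥ : Submodule k k)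
  simp [Submodule.mem_prod]

theorem dualEta_mem : dualEta k d n ∈ (dualNumbers k d n).gr n := by
  change ((0, 1) : k × k) ∈ Submodule.prod (if n = 0 then ⊤ else ⊥ : Submodule k k)
    (if n = n then ⊤ else ⊥ : Submodule k k)
  simp [Submodule.mem_prod]

theorem comul_dualOne : (dualNumbers k d n).comul (dualOne k d n) =
    dualOne k d n ⊗ₜ dualOne k d n := by
  have h : dualComul k (1, 0) = (1, 0) ⊗ₜ (1, 0) := by simp [dualComul]
  exact h

theorem comul_dualEta : (dualNumbers k d n).comul (dualEta k d n) =
    dualOne k d n ⊗ₜ dualEta k d n + dualEta k d n ⊗ₜ dualOne k d n := by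
  have h : dualComul k (0, 1) = (1, 0) ⊗ₜ (0, 1) + (0, 1) ⊗ₜ (1, 0) := by simp [dualComul]
  exact h

theorem counit_dualOne : (dualNumbers k d n).counit (dualOne k d n) = 1 := rfl

theorem counit_dualEta : (dualNumbers k d n).counit (dualEta k d n) = 0 := rfl

theorem cobracket_dualNumbers : (dualNumbers k d n).cobracket = 0 := rfl

theorem D_dualNumbers : (dualNumbers k d n).D = 0 := rfl

variable {k d n}

theorem dualNumbers_eq (x : dualNumbers k d n) :
    ∃ a b : k, x = a • dualOne k d n + b • dualEta k d n :=
  have h : ∀ y : k × k, y = y.1 • ((1, 0) : k × k) + y.2 • ((0, 1) : k × k) := fun y => by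
    simp
  ⟨x.1, x.2, h x⟩

theorem dualNumbers_hom_ext {P : Type*} [AddCommGroup P] [Module k P]
    {f g : dualNumbers k d n →ₗ[k] P} (h1 : f (dualOne k d n) = g (dualOne k d n))
    (h2 : f (dualEta k d n) = g (dualEta k d n)) : f = g := by
  refine LinearMap.ext fun x => ?_
  obtain ⟨a, b, rfl⟩ := dualNumbers_eq x
  simp only [map_add, map_smul, h1, h2]

variable (k d n)

theorem dualNumbers_isDCoalgebra : (dualNumbers k d n).IsDCoalgebra := by
  have h1 := dualOne_mem k d n
  have hη := dualEta_mem k d n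
  have hdeg : DGSpace.HasDegree (dualNumbers k d n).toDGSpace
      ((dualNumbers k d n).toDGSpace.tensor (dualNumbers k d n).toDGSpace) 0
      (dualNumbers k d n).comul := by
    refine DGSpace.hasDegree_iff_proj_comp.2 fun m => dualNumbers_hom_ext ?_ ?_
    · have h2 := DGSpace.tmul_mem _ _ h1 h1
      rw [LinearMap.comp_apply, LinearMap.comp_apply, comul_dualOne, add_zero]
      rcases eq_or_ne 0 m with rfl | hm
      · rw [add_zero] at h2
        rw [DGSpace.proj_of_mem _ h1, comul_dualOne, DGSpace.proj_of_mem _ h2]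
      · rw [DGSpace.proj_of_mem_ne _ h1 hm, DGSpace.proj_of_mem_ne _ h2 (by simpa using hm), map_zero]
    · have h2 := DGSpace.tmul_mem _ _ h1 hη
      have h3 := DGSpace.tmul_mem _ _ hη h1
      rw [LinearMap.comp_apply, LinearMap.comp_apply, comul_dualEta, add_zero, map_add]
      rcases eq_or_ne n m with rfl | hm
      · rw [DGSpace.proj_of_mem _ hη, comul_dualEta]
        rw [zero_add] at h2
        rw [add_zero] at h3
        rw [DGSpace.proj_of_mem _ h2, DGSpace.proj_of_mem _ h3]
      · rw [DGSpace.proj_of_mem_ne _ hη hm, DGSpace.proj_of_mem_ne _ h2 (by simpa using hm),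
          DGSpace.proj_of_mem_ne _ h3 (by simpa using hm), map_zero, add_zero]
  have hδ := cobracket_dualNumbers k d n
  have hD := D_dualNumbers k d n
  refine ⟨DGSpace.hasDegree_zero_iff.1 hdeg, fun m x hm hx => ?_, fun m x _ => ?_, fun x => ?_,
    fun x => ?_, fun x => ?_, ?_, ?_, ?_, ?_, ?_, ?_, ?_⟩
  · have := hx.1
    rw [if_neg hm] at this
    exact this
  · rw [hδ]
    exact Submodule.zero_mem _
  · simp only [hD, LinearMap.zero_apply, map_zero, TensorProduct.map_zero_left,
      TensorProduct.map_zero_right, add_zero]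
  · rw [hD]; simp
  · rw [hδ, hD]; simp
  · refine dualNumbers_hom_ext ?_ ?_
    · simp [comul_dualOne]
    · simp [comul_dualEta, comul_dualOne, TensorProduct.add_tmul, TensorProduct.tmul_add, add_assoc]
  · refine dualNumbers_hom_ext ?_ ?_
    · rw [LinearMap.comp_apply, comul_dualOne, DGSpace.swap_tmul _ _ h1 h1]
      simp [koszulSign_zero]
    · rw [LinearMap.comp_apply, comul_dualEta, map_add, DGSpace.swap_tmul _ _ h1 hη,
        DGSpace.swap_tmul _ _ hη h1]
      simp [koszulSign_zero, add_comm]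
  · refine dualNumbers_hom_ext ?_ ?_
    · simp [comul_dualOne, counit_dualOne]
    · simp [comul_dualEta, counit_dualOne, counit_dualEta]
  · rw [hδ]; simp
  · rw [hδ]; simp
  · rw [hδ]; simp
  · rw [hδ]; simp

theorem dualNumbers_isCoproartinian : (dualNumbers k d n).IsCoproartinian := by
  have hC := dualNumbers_isDCoalgebra k d n
  refine ⟨hC, fun i => if i = 0 then Submodule.span k {dualOne k d n} else ⊤, dualOne k d n,
    hC.isCoartFiltration (fun i j hij => ?_) (fun x => ⟨1, by simp⟩) (fun i m x hx => ?_)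
      (fun i x hx => ?_) (by simp) (counit_dualOne k d n) (fun i x hx => ?_) fun i x hx => ?_⟩
  · by_cases hj : j = 0
    · have : i = 0 := by omega
      simp [hj, this]
    · simp [hj]
  · by_cases hi : i = 0
    · simp only [hi, if_true] at hx ⊢
      obtain ⟨c, rfl⟩ := Submodule.mem_span_singleton.1 hx
      rw [map_smul]
      refine Submodule.smul_mem _ _ ?_
      rcases eq_or_ne 0 m with rfl | hm
      · rw [DGSpace.proj_of_mem _ (dualOne_mem k d n)]
        exact Submodule.mem_span_singleton_self _
      · rw [DGSpace.proj_of_mem_ne _ (dualOne_mem k d n) hm]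
        exact Submodule.zero_mem _
    · simp [hi]
  · rw [D_dualNumbers]
    exact Submodule.zero_mem _
  · obtain ⟨a, b, rfl⟩ := dualNumbers_eq x
    have h : (dualNumbers k d n).reducedComul (dualOne k d n)
        (a • dualOne k d n + b • dualEta k d n) = -(a • (dualOne k d n ⊗ₜ[k] dualOne k d n)) := by
      rw [reducedComul_apply, map_add, map_smul, map_smul, comul_dualOne, comul_dualEta]
      simp only [TensorProduct.tmul_add, TensorProduct.add_tmul, TensorProduct.tmul_smul,
        ← TensorProduct.smul_tmul', smul_add]
      abel
    rw [h]
    have h1 : dualOne k d n ∈ (if i = 0 then Submodule.span k {dualOne k d n} else ⊤ :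
        Submodule k (dualNumbers k d n)) := by
      split_ifs
      · exact Submodule.mem_span_singleton_self _
      · trivial
    exact Submodule.neg_mem _ (Submodule.smul_mem _ _ (tmul_mem_square _ h1 h1))
  · rw [cobracket_dualNumbers]
    exact Submodule.zero_mem _

theorem dualOne_isGrouplike : (dualNumbers k d n).IsGrouplike (dualOne k d n) :=
  ⟨comul_dualOne k d n, counit_dualOne k d n⟩

end Dual

theorem iSup_range_map_id {ι : Type*} {S : ι → DCoalgebraOps k d} {T : DCoalgebraOps k d}
    {g : ∀ i, S i →ₗ[k] T} (hs : ⨆ i, LinearMap.range (g i) = ⊤) (X : DCoalgebraOps k d) :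
    ⨆ i, LinearMap.range (TensorProduct.map (LinearMap.id : X →ₗ[k] X) (g i)) = ⊤ := by
  rw [eq_top_iff, ← TensorProduct.span_tmul_eq_top, Submodule.span_le]
  rintro _ ⟨x, y, rfl⟩
  set P := ⨆ i, LinearMap.range (TensorProduct.map (LinearMap.id : X →ₗ[k] X) (g i)) with hP
  have h : (⊤ : Submodule k T) ≤ P.comap (TensorProduct.mk k X T x) := by
    rw [← hs]
    refine iSup_le fun i => ?_
    rintro _ ⟨z, rfl⟩
    rw [Submodule.mem_comap, hP]
    exact Submodule.mem_iSup_of_mem i ⟨x ⊗ₜ z, by simp⟩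
  exact h (Submodule.mem_top (x := y))

end DCoalgebraOps

/-! ### Internal homs and composition of families -/

section InternalHom

open DCoalgebraOps

variable {k : Type u} [Field k] {d : ℤ} {X Y Z : DCoalgebraOps k d}

theorem IsFamily.comp {φ : X →ₗ[k] Y} {S T : DCoalgebraOps k d} {f : X ⊗[k] T →ₗ[k] Y}
    (hf : IsFamily φ T f) {g : S →ₗ[k] T} (hg : S.IsHom T g) :
    IsFamily φ S (f ∘ₗ TensorProduct.map LinearMap.id g) :=
  ⟨hf.isHom.comp ((IsHom.id X).tensor hg), fun _ he x => by
    simpa using hf.restrict _ (he.map hg.toIsGradedHom) x⟩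

theorem isFamily_counit {φ : X →ₗ[k] Y} (hφ : X.IsHom Y φ) {S : DCoalgebraOps k d}
    (hS : S.IsDCoalgebra) : IsFamily φ S (φ ∘ₗ (TensorProduct.rid k X).toLinearMap ∘ₗ
      TensorProduct.map LinearMap.id S.counit) :=
  ⟨hφ.comp (isHom_tensor_counit X hS), fun e he x => by simp [he.2]⟩

/-- Currying turns a family `X ⊗ S → Y` into a linear map from `S` to the space of linear maps `X →
Y`, the form required by the representability principle. The value at the grouplike element is
always `φ`, and the constant family shows that the condition is inhabited. -/
theorem IsFamily.isLocal {φ : X →ₗ[k] Y} (hφ : X.IsHom Y φ) :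
    IsLocal (M := X →ₗ[k] Y) fun (S : DCoalgebraOps k d) f =>
      IsFamily φ S (TensorProduct.lift f.flip) where
  pull {S T g f} _ _ hg _ hf := by
    have : TensorProduct.lift (f ∘ₗ g).flip =
        TensorProduct.lift f.flip ∘ₗ TensorProduct.map LinearMap.id g :=
      TensorProduct.ext' fun x s => by simp
    rw [this]
    exact hf.comp hg
  unit hf hg he he' := LinearMap.ext fun x => by
    simpa using (hf.restrict _ he x).trans (hg.restrict _ he' x).symm
  glue {ι _ S T g f} hS hT hg hs hf := by
    have h : ∀ i, TensorProduct.lift (f ∘ₗ g i).flip =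
        TensorProduct.lift f.flip ∘ₗ TensorProduct.map LinearMap.id (g i) := fun i =>
      TensorProduct.ext' fun x s => by simp
    refine ⟨isHom_of_jointly_surjective (S := fun i => X.tensor (S i)) (T := X.tensor T)
      (g := fun i => TensorProduct.map LinearMap.id (g i))
      (fun i => (IsHom.id X).tensor (hg i)) (iSup_range_map_id hs X) fun i => ?_, fun e he x => ?_⟩
    · rw [← h]
      exact (hf i).isHom
    · obtain ⟨i⟩ := ‹Nonempty ι›
      obtain ⟨e', he'⟩ := (hS i).exists_isGrouplike
      rw [hT.grouplike_unique he (he'.map (hg i).toIsGradedHom)]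
      simpa using (hf i).restrict e' he' x
  inhabited := by
    have hS := dualNumbers_isCoproartinian k d 0
    refine ⟨dualNumbers k d 0, (dualNumbers k d 0).counit.smulRight φ, hS, ?_⟩
    have h := isFamily_counit hφ hS.isDCoalgebra
    convert h using 1
    exact TensorProduct.ext' fun x s => by simp

theorem nonempty_internalHom {φ : X →ₗ[k] Y} (hφ : X.IsHom Y φ) : Nonempty (InternalHom φ) := by
  obtain ⟨H, ev, hH, hev, huniv⟩ := (IsFamily.isLocal hφ).exists_universal
  refine ⟨⟨H, hH, TensorProduct.lift ev.flip, hev, fun S hS f hf => ?_⟩⟩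
  have h1 : TensorProduct.lift (TensorProduct.curry f).flip.flip = f :=
    TensorProduct.ext' fun x s => by simp
  obtain ⟨g, ⟨hg, hgf⟩, huniq⟩ := huniv S hS (TensorProduct.curry f).flip (by rwa [h1])
  refine ⟨g, ⟨hg, ?_⟩, fun g' ⟨hg', hgf'⟩ => huniq g' ⟨hg', ?_⟩⟩
  · refine TensorProduct.ext' fun x s => ?_
    simpa using LinearMap.congr_fun (LinearMap.congr_fun hgf s) x
  · refine LinearMap.ext fun s => LinearMap.ext fun x => ?_
    simpa using LinearMap.congr_fun hgf' (x ⊗ₜ s)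

theorem InternalHom.hom_ext {φ : X →ₗ[k] Y} (H : InternalHom φ) {S : DCoalgebraOps k d}
    (hS : S.IsCoproartinian) {f g : S →ₗ[k] H.obj} (hf : S.IsHom H.obj f) (hg : S.IsHom H.obj g)
    (h : H.ev ∘ₗ TensorProduct.map LinearMap.id f = H.ev ∘ₗ TensorProduct.map LinearMap.id g) :
    f = g :=
  (H.represents S hS _ (H.ev_mem.comp hg)).unique ⟨hf, h⟩ ⟨hg, rfl⟩

theorem compFamily_tmul {S T : DCoalgebraOps k d} (f : X ⊗[k] S →ₗ[k] Y) (g : Y ⊗[k] T →ₗ[k] Z)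
    (x : X) (s : S) (t : T) : compFamily f g (x ⊗ₜ (s ⊗ₜ t)) = g (f (x ⊗ₜ s) ⊗ₜ t) := by
  simp [compFamily]

theorem isHom_assoc_symm (C E G : DCoalgebraOps k d) :
    (C.tensor (E.tensor G)).IsHom ((C.tensor E).tensor G)
      (TensorProduct.assoc k C E G).symm.toLinearMap :=
  IsHom.symm (C := (C.tensor E).tensor G) (E := C.tensor (E.tensor G)) (isHom_assoc C E G)

/-- All three constituents, the inverse associator, `f ⊗ id` and `g`, are morphisms; the grouplike
element of `S ⊗ T` is the tensor product of the two grouplike elements, which gives the restriction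
`ψ ∘ φ`. -/
theorem IsFamily.compFamily {φ : X →ₗ[k] Y} {ψ : Y →ₗ[k] Z} {S T : DCoalgebraOps k d}
    (hS : S.IsCoproartinian) (hT : T.IsCoproartinian) {f : X ⊗[k] S →ₗ[k] Y}
    {g : Y ⊗[k] T →ₗ[k] Z} (hf : IsFamily φ S f) (hg : IsFamily ψ T g) :
    IsFamily (ψ ∘ₗ φ) (S.tensor T) (compFamily f g) := by
  refine ⟨hg.isHom.comp ((hf.isHom.tensor (IsHom.id T)).comp (isHom_assoc_symm X S T)),
    fun e he x => ?_⟩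
  obtain ⟨a, ha⟩ := hS.exists_isGrouplike
  obtain ⟨b, hb⟩ := hT.exists_isGrouplike
  rw [(hS.tensor hT).grouplike_unique he (hS.isGrouplike_tmul ha hb), compFamily_tmul,
    hf.restrict a ha, hg.restrict b hb]
  rfl

theorem compFamily_comp {S T S' T' : DCoalgebraOps k d} (f : X ⊗[k] S →ₗ[k] Y)
    (g : Y ⊗[k] T →ₗ[k] Z) (a : S' →ₗ[k] S) (b : T' →ₗ[k] T) :
    compFamily f g ∘ₗ TensorProduct.map LinearMap.id (TensorProduct.map a b) =
      compFamily (f ∘ₗ TensorProduct.map LinearMap.id a)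
        (g ∘ₗ TensorProduct.map LinearMap.id b) := by
  refine TensorProduct.ext' fun x t => ?_
  induction t with
  | zero => simp
  | tmul s t => simp [compFamily_tmul]
  | add a b ha hb => rw [TensorProduct.tmul_add, map_add, map_add, ha, hb]

theorem compFamily_assoc {B R S T : DCoalgebraOps k d} (f : X ⊗[k] R →ₗ[k] Y)
    (g : Y ⊗[k] S →ₗ[k] Z) (h : Z ⊗[k] T →ₗ[k] B) :
    compFamily (S := R.tensor S) (compFamily f g) h =
      compFamily (T := S.tensor T) f (compFamily g h) ∘ₗ
        TensorProduct.map LinearMap.id (TensorProduct.assoc k R S T).toLinearMap := by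
  refine TensorProduct.ext' fun x t => ?_
  suffices e : compFamily (S := R.tensor S) (compFamily f g) h ∘ₗ TensorProduct.mk k _ _ x =
      compFamily (T := S.tensor T) f (compFamily g h) ∘ₗ
        TensorProduct.map LinearMap.id (TensorProduct.assoc k R S T).toLinearMap ∘ₗ
          TensorProduct.mk k _ _ x from LinearMap.congr_fun e t
  refine TensorProduct.ext_threefold fun r s t => ?_
  simp only [LinearMap.comp_apply, TensorProduct.mk_apply, TensorProduct.map_tmul,
    LinearMap.id_apply, LinearEquiv.coe_coe, TensorProduct.assoc_tmul]
  rw [compFamily_tmul, compFamily_tmul f g, compFamily_tmul (T := S.tensor T) f,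
    compFamily_tmul g h]

/-- The relation `χ = ψ ∘ φ` is a hypothesis so that the lemma also applies to the identity, which
is not literally a composite. -/
theorem exists_isComposition {φ : X →ₗ[k] Y} {ψ : Y →ₗ[k] Z} {χ : X →ₗ[k] Z} (hχ : χ = ψ ∘ₗ φ)
    (H₁ : InternalHom φ) (H₂ : InternalHom ψ) (H₃ : InternalHom χ) :
    ∃ c, IsComposition H₁ H₂ H₃ c := by
  subst hχ
  obtain ⟨c, ⟨hc, h⟩, -⟩ := H₃.represents _ (H₁.coart.tensor H₂.coart) _
    (H₁.ev_mem.compFamily H₁.coart H₂.coart H₂.ev_mem)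
  exact ⟨c, hc, h⟩

theorem IsComposition.unique {φ : X →ₗ[k] Y} {ψ : Y →ₗ[k] Z} {χ : X →ₗ[k] Z}
    {H₁ : InternalHom φ} {H₂ : InternalHom ψ} {H₃ : InternalHom χ}
    {c c' : H₁.obj ⊗[k] H₂.obj →ₗ[k] H₃.obj} (h : IsComposition H₁ H₂ H₃ c)
    (h' : IsComposition H₁ H₂ H₃ c') : c = c' :=
  H₃.hom_ext (H₁.coart.tensor H₂.coart) h.isHom h'.isHom (h.classifies.trans h'.classifies.symm)

theorem IsComposition.classifies_comp {φ : X →ₗ[k] Y} {ψ : Y →ₗ[k] Z} {χ : X →ₗ[k] Z}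
    {H₁ : InternalHom φ} {H₂ : InternalHom ψ} {H₃ : InternalHom χ}
    {c : H₁.obj ⊗[k] H₂.obj →ₗ[k] H₃.obj} (h : IsComposition H₁ H₂ H₃ c) {S T : DCoalgebraOps k d}
    (f : S →ₗ[k] H₁.obj) (g : T →ₗ[k] H₂.obj) :
    H₃.ev ∘ₗ TensorProduct.map LinearMap.id (c ∘ₗ TensorProduct.map f g) =
      _root_.compFamily (H₁.ev ∘ₗ TensorProduct.map LinearMap.id f)
        (H₂.ev ∘ₗ TensorProduct.map LinearMap.id g) := by
  rw [← compFamily_comp, ← h.classifies, LinearMap.comp_assoc, ← TensorProduct.map_comp,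
    LinearMap.id_comp]

/-- Both sides are morphisms into the representing object `H₁₂₃.obj`, and both classify the
threefold composite of the universal families; conclude by uniqueness of classifying morphisms. -/
theorem IsComposition.assoc {B : DCoalgebraOps k d} {φ : X →ₗ[k] Y} {ψ : Y →ₗ[k] Z} {χ : Z →ₗ[k] B}
    {α : X →ₗ[k] Z} {β : Y →ₗ[k] B} {γ : X →ₗ[k] B} {H₁ : InternalHom φ} {H₂ : InternalHom ψ}
    {H₃ : InternalHom χ} {H₁₂ : InternalHom α} {H₂₃ : InternalHom β} {H₁₂₃ : InternalHom γ}
    {c₁₂ : H₁.obj ⊗[k] H₂.obj →ₗ[k] H₁₂.obj} {c₂₃ : H₂.obj ⊗[k] H₃.obj →ₗ[k] H₂₃.obj}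
    {l : H₁₂.obj ⊗[k] H₃.obj →ₗ[k] H₁₂₃.obj} {r : H₁.obj ⊗[k] H₂₃.obj →ₗ[k] H₁₂₃.obj}
    (h₁₂ : IsComposition H₁ H₂ H₁₂ c₁₂) (h₂₃ : IsComposition H₂ H₃ H₂₃ c₂₃)
    (hl : IsComposition H₁₂ H₃ H₁₂₃ l) (hr : IsComposition H₁ H₂₃ H₁₂₃ r) :
    l ∘ₗ TensorProduct.map c₁₂ LinearMap.id = r ∘ₗ TensorProduct.map LinearMap.id c₂₃ ∘ₗ
      (TensorProduct.assoc k H₁.obj H₂.obj H₃.obj).toLinearMap := by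
  refine H₁₂₃.hom_ext (S := (H₁.obj.tensor H₂.obj).tensor H₃.obj)
    ((H₁.coart.tensor H₂.coart).tensor H₃.coart)
    (hl.isHom.comp (h₁₂.isHom.tensor (IsHom.id H₃.obj)))
    (hr.isHom.comp (((IsHom.id H₁.obj).tensor h₂₃.isHom).comp
      (isHom_assoc H₁.obj H₂.obj H₃.obj))) ?_
  have h1 := hl.classifies_comp (S := H₁.obj.tensor H₂.obj) (T := H₃.obj) c₁₂ LinearMap.id
  have h2 := hr.classifies_comp (S := H₁.obj) (T := H₂.obj.tensor H₃.obj) LinearMap.id c₂₃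
  rw [h₁₂.classifies, TensorProduct.map_id, LinearMap.comp_id] at h1
  rw [h₂₃.classifies, TensorProduct.map_id, LinearMap.comp_id] at h2
  refine h1.trans ((compFamily_assoc _ _ _).trans ?_)
  rw [← h2, LinearMap.comp_assoc, ← TensorProduct.map_comp, LinearMap.id_comp, LinearMap.comp_assoc]

/-- For the unit laws: evaluation at the grouplike `e` is the identity of `X`, so `m (e ⊗ t)` and `m
(t ⊗ e)` classify the same family as `t`. Associativity is the general statement for `H` with
itself. -/
theorem IsComposition.isDBialgebra {H : InternalHom (LinearMap.id : X →ₗ[k] X)}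
    {m : H.obj ⊗[k] H.obj →ₗ[k] H.obj} (h : IsComposition H H H m) : IsDBialgebra H.obj m := by
  refine ⟨H.coart, h.isHom, fun x y z => LinearMap.congr_fun (h.assoc h h h) ((x ⊗ₜ y) ⊗ₜ z), ?_⟩
  obtain ⟨e, he⟩ := H.coart.exists_isGrouplike
  have hc : ∀ x s t, H.ev (x ⊗ₜ m (s ⊗ₜ t)) = H.ev (H.ev (x ⊗ₜ s) ⊗ₜ t) := fun x s t => by
    have := LinearMap.congr_fun h.classifies (x ⊗ₜ (s ⊗ₜ t))
    rwa [compFamily_tmul] at this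
  refine ⟨e, he, fun e' he' => H.coart.grouplike_unique he' he, fun x => ⟨?_, ?_⟩⟩
  · have := H.hom_ext H.coart (h.isHom.comp (isHom_unit_tmul H.coart he H.obj))
      (IsHom.id H.obj) (TensorProduct.ext' fun x t => by
        simp [hc, H.ev_mem.restrict e he])
    exact LinearMap.congr_fun this x
  · have := H.hom_ext H.coart (h.isHom.comp (isHom_tmul_unit H.coart he H.obj))
      (IsHom.id H.obj) (TensorProduct.ext' fun x t => by
        simp [hc, H.ev_mem.restrict e he])
    exact LinearMap.congr_fun this x

end InternalHom

/-! ### The identities behind the bar differential -/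

namespace DAlgebra

variable {k : Type u} [Field k] {d : ℤ} (V : DAlgebra k d)

theorem mul_comm_sign {m n : ℤ} {x y : V.carrier} (hx : x ∈ V.gr m) (hy : y ∈ V.gr n) :
    V.mul x y = koszulSign k (m * n) • V.mul y x := by
  rw [V.mul_comm hx hy, negOnePow_smul_eq (k := k)]

theorem bracket_skew_sign {m n : ℤ} {x y : V.carrier} (hx : x ∈ V.gr m) (hy : y ∈ V.gr n) :
    V.bracket x y = -(koszulSign k ((m - (d - 1)) * (n - (d - 1))) • V.bracket y x) := by
  rw [V.bracket_skew hx hy, negOnePow_smul_eq (k := k)]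

/-- Skew symmetry moves all nested brackets to the left, giving the cyclic form that matches sums
over rotations in `C ⊗ C ⊗ C`. -/
theorem jacobi_cyclic {l m n : ℤ} {x y z : V.carrier} (hx : x ∈ V.gr l) (hy : y ∈ V.gr m)
    (hz : z ∈ V.gr n) : V.bracket (V.bracket x y) z +
      koszulSign k ((n - (d - 1)) * (l - (d - 1) + (m - (d - 1)))) • V.bracket (V.bracket z x) y +
      koszulSign k ((l - (d - 1)) * (m - (d - 1) + (n - (d - 1)))) • V.bracket (V.bracket y z) x =
      0 := by
  have h := V.jacobi z hx hy
  have h1 := V.bracket_skew_sign hx (V.bracket_mem hy hz)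
  have h2 := V.bracket_skew_sign hy (V.bracket_mem hx hz)
  have h3 := V.bracket_skew_sign hx hz
  rw [negOnePow_smul_eq (k := k), h1, h2, h3] at h
  simp only [map_neg, map_smul, LinearMap.neg_apply, LinearMap.smul_apply, smul_neg, neg_neg,
    smul_smul, ← koszulSign_add] at h
  rw [koszulSign_congr (n := (l - (d - 1)) * (m - (d - 1) + (n - (d - 1)))) (by push_cast; grind),
    koszulSign_congr (k := k) (n := (n - (d - 1)) * (l - (d - 1) + (m - (d - 1))))
      (m := _ + _) (by push_cast; grind)] at h
  linear_combination (norm := module) -h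

theorem D_mul_sign {m : ℤ} {x : V.carrier} (y : V.carrier) (hx : x ∈ V.gr m) :
    V.D (V.mul x y) = V.mul (V.D x) y + koszulSign k m • V.mul x (V.D y) := by
  rw [V.D_mul y hx, negOnePow_smul_eq (k := k)]

theorem D_bracket_sign {m : ℤ} {x : V.carrier} (y : V.carrier) (hx : x ∈ V.gr m) :
    V.D (V.bracket x y) = V.bracket (V.D x) y + koszulSign k (m - (d - 1)) • V.bracket x (V.D y) := by
  rw [V.D_bracket y hx, negOnePow_smul_eq (k := k)]

theorem leibniz_sign {n l : ℤ} (x : V.carrier) {y z : V.carrier} (hy : y ∈ V.gr n)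
    (hz : z ∈ V.gr l) : V.bracket (V.mul x y) z =
      V.mul x (V.bracket y z) + koszulSign k (n * (l + d - 1)) • V.mul (V.bracket x z) y := by
  rw [V.leibniz x hy hz, negOnePow_smul_eq (k := k)]

end DAlgebra

namespace DCoalgebraOps

variable {k : Type u} [Field k] {d : ℤ} {C : DCoalgebraOps k d} {V : DAlgebra k d}

/-- The bracket of two values of `p`, with the sign of the bar differential. -/
def barBracket (V : DAlgebra k d) (p : C →ₗ[k] V.carrier) : C ⊗[k] C →ₗ[k] V.carrier :=
  TensorProduct.lift V.bracket ∘ₗ TensorProduct.map (p ∘ₗ C.sgn 1) p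

/-- The product of two values of `p`, with the sign of the bar differential. -/
def barMul (V : DAlgebra k d) (p : C →ₗ[k] V.carrier) : C ⊗[k] C →ₗ[k] V.carrier :=
  TensorProduct.lift V.mul ∘ₗ TensorProduct.map (p ∘ₗ C.sgn d) p

variable {p : C →ₗ[k] V.carrier}

/-- For `x` of degree `i`, the element `p x` has degree `i + 1` in `V[d-1]`. The signs in
`barBracket` compensate this shift, so on homogeneous `x ⊗ y ⊗ z` the sum is `(-1)^|y|` times the
cyclic Jacobi identity. -/
theorem barBracket_jacobi (hp : DGSpace.HasDegree C.toDGSpace V.toDGSpace d p) :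
    let J := TensorProduct.lift V.bracket ∘ₗ
      TensorProduct.map (barBracket V p ∘ₗ TensorProduct.map (C.sgn 1) (C.sgn 1)) p
    J + J ∘ₗ C.cyc + J ∘ₗ C.cyc ∘ₗ C.cyc = 0 := by
  intro J
  refine DGSpace.tensor_hom_ext₃ C.toDGSpace C.toDGSpace C.toDGSpace fun i x hx j y hy l z hz => ?_
  have hJ : ∀ {i j : ℤ} {x y z : C}, x ∈ C.gr i → y ∈ C.gr j → J ((x ⊗ₜ y) ⊗ₜ z) =
      koszulSign k j • V.bracket (V.bracket (p x) (p y)) (p z) := fun {i j x y z} hx hy => by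
    simp only [J, barBracket, LinearMap.comp_apply, TensorProduct.map_tmul, C.sgn_apply' _ hx,
      C.sgn_apply' _ hy, TensorProduct.lift.tmul, map_smul, LinearMap.smul_apply, smul_smul,
      ← koszulSign_add]
    congr 1
    exact koszulSign_congr (by push_cast; grind)
  have h := V.jacobi_cyclic (hp _ _ hx) (hp _ _ hy) (hp _ _ hz)
  simp only [LinearMap.add_apply, LinearMap.comp_apply, C.cyc_tmul hx hy hz, C.cyc_tmul hz hx hy,
    map_smul, hJ hx hy, hJ hz hx, hJ hy hz, smul_smul, ← koszulSign_add, LinearMap.zero_apply]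
  rw [koszulSign_congr (k := k) (m := (i + j) * l + i)
      (n := j + (l + d - (d - 1)) * (i + d - (d - 1) + (j + d - (d - 1)))) (by push_cast; grind),
    koszulSign_congr (k := k) (m := (i + j) * l + (l + i) * j + l)
      (n := j + (i + d - (d - 1)) * (j + d - (d - 1) + (l + d - (d - 1)))) (by push_cast; grind),
    koszulSign_add j, koszulSign_add j]
  linear_combination (norm := module) koszulSign k j • h

/-- Associativity and commutativity make a triple product rotation-invariant up to sign; the signs
in `barMul` absorb the shift by `d`, using that `d²` and `d` have the same parity. -/
theorem barMul_cyc (hp : DGSpace.HasDegree C.toDGSpace V.toDGSpace d p) :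
    let N := TensorProduct.lift V.mul ∘ₗ
      TensorProduct.map (barMul V p ∘ₗ TensorProduct.map (C.sgn d) (C.sgn d)) p
    N ∘ₗ C.cyc = N := by
  intro N
  refine DGSpace.tensor_hom_ext₃ C.toDGSpace C.toDGSpace C.toDGSpace fun i x hx j y hy l z hz => ?_
  have hN : ∀ {i j : ℤ} {x y z : C}, x ∈ C.gr i → y ∈ C.gr j → N ((x ⊗ₜ y) ⊗ₜ z) =
      koszulSign k (d * j) • V.mul (V.mul (p x) (p y)) (p z) := fun {i j x y z} hx hy => by
    simp only [N, barMul, LinearMap.comp_apply, TensorProduct.map_tmul, C.sgn_apply' _ hx,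
      C.sgn_apply' _ hy, TensorProduct.lift.tmul, map_smul, LinearMap.smul_apply, smul_smul,
      ← koszulSign_add]
    congr 1
    exact koszulSign_congr (by push_cast; grind)
  rw [LinearMap.comp_apply, C.cyc_tmul hx hy hz, map_smul, hN hz hx, hN hx hy, V.mul_assoc,
    V.mul_comm_sign (hp _ _ hz) (V.mul_mem (hp _ _ hx) (hp _ _ hy)), smul_smul, smul_smul,
    ← koszulSign_add, ← koszulSign_add]
  congr 1
  refine koszulSign_congr ?_
  have := ZMod.two_mul_self_eq (d : ZMod 2)
  push_cast
  grind

/-- The Leibniz rule in a form dual to `comul_id_cobracket`: after composition with `(δ ⊗ 1) Δ`, the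
two rotated `N₃` terms combine to `N₃` applied to `(Δ ⊗ 1) δ`. -/
theorem bar_leibniz (hp : DGSpace.HasDegree C.toDGSpace V.toDGSpace d p) :
    let N₂ := TensorProduct.lift V.bracket ∘ₗ
      TensorProduct.map (barMul V p ∘ₗ TensorProduct.map (C.sgn 1) (C.sgn 1)) p
    let N₃ := TensorProduct.lift V.mul ∘ₗ
      TensorProduct.map (barBracket V p ∘ₗ TensorProduct.map (C.sgn d) (C.sgn d)) p
    koszulSign k (1 - d) • N₂ + N₃ ∘ₗ C.cyc + koszulSign k d • (N₃ ∘ₗ C.cyc ∘ₗ C.cyc) = 0 := by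
  intro N₂ N₃
  refine DGSpace.tensor_hom_ext₃ C.toDGSpace C.toDGSpace C.toDGSpace fun i x hx j y hy l z hz => ?_
  have hN₂ : N₂ ((x ⊗ₜ y) ⊗ₜ z) = koszulSign k ((d + 1) * i + j) •
      V.bracket (V.mul (p x) (p y)) (p z) := by
    simp only [N₂, barMul, LinearMap.comp_apply, TensorProduct.map_tmul, C.sgn_apply' _ hx,
      C.sgn_apply' _ hy, TensorProduct.lift.tmul, map_smul, LinearMap.smul_apply, smul_smul,
      ← koszulSign_add]
    congr 1
    exact koszulSign_congr (by push_cast; grind)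
  have hN₃ : ∀ {i j : ℤ} {x y z : C}, x ∈ C.gr i → y ∈ C.gr j → N₃ ((x ⊗ₜ y) ⊗ₜ z) =
      koszulSign k ((d + 1) * i + d * j) • V.mul (V.bracket (p x) (p y)) (p z) :=
    fun {i j x y z} hx hy => by
    simp only [N₃, barBracket, LinearMap.comp_apply, TensorProduct.map_tmul, C.sgn_apply' _ hx,
      C.sgn_apply' _ hy, TensorProduct.lift.tmul, map_smul, LinearMap.smul_apply, smul_smul,
      ← koszulSign_add]
    congr 1
    exact koszulSign_congr (by push_cast; grind)
  have hd := ZMod.two_mul_self_eq (d : ZMod 2)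
  simp only [LinearMap.add_apply, LinearMap.smul_apply, LinearMap.comp_apply, C.cyc_tmul hx hy hz,
    C.cyc_tmul hz hx hy, map_smul, hN₂, hN₃ hz hx, hN₃ hy hz, LinearMap.zero_apply]
  rw [V.leibniz_sign (p x) (hp _ _ hy) (hp _ _ hz),
    V.mul_comm_sign (hp _ _ hx) (V.bracket_mem (hp _ _ hy) (hp _ _ hz)),
    V.bracket_skew_sign (hp _ _ hz) (hp _ _ hx)]
  simp only [map_neg, LinearMap.neg_apply, map_smul, LinearMap.smul_apply, smul_add, smul_neg,
    smul_smul, ← koszulSign_add]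
  rw [koszulSign_congr (k := k)
      (m := 1 - d + ((d + 1) * i + j + (i + d) * (j + d + (l + d) + (1 - d))))
      (n := d + ((i + j) * l + ((l + i) * j + ((d + 1) * j + d * l))) + 1) (by push_cast; grind),
    koszulSign_congr (k := k) (m := 1 - d + ((d + 1) * i + j + (j + d) * (l + d + d - 1)))
      (n := (i + j) * l + ((d + 1) * l + d * i + (l + d - (d - 1)) * (i + d - (d - 1))))
      (by push_cast; grind),
    koszulSign_add _ 1, koszulSign_one]
  module

/-- Used with `r` equal to `d p` or `p Q`, to move the modified factor from the second slot to the
first. -/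
theorem barBracket_swap (hp : DGSpace.HasDegree C.toDGSpace V.toDGSpace d p)
    {r : C →ₗ[k] V.carrier} (hr : DGSpace.HasDegree C.toDGSpace V.toDGSpace (d + 1) r) :
    (TensorProduct.lift V.bracket ∘ₗ TensorProduct.map p r) ∘ₗ C.swap C.toDGSpace =
      -(TensorProduct.lift V.bracket ∘ₗ TensorProduct.map (r ∘ₗ C.sgn 1) p) := by
  refine DGSpace.tensor_hom_ext C.toDGSpace C.toDGSpace fun i x hx j y hy => ?_
  simp only [LinearMap.comp_apply, DGSpace.swap_tmul _ _ hx hy, map_smul, TensorProduct.map_tmul,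
    TensorProduct.lift.tmul, C.sgn_apply' _ hx, LinearMap.neg_apply, LinearMap.smul_apply]
  rw [V.bracket_skew_sign (hp _ _ hy) (hr _ _ hx), smul_neg, smul_smul, ← koszulSign_add]
  congr 2
  exact koszulSign_congr (by push_cast; grind)

theorem barMul_swap (hp : DGSpace.HasDegree C.toDGSpace V.toDGSpace d p)
    {r : C →ₗ[k] V.carrier} (hr : DGSpace.HasDegree C.toDGSpace V.toDGSpace (d + 1) r) :
    (TensorProduct.lift V.mul ∘ₗ TensorProduct.map (p ∘ₗ C.sgn d ∘ₗ C.sgn 1) r) ∘ₗ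
        C.swap C.toDGSpace =
      TensorProduct.lift V.mul ∘ₗ TensorProduct.map (r ∘ₗ C.sgn d) p := by
  refine DGSpace.tensor_hom_ext C.toDGSpace C.toDGSpace fun i x hx j y hy => ?_
  simp only [LinearMap.comp_apply, DGSpace.swap_tmul _ _ hx hy, map_smul, TensorProduct.map_tmul,
    TensorProduct.lift.tmul, C.sgn_apply' _ hx, C.sgn_apply' _ hy, LinearMap.smul_apply]
  rw [V.mul_comm_sign (hp _ _ hy) (hr _ _ hx), smul_smul, smul_smul, smul_smul, ← koszulSign_add,
    ← koszulSign_add, ← koszulSign_add]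
  have hd := ZMod.two_mul_self_eq (d : ZMod 2)
  congr 1
  exact koszulSign_congr (by push_cast; grind)

theorem D_barBracket (hp : DGSpace.HasDegree C.toDGSpace V.toDGSpace d p) :
    V.D ∘ₗ barBracket V p =
      TensorProduct.lift V.bracket ∘ₗ TensorProduct.map ((V.D ∘ₗ p) ∘ₗ C.sgn 1) p -
        TensorProduct.lift V.bracket ∘ₗ TensorProduct.map p (V.D ∘ₗ p) := by
  refine DGSpace.tensor_hom_ext C.toDGSpace C.toDGSpace fun i x hx j y hy => ?_
  simp only [barBracket, LinearMap.comp_apply, TensorProduct.map_tmul, C.sgn_apply' _ hx, map_smul,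
    TensorProduct.lift.tmul, LinearMap.smul_apply, LinearMap.sub_apply,
    V.D_bracket_sign (p y) (hp _ _ hx), smul_add, smul_smul, ← koszulSign_add]
  rw [koszulSign_congr (m := 1 * i + (i + d - (d - 1))) (n := 1) (by push_cast; grind),
    koszulSign_one]
  module

theorem D_barMul (hp : DGSpace.HasDegree C.toDGSpace V.toDGSpace d p) :
    V.D ∘ₗ barMul V p =
      TensorProduct.lift V.mul ∘ₗ TensorProduct.map ((V.D ∘ₗ p) ∘ₗ C.sgn d) p + koszulSign k d •
        (TensorProduct.lift V.mul ∘ₗ TensorProduct.map (p ∘ₗ C.sgn d ∘ₗ C.sgn 1) (V.D ∘ₗ p)) := by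
  refine DGSpace.tensor_hom_ext C.toDGSpace C.toDGSpace fun i x hx j y hy => ?_
  simp only [barMul, LinearMap.comp_apply, TensorProduct.map_tmul, C.sgn_apply' _ hx, map_smul,
    TensorProduct.lift.tmul, LinearMap.smul_apply, LinearMap.add_apply,
    V.D_mul_sign (p y) (hp _ _ hx), smul_add, smul_smul, ← koszulSign_add]
  congr 2
  exact koszulSign_congr (by push_cast; grind)

/-- The part of a coderivation's composite with the structure maps which is linear in `r`. -/
def barLinear (V : DAlgebra k d) (p r : C →ₗ[k] V.carrier) : C →ₗ[k] V.carrier :=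
  TensorProduct.lift V.bracket ∘ₗ TensorProduct.map (r ∘ₗ C.sgn 1) p ∘ₗ C.comul +
    TensorProduct.lift V.mul ∘ₗ TensorProduct.map (r ∘ₗ C.sgn d) p ∘ₗ C.cobracket

/-- The quadratic part of the bar differential. -/
def barQuadratic (V : DAlgebra k d) (p : C →ₗ[k] V.carrier) : C →ₗ[k] V.carrier :=
  barBracket V p ∘ₗ C.comul + barMul V p ∘ₗ C.cobracket

theorem barLinear_add_smul (p r r' : C →ₗ[k] V.carrier) (c : k) :
    barLinear V p (r + c • r') = barLinear V p r + c • barLinear V p r' := by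
  simp only [barLinear, LinearMap.add_comp, LinearMap.smul_comp, TensorProduct.map_add_left,
    TensorProduct.map_smul_left, LinearMap.comp_add, LinearMap.comp_smul, smul_add]
  abel

theorem lift_swap_comul (hC : C.IsDCoalgebra) (hp : DGSpace.HasDegree C.toDGSpace V.toDGSpace d p)
    {r : C →ₗ[k] V.carrier} (hr : DGSpace.HasDegree C.toDGSpace V.toDGSpace (d + 1) r) :
    TensorProduct.lift V.bracket ∘ₗ TensorProduct.map p r ∘ₗ C.comul =
      -(TensorProduct.lift V.bracket ∘ₗ TensorProduct.map (r ∘ₗ C.sgn 1) p ∘ₗ C.comul) := by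
  have h := congrArg (· ∘ₗ C.comul) (barBracket_swap hp hr)
  simp only [LinearMap.comp_assoc, hC.cocomm, LinearMap.neg_comp] at h
  exact h

theorem lift_swap_cobracket (hC : C.IsDCoalgebra)
    (hp : DGSpace.HasDegree C.toDGSpace V.toDGSpace d p)
    {r : C →ₗ[k] V.carrier} (hr : DGSpace.HasDegree C.toDGSpace V.toDGSpace (d + 1) r) :
    koszulSign k d • (TensorProduct.lift V.mul ∘ₗ
        TensorProduct.map (p ∘ₗ C.sgn d ∘ₗ C.sgn 1) r ∘ₗ C.cobracket) =
      TensorProduct.lift V.mul ∘ₗ TensorProduct.map (r ∘ₗ C.sgn d) p ∘ₗ C.cobracket := by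
  have h := congrArg (· ∘ₗ C.cobracket) (barMul_swap hp hr)
  simp only [LinearMap.comp_assoc, hC.swap_comp_cobracket, LinearMap.comp_smul] at h
  exact h

theorem barQuadratic_hasDegree (hC : C.IsDCoalgebra)
    (hp : DGSpace.HasDegree C.toDGSpace V.toDGSpace d p) :
    DGSpace.HasDegree C.toDGSpace V.toDGSpace (d + 1) (barQuadratic V p) := by
  have h1 : DGSpace.HasDegree (C.toDGSpace.tensor C.toDGSpace) V.toDGSpace (d + 1) (barBracket V p) := by
    intro n
    suffices h : DGSpace.tensorGr C.toDGSpace C.toDGSpace n ≤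
        (V.gr (n + (d + 1))).comap (barBracket V p) from h
    refine DGSpace.tensorGr_le _ _ fun i j hij x hx y hy => ?_
    have := V.bracket_mem (hp _ _ (C.hasDegree_sgn 1 _ _ hx)) (hp _ _ hy)
    rw [show i + 0 + d + (j + d) + (1 - d) = n + (d + 1) by omega] at this
    exact this
  have h2 : DGSpace.HasDegree (C.toDGSpace.tensor C.toDGSpace) V.toDGSpace (2 * d) (barMul V p) := by
    intro n
    suffices h : DGSpace.tensorGr C.toDGSpace C.toDGSpace n ≤
        (V.gr (n + 2 * d)).comap (barMul V p) from h
    refine DGSpace.tensorGr_le _ _ fun i j hij x hx y hy => ?_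
    have := V.mul_mem (hp _ _ (C.hasDegree_sgn d _ _ hx)) (hp _ _ hy)
    rw [show i + 0 + d + (j + d) = n + 2 * d by omega] at this
    exact this
  exact (h1.comp hC.hasDegree_comul (by ring)).add (h2.comp hC.hasDegree_cobracket (by ring))

/-- The differential falls on either factor; cocommutativity of the coproduct and the symmetry of
the cobracket show that both contributions are equal, whence the factor `2`. -/
theorem D_barQuadratic (hC : C.IsDCoalgebra)
    (hp : DGSpace.HasDegree C.toDGSpace V.toDGSpace d p) :
    V.D ∘ₗ barQuadratic V p = (2 : k) • barLinear V p (V.D ∘ₗ p) := by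
  have hDp : DGSpace.HasDegree C.toDGSpace V.toDGSpace (d + 1) (V.D ∘ₗ p) :=
    V.hasDegree_D.comp hp rfl
  rw [barQuadratic, LinearMap.comp_add, ← LinearMap.comp_assoc, ← LinearMap.comp_assoc,
    D_barBracket hp, D_barMul hp, LinearMap.sub_comp, LinearMap.add_comp, LinearMap.smul_comp]
  generalize V.D ∘ₗ p = r at hDp ⊢
  rw [LinearMap.comp_assoc, LinearMap.comp_assoc, LinearMap.comp_assoc, LinearMap.comp_assoc,
    lift_swap_comul hC hp hDp, lift_swap_cobracket hC hp hDp, barLinear]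
  module

/-- The Jacobi, Leibniz and associativity identities combined. -/
theorem barLinear_barQuadratic [CharZero k] (hC : C.IsDCoalgebra)
    (hp : DGSpace.HasDegree C.toDGSpace V.toDGSpace d p) :
    barLinear V p (barQuadratic V p) = 0 := by
  set J := TensorProduct.lift V.bracket ∘ₗ
      TensorProduct.map (barBracket V p ∘ₗ TensorProduct.map (C.sgn 1) (C.sgn 1)) p with hJ
  set N₂ := TensorProduct.lift V.bracket ∘ₗ
      TensorProduct.map (barMul V p ∘ₗ TensorProduct.map (C.sgn 1) (C.sgn 1)) p with hN₂
  set N₃ := TensorProduct.lift V.mul ∘ₗ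
      TensorProduct.map (barBracket V p ∘ₗ TensorProduct.map (C.sgn d) (C.sgn d)) p with hN₃
  set N := TensorProduct.lift V.mul ∘ₗ
      TensorProduct.map (barMul V p ∘ₗ TensorProduct.map (C.sgn d) (C.sgn d)) p with hN
  have h3 : (3 : k) ≠ 0 := by exact_mod_cast (by norm_num : (3 : ℕ) ≠ 0)
  -- The iterated coproduct is rotation-invariant, so the three terms of the Jacobi identity become
  -- equal and `3 J = 0` on it.
  have eJ : J ∘ₗ TensorProduct.map C.comul LinearMap.id ∘ₗ C.comul = 0 := by
    have h := congrArg (· ∘ₗ TensorProduct.map C.comul LinearMap.id ∘ₗ C.comul)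
      (barBracket_jacobi hp)
    simp only [← hJ, LinearMap.add_comp, LinearMap.comp_assoc, hC.cyc_comul_id,
      LinearMap.zero_comp] at h
    have h' : (3 : k) • (J ∘ₗ TensorProduct.map C.comul LinearMap.id ∘ₗ C.comul) = 0 := by
      linear_combination (norm := module) h
    exact (smul_eq_zero.1 h').resolve_left h3
  -- The dual situation: `N` is rotation-invariant, so applying it to the co-Jacobi identity gives
  -- three equal terms.
  have eN : N ∘ₗ TensorProduct.map C.cobracket LinearMap.id ∘ₗ C.cobracket = 0 := by
    have h := congrArg (N ∘ₗ ·) hC.cojacobi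
    have hc : N ∘ₗ C.cyc = N := barMul_cyc hp
    have hc' : N ∘ₗ C.cyc ∘ₗ C.cyc = N := by rw [← LinearMap.comp_assoc, hc, hc]
    simp only [LinearMap.comp_zero] at h
    rw [← LinearMap.comp_assoc, LinearMap.comp_add, LinearMap.comp_add, hc, hc', LinearMap.comp_id,
      LinearMap.add_comp, LinearMap.add_comp] at h
    have h' : (3 : k) • (N ∘ₗ TensorProduct.map C.cobracket LinearMap.id ∘ₗ C.cobracket) = 0 := by
      linear_combination (norm := module) h
    exact (smul_eq_zero.1 h').resolve_left h3
  -- The two mixed terms, a bracket of a product and a product of a bracket, cancel by Leibniz and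
  -- co-Leibniz together.
  have e23 : koszulSign k (1 - d) • (N₂ ∘ₗ TensorProduct.map C.cobracket LinearMap.id ∘ₗ C.comul) +
      N₃ ∘ₗ TensorProduct.map C.comul LinearMap.id ∘ₗ C.cobracket = 0 := by
    have h := congrArg (· ∘ₗ TensorProduct.map C.cobracket LinearMap.id ∘ₗ C.comul)
      (bar_leibniz hp)
    simp only [← hN₂, ← hN₃, LinearMap.add_comp, LinearMap.smul_comp, LinearMap.comp_assoc,
      LinearMap.zero_comp] at h
    rw [hC.comul_id_cobracket, LinearMap.comp_add, LinearMap.comp_smul, ← add_assoc]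
    exact h
  have hs : ∀ q, barQuadratic V p ∘ₗ C.sgn q =
      (barBracket V p ∘ₗ TensorProduct.map (C.sgn q) (C.sgn q)) ∘ₗ C.comul +
        koszulSign k (q * (1 - d)) •
          ((barMul V p ∘ₗ TensorProduct.map (C.sgn q) (C.sgn q)) ∘ₗ C.cobracket) := fun q => by
    rw [LinearMap.comp_assoc, LinearMap.comp_assoc, hC.sgn_comul, hC.sgn_cobracket,
      LinearMap.comp_smul, smul_smul, koszulSign_mul_self, one_smul]
    rfl
  have hm : ∀ (f : C ⊗[k] C →ₗ[k] V.carrier) (g : C →ₗ[k] C ⊗[k] C),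
      TensorProduct.map (f ∘ₗ g) p = TensorProduct.map f p ∘ₗ TensorProduct.map g LinearMap.id :=
    fun f g => by rw [← TensorProduct.map_comp, LinearMap.comp_id]
  rw [barLinear, hs, hs, TensorProduct.map_add_left, TensorProduct.map_add_left,
    TensorProduct.map_smul_left, TensorProduct.map_smul_left, hm, hm, hm, hm]
  have hd := ZMod.two_mul_self_eq (d : ZMod 2)
  -- The exponent `d (1 - d)` is always even.
  rw [koszulSign_congr (m := d * (1 - d)) (n := 0) (by push_cast; grind), koszulSign_zero,
    one_smul, one_mul]
  simp only [LinearMap.add_comp, LinearMap.comp_add, LinearMap.smul_comp, LinearMap.comp_smul]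
  have t1 : ∀ (f : (C ⊗[k] C) ⊗[k] C →ₗ[k] V.carrier ⊗[k] V.carrier)
      (l : V.carrier ⊗[k] V.carrier →ₗ[k] V.carrier) (g : C ⊗[k] C →ₗ[k] (C ⊗[k] C) ⊗[k] C)
      (h : C →ₗ[k] C ⊗[k] C), l ∘ₗ (f ∘ₗ g) ∘ₗ h = (l ∘ₗ f) ∘ₗ g ∘ₗ h := fun _ _ _ _ => rfl
  rw [t1, t1, t1, t1, ← hJ, ← hN₂, ← hN₃, ← hN, eJ, eN, zero_add, add_zero, e23]

end DCoalgebraOps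

/-! ### Coderivations and the dual numbers -/

namespace DCoalgebraOps

variable {k : Type u} [Field k] {d : ℤ} {C : DCoalgebraOps k d}

/-- Coderivations of degree `n`. -/
structure IsCoderivation (C : DCoalgebraOps k d) (n : ℤ) (Q : C →ₗ[k] C) : Prop where
  hasDegree : DGSpace.HasDegree C.toDGSpace C.toDGSpace n Q
  counit_comp : C.counit ∘ₗ Q = 0
  comul_comp : C.comul ∘ₗ Q =
    (TensorProduct.map Q LinearMap.id + TensorProduct.map (C.sgn n) Q) ∘ₗ C.comul
  cobracket_comp : C.cobracket ∘ₗ Q = koszulSign k (n * (1 - d)) •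
    ((TensorProduct.map Q LinearMap.id + TensorProduct.map (C.sgn n) Q) ∘ₗ C.cobracket)

theorem IsCoderivation.zero (C : DCoalgebraOps k d) (n : ℤ) : C.IsCoderivation n 0 :=
  ⟨fun _ _ _ => Submodule.zero_mem _, LinearMap.comp_zero _, by simp, by simp⟩

/-- The square of a coderivation of degree `1` is a coderivation. -/
theorem IsCoderivation.comp_self {Q : C →ₗ[k] C} (hQ : C.IsCoderivation 1 Q) :
    C.IsCoderivation 2 (Q ∘ₗ Q) := by
  have h : (TensorProduct.map Q LinearMap.id + TensorProduct.map (C.sgn 1) Q) ∘ₗ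
      (TensorProduct.map Q LinearMap.id + TensorProduct.map (C.sgn 1) Q) =
      TensorProduct.map (Q ∘ₗ Q) LinearMap.id + TensorProduct.map (C.sgn 2) (Q ∘ₗ Q) := by
    -- This anticommutation makes the cross terms cancel in the square of the extension of `Q` to `C
    -- ⊗ C`.
    have h1 : C.sgn 1 ∘ₗ Q = (-1 : k) • (Q ∘ₗ C.sgn 1) := by
      rw [hQ.hasDegree.sgn_comp, mul_one, koszulSign_one]
    have h2 : C.sgn 2 = LinearMap.id := by
      rw [C.sgn_congr (q := 2) (r := 0) (by decide), DGSpace.sgn_zero]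
    rw [LinearMap.comp_add, LinearMap.add_comp, LinearMap.add_comp, ← TensorProduct.map_comp,
      ← TensorProduct.map_comp, ← TensorProduct.map_comp, ← TensorProduct.map_comp, h1, h2,
      C.sgn_sgn, TensorProduct.map_smul_left]
    simp only [LinearMap.id_comp, LinearMap.comp_id]
    module
  refine ⟨hQ.hasDegree.comp hQ.hasDegree rfl, ?_, ?_, ?_⟩
  · rw [← LinearMap.comp_assoc, hQ.counit_comp, LinearMap.zero_comp]
  · rw [← LinearMap.comp_assoc, hQ.comul_comp, LinearMap.comp_assoc, hQ.comul_comp,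
      ← LinearMap.comp_assoc, h]
  · rw [← LinearMap.comp_assoc, hQ.cobracket_comp, LinearMap.smul_comp, LinearMap.comp_assoc,
      hQ.cobracket_comp, LinearMap.comp_smul, ← LinearMap.comp_assoc, h, smul_smul,
      koszulSign_mul_self, koszulSign_congr (n := 0) (by
        push_cast; rw [show (2 : ZMod 2) = 0 from rfl, zero_mul]), koszulSign_zero, one_smul]

section Dual

variable {n : ℤ}

/-- The map `1 ⊗ x ↦ x`, `η ⊗ x ↦ Q x`. -/
def dualMap {M : Type*} [AddCommGroup M] [Module k M] (n : ℤ) (p q : C →ₗ[k] M) :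
    dualNumbers k d n ⊗[k] C →ₗ[k] M :=
  TensorProduct.lift ((LinearMap.fst k k k).smulRight p + (LinearMap.snd k k k).smulRight q)

theorem dualMap_one {M : Type*} [AddCommGroup M] [Module k M] (p q : C →ₗ[k] M) (x : C) :
    dualMap n p q (dualOne k d n ⊗ₜ x) = p x := by
  have h : ((LinearMap.fst k k k).smulRight p + (LinearMap.snd k k k).smulRight q) (1, 0) x = p x := by
    simp
  exact h

theorem dualMap_eta {M : Type*} [AddCommGroup M] [Module k M] (p q : C →ₗ[k] M) (x : C) :
    dualMap n p q (dualEta k d n ⊗ₜ x) = q x := by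
  have h : ((LinearMap.fst k k k).smulRight p + (LinearMap.snd k k k).smulRight q) (0, 1) x = q x := by
    simp
  exact h

theorem dual_tensor_hom_ext {P : Type*} [AddCommGroup P] [Module k P]
    {f g : dualNumbers k d n ⊗[k] C →ₗ[k] P}
    (h1 : ∀ x, f (dualOne k d n ⊗ₜ x) = g (dualOne k d n ⊗ₜ x))
    (h2 : ∀ x, f (dualEta k d n ⊗ₜ x) = g (dualEta k d n ⊗ₜ x)) : f = g :=
  TensorProduct.ext (dualNumbers_hom_ext (LinearMap.ext h1) (LinearMap.ext h2))

theorem map_interchange_dualOne {G : dualNumbers k d n ⊗[k] C →ₗ[k] C}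
    (h1 : ∀ x, G (dualOne k d n ⊗ₜ x) = x) (t : C ⊗[k] C) :
    TensorProduct.map G G (DGSpace.interchange (dualNumbers k d n).toDGSpace C.toDGSpace
      ((dualOne k d n ⊗ₜ dualOne k d n) ⊗ₜ t)) = t := by
  rw [DGSpace.interchange_eq, DGSpace.interchange₄_unit_left _ _ _ (dualOne_mem k d n)]
  have : G ∘ₗ TensorProduct.mk k (dualNumbers k d n) C (dualOne k d n) = LinearMap.id :=
    LinearMap.ext h1
  rw [TensorProduct.map_map, this, TensorProduct.map_id]
  rfl

/-- In the term with `η` in the second place, the interchange moves `η`, of degree `n`, past the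
first factor of `t`; this produces `C.sgn n`, as in the coderivation rule. -/
theorem map_interchange_dualEta {G : dualNumbers k d n ⊗[k] C →ₗ[k] C} {Q : C →ₗ[k] C}
    (h1 : ∀ x, G (dualOne k d n ⊗ₜ x) = x) (h2 : ∀ x, G (dualEta k d n ⊗ₜ x) = Q x)
    (t : C ⊗[k] C) :
    TensorProduct.map G G (DGSpace.interchange (dualNumbers k d n).toDGSpace C.toDGSpace
      ((dualOne k d n ⊗ₜ dualEta k d n + dualEta k d n ⊗ₜ dualOne k d n) ⊗ₜ t)) =
    (TensorProduct.map Q LinearMap.id + TensorProduct.map (C.sgn n) Q :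
      C ⊗[k] C →ₗ[k] C ⊗[k] C) t := by
  suffices h : TensorProduct.map G G ∘ₗ DGSpace.interchange (dualNumbers k d n).toDGSpace
      C.toDGSpace ∘ₗ TensorProduct.mk k (dualNumbers k d n ⊗[k] dualNumbers k d n) (C ⊗[k] C)
        (dualOne k d n ⊗ₜ dualEta k d n + dualEta k d n ⊗ₜ dualOne k d n) =
      TensorProduct.map Q LinearMap.id + TensorProduct.map (C.sgn n) Q from
    LinearMap.congr_fun h t
  refine DGSpace.tensor_hom_ext C.toDGSpace C.toDGSpace fun i x hx j y hy => ?_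
  rw [LinearMap.comp_apply, LinearMap.comp_apply, TensorProduct.mk_apply, TensorProduct.add_tmul,
    map_add, map_add, DGSpace.interchange_eq]
  rw [DGSpace.interchange₄_tmul _ _ _ _ _ y (dualEta_mem k d n) hx,
    DGSpace.interchange₄_tmul _ _ _ _ _ y (dualOne_mem k d n) hx]
  simp only [map_smul, TensorProduct.map_tmul, h1, h2, LinearMap.add_apply, LinearMap.id_apply,
    C.sgn_apply' n hx, zero_mul, koszulSign_zero, one_smul, ← TensorProduct.smul_tmul']
  rw [add_comm]

/-- Coderivations are the same as homomorphisms from the tensor product with `dualNumbers`. -/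
theorem isCoderivation_iff {Q : C →ₗ[k] C} {G : dualNumbers k d n ⊗[k] C →ₗ[k] C}
    (h1 : ∀ x, G (dualOne k d n ⊗ₜ x) = x) (h2 : ∀ x, G (dualEta k d n ⊗ₜ x) = Q x) :
    C.IsCoderivation n Q ↔ ((dualNumbers k d n).tensor C).IsGradedHom C G := by
  have hs : (dualNumbers k d n).sgn (d - 1) (dualEta k d n) =
      koszulSign k (n * (1 - d)) • dualEta k d n := by
    rw [(dualNumbers k d n).sgn_apply' _ (dualEta_mem k d n)]
    exact koszulSign_smul_congr _ (by push_cast; grind)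
  have hs' : (dualNumbers k d n).sgn (d - 1) (dualOne k d n) = dualOne k d n := by
    rw [(dualNumbers k d n).sgn_apply' _ (dualOne_mem k d n), mul_zero, koszulSign_zero, one_smul]
  have hcη : ∀ x, TensorProduct.map G G (((dualNumbers k d n).tensor C).comul
      (dualEta k d n ⊗ₜ x)) =
      (TensorProduct.map Q LinearMap.id + TensorProduct.map (C.sgn n) Q :
        C ⊗[k] C →ₗ[k] C ⊗[k] C) (C.comul x) := fun x => by
    rw [tensor_comul_apply, comul_dualEta, map_interchange_dualEta h1 h2]
  have hδη : ∀ x, TensorProduct.map G G (((dualNumbers k d n).tensor C).cobracket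
      (dualEta k d n ⊗ₜ x)) = koszulSign k (n * (1 - d)) •
      (TensorProduct.map Q LinearMap.id + TensorProduct.map (C.sgn n) Q :
        C ⊗[k] C →ₗ[k] C ⊗[k] C) (C.cobracket x) :=
    fun x => by
    rw [tensor_cobracket_apply, cobracket_dualNumbers, LinearMap.zero_apply,
      TensorProduct.zero_tmul, map_zero, zero_add, hs, map_smul, ← TensorProduct.smul_tmul',
      map_smul, map_smul, comul_dualEta, map_interchange_dualEta h1 h2]
  have hεη : ∀ x, ((dualNumbers k d n).tensor C).counit (dualEta k d n ⊗ₜ x) = 0 := fun x => by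
    change (dualNumbers k d n).counit (dualEta k d n) * C.counit x = 0
    rw [counit_dualEta, zero_mul]
  constructor
  · intro hQ
    refine ⟨?_, fun t => ?_, fun t => ?_, fun t => ?_⟩
    · refine DGSpace.hasDegree_zero_iff.1 (DGSpace.hasDegree_iff_proj_comp.2 fun m =>
        TensorProduct.ext (dualNumbers_hom_ext (C.hom_ext fun i x hx => ?_)
          (C.hom_ext fun i x hx => ?_)))
      · change C.proj (m + 0) (G (dualOne k d n ⊗ₜ x)) =
          G (((dualNumbers k d n).tensor C).proj m (dualOne k d n ⊗ₜ x))
        have h3 := DGSpace.tmul_mem _ C.toDGSpace (dualOne_mem k d n) hx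
        rw [zero_add] at h3
        rw [h1, add_zero]
        rcases eq_or_ne i m with rfl | hi
        · rw [DGSpace.proj_of_mem _ h3, h1, C.proj_of_mem hx]
        · rw [DGSpace.proj_of_mem_ne _ h3 hi, map_zero, C.proj_of_mem_ne hx hi]
      · change C.proj (m + 0) (G (dualEta k d n ⊗ₜ x)) =
          G (((dualNumbers k d n).tensor C).proj m (dualEta k d n ⊗ₜ x))
        have h3 := DGSpace.tmul_mem _ C.toDGSpace (dualEta_mem k d n) hx
        have h4 := hQ.hasDegree _ _ hx
        rw [add_comm] at h4
        rw [h2, add_zero]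
        rcases eq_or_ne (n + i) m with rfl | hi
        · rw [DGSpace.proj_of_mem _ h3, h2, C.proj_of_mem h4]
        · rw [DGSpace.proj_of_mem_ne _ h3 hi, map_zero, C.proj_of_mem_ne h4 hi]
    · suffices h : C.counit ∘ₗ G = ((dualNumbers k d n).tensor C).counit from
        LinearMap.congr_fun h t
      refine dual_tensor_hom_ext (fun x => ?_) fun x => ?_
      · rw [LinearMap.comp_apply, h1]
        change _ = (dualNumbers k d n).counit (dualOne k d n) * C.counit x
        rw [counit_dualOne, one_mul]
      · rw [LinearMap.comp_apply, h2, hεη]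
        exact LinearMap.congr_fun hQ.counit_comp x
    · suffices h : C.comul ∘ₗ G = TensorProduct.map G G ∘ₗ ((dualNumbers k d n).tensor C).comul from
        LinearMap.congr_fun h t
      refine dual_tensor_hom_ext (fun x => ?_) fun x => ?_
      · rw [LinearMap.comp_apply, h1, LinearMap.comp_apply, tensor_comul_apply, comul_dualOne,
          map_interchange_dualOne h1]
      · rw [LinearMap.comp_apply, h2, LinearMap.comp_apply, hcη]
        exact LinearMap.congr_fun hQ.comul_comp x
    · suffices h : C.cobracket ∘ₗ G =
          TensorProduct.map G G ∘ₗ ((dualNumbers k d n).tensor C).cobracket from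
        LinearMap.congr_fun h t
      refine dual_tensor_hom_ext (fun x => ?_) fun x => ?_
      · rw [LinearMap.comp_apply, h1, LinearMap.comp_apply, tensor_cobracket_apply,
          cobracket_dualNumbers, LinearMap.zero_apply, TensorProduct.zero_tmul, map_zero, zero_add,
          hs', comul_dualOne, map_interchange_dualOne h1]
      · rw [LinearMap.comp_apply, h2, LinearMap.comp_apply, hδη]
        exact LinearMap.congr_fun hQ.cobracket_comp x
  · intro hG
    refine ⟨fun m x hx => ?_, LinearMap.ext fun x => ?_, LinearMap.ext fun x => ?_,
      LinearMap.ext fun x => ?_⟩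
    · rw [← h2, add_comm]
      exact hG.map_mem _ _ (DGSpace.tmul_mem _ C.toDGSpace (dualEta_mem k d n) hx)
    · rw [LinearMap.comp_apply, ← h2, hG.map_counit, hεη]
      rfl
    · rw [LinearMap.comp_apply, ← h2, hG.map_comul, hcη]
      rfl
    · rw [LinearMap.comp_apply, ← h2, hG.map_cobracket, hδη]
      rfl

end Dual

end DCoalgebraOps

/-! ### Cofree coproartinian coalgebras and their coderivations -/

section Cofree

variable {k : Type u} [Field k] {d : ℤ} {C E : DCoalgebraOps k d} {M : DGSpace k}

theorem IsCogenerator.comp {f : E →ₗ[k] M} (h : IsCogenerator E M f) {g : C →ₗ[k] E}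
    (hg : C.IsGradedHom E g) : IsCogenerator C M (f ∘ₗ g) :=
  ⟨fun n _ hx => h.map_mem n _ (hg.map_mem n _ hx), fun _ he => h.map_grouplike _ (he.map hg)⟩

namespace DCoalgebraOps

/-- Requiring zero differential turns morphisms of dg coalgebras into morphisms of graded ones, so
the universal object is cofree in the graded sense. -/
theorem isLocal_isCogenerator (d : ℤ) (M : DGSpace k) :
    IsLocal fun (S : DCoalgebraOps k d) (f : S →ₗ[k] M) => S.D = 0 ∧ IsCogenerator S M f where
  pull := fun {S T g f} _ _ hg hinj hf => by
    refine ⟨LinearMap.ext fun x => hinj ?_, hf.2.comp hg.toIsGradedHom⟩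
    rw [hg.map_D, hf.1, LinearMap.zero_apply, LinearMap.zero_apply, map_zero]
  unit := fun hf hg he he' => by rw [hf.2.map_grouplike _ he, hg.2.map_grouplike _ he']
  glue := fun {ι _ S T g f} hS hT hg hs hf => by
    obtain ⟨i₀⟩ := ‹Nonempty ι›
    refine ⟨LinearMap.ext_of_iSup_range hs fun i => LinearMap.ext fun x => ?_, ⟨?_, fun e he => ?_⟩⟩
    · rw [LinearMap.comp_apply, ← (hg i).map_D, (hf i).1, LinearMap.zero_apply, map_zero,
        LinearMap.zero_comp, LinearMap.zero_apply]
    · refine DGSpace.hasDegree_iff_proj_comp.2 fun n =>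
        LinearMap.ext_of_iSup_range hs fun i => LinearMap.ext fun x => ?_
      have h1 := LinearMap.congr_fun
        (DGSpace.HasDegree.proj_comp (M := (S i).toDGSpace) (N := M) (hf i).2.map_mem n) x
      have h2 := (hg i).proj_nat n x
      simp only [LinearMap.comp_apply] at h1 ⊢
      rw [h1, h2]
    · obtain ⟨a, ha⟩ := (hS i₀).exists_isGrouplike
      rw [hT.grouplike_unique he (ha.map (hg i₀).toIsGradedHom)]
      exact (hf i₀).2.map_grouplike a ha
  inhabited := ⟨dualNumbers k d 0, 0, dualNumbers_isCoproartinian k d 0, D_dualNumbers k d 0,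
    fun _ _ _ => Submodule.zero_mem _, fun _ _ => rfl⟩

/-- The `d`-coalgebra `C` with a new differential `Q`. -/
def withD (C : DCoalgebraOps k d) (Q : C →ₗ[k] C)
    (hQ : DGSpace.HasDegree C.toDGSpace C.toDGSpace 1 Q) (hQQ : Q ∘ₗ Q = 0) :
    DCoalgebraOps k d where
  carrier := C.carrier
  gr := C.gr
  internal := C.internal
  D := Q
  D_mem := hQ
  D_D := LinearMap.congr_fun hQQ
  comul := C.comul
  counit := C.counit
  cobracket := C.cobracket

theorem IsDCoalgebra.withD (hC : C.IsDCoalgebra) {Q : C →ₗ[k] C} (hQ : C.IsCoderivation 1 Q)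
    (hQQ : Q ∘ₗ Q = 0) : (C.withD Q hQ.hasDegree hQQ).IsDCoalgebra where
  comul_mem := hC.comul_mem
  counit_eq_zero := hC.counit_eq_zero
  cobracket_mem := hC.cobracket_mem
  comul_D := LinearMap.congr_fun hQ.comul_comp
  counit_D := LinearMap.congr_fun hQ.counit_comp
  cobracket_D := fun x => by
    rw [negOnePow_smul_eq (k := k), koszulSign_congr (n := 1 * (1 - d)) (by push_cast; grind)]
    exact LinearMap.congr_fun hQ.cobracket_comp x
  coassoc := hC.coassoc
  cocomm := hC.cocomm
  counit_comul := hC.counit_comul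
  cobracket_swap := hC.cobracket_swap
  cojacobi := hC.cojacobi
  coleibniz := hC.coleibniz
  counit_cobracket := hC.counit_cobracket

/-- The largest filtration which can exhibit `C` as coproartinian. -/
def coradicalFiltration (C : DCoalgebraOps k d) (e : C) : ℕ → Submodule k C
  | 0 => Submodule.span k {e}
  | i + 1 => (C.square (C.coradicalFiltration e i)).comap (C.reducedComul e) ⊓
      (C.square (C.coradicalFiltration e i)).comap C.cobracket

theorem mem_coradicalFiltration_succ {e : C} {i : ℕ} {x : C} :
    x ∈ C.coradicalFiltration e (i + 1) ↔
      C.reducedComul e x ∈ C.square (C.coradicalFiltration e i) ∧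
        C.cobracket x ∈ C.square (C.coradicalFiltration e i) := Iff.rfl

/-- Since any exhibiting filtration lies below the coradical one, exhaustiveness passes to the
latter. -/
theorem IsCoartFiltration.le_coradicalFiltration {F : ℕ → Submodule k C} {e : C}
    (h : C.IsCoartFiltration F e) (hC : C.IsDCoalgebra) (i : ℕ) :
    F i ≤ C.coradicalFiltration e i := by
  induction i with
  | zero => exact h.zero_eq.le
  | succ i ih =>
    exact fun x hx => mem_coradicalFiltration_succ.2 ⟨
      C.square_mono ih (h.reducedComul_mem hC i hx), C.square_mono ih (h.cobracket_mem' i hx)⟩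

theorem coradicalFiltration_mono (hC : C.IsCoproartinian) {e : C} (he : C.IsGrouplike e) :
    Monotone (C.coradicalFiltration e) := by
  refine monotone_nat_of_le_succ fun i => ?_
  induction i with
  | zero =>
    refine (Submodule.span_singleton_le_iff_mem _ _).2 (mem_coradicalFiltration_succ.2 ⟨?_, ?_⟩)
    · have h1 : e ∈ C.coradicalFiltration e 0 := Submodule.mem_span_singleton_self e
      rw [reducedComul_apply, he.1, sub_self, zero_sub]
      exact Submodule.neg_mem _ (C.tmul_mem_square h1 h1)
    · rw [hC.cobracket_grouplike he]
      exact Submodule.zero_mem _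
  | succ i ih =>
    exact fun x hx => mem_coradicalFiltration_succ.2 ⟨
      C.square_mono ih (mem_coradicalFiltration_succ.1 hx).1,
        C.square_mono ih (mem_coradicalFiltration_succ.1 hx).2⟩

theorem coradicalFiltration_exhaustive (hC : C.IsCoproartinian) {e : C} (he : C.IsGrouplike e)
    (x : C) : ∃ i, x ∈ C.coradicalFiltration e i := by
  obtain ⟨F, e', h⟩ := hC.exists_filtration
  obtain rfl := hC.grouplike_unique he (h.isGrouplike hC.isDCoalgebra)
  obtain ⟨i, hi⟩ := h.exhaustive x
  exact ⟨i, h.le_coradicalFiltration hC.isDCoalgebra i hi⟩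

theorem reducedComul_hasDegree (hC : C.IsCoproartinian) {e : C} (he : C.IsGrouplike e) :
    DGSpace.HasDegree C.toDGSpace (C.toDGSpace.tensor C.toDGSpace) 0
    (C.reducedComul e) := fun n x hx => by
  have h0 := hC.grouplike_mem_gr he
  rw [add_zero, reducedComul_apply]
  exact Submodule.sub_mem _ (Submodule.sub_mem _ (hC.isDCoalgebra.comul_mem n x hx)
    (DGSpace.tmul_mem_tensorGr _ _ (zero_add n) h0 hx))
    (DGSpace.tmul_mem_tensorGr _ _ (add_zero n) hx h0)

theorem proj_mem_coradicalFiltration (hC : C.IsCoproartinian) {e : C} (he : C.IsGrouplike e)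
    (i : ℕ) :
    ∀ n, ∀ x ∈ C.coradicalFiltration e i, C.proj n x ∈ C.coradicalFiltration e i := by
  induction i with
  | zero =>
    intro n x hx
    obtain ⟨c, rfl⟩ := Submodule.mem_span_singleton.1 hx
    rw [map_smul]
    refine Submodule.smul_mem _ _ ?_
    rcases eq_or_ne 0 n with rfl | hn
    · rw [DGSpace.proj_of_mem _ (hC.grouplike_mem_gr he)]
      exact Submodule.mem_span_singleton_self e
    · rw [DGSpace.proj_of_mem_ne _ (hC.grouplike_mem_gr he) hn]
      exact Submodule.zero_mem _
  | succ i ih =>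
    intro n x hx
    have h1 := LinearMap.congr_fun ((reducedComul_hasDegree hC he).proj_comp n) x
    have h2 := LinearMap.congr_fun (DGSpace.HasDegree.proj_comp (M := C.toDGSpace)
      (N := C.toDGSpace.tensor C.toDGSpace) hC.isDCoalgebra.cobracket_mem n) x
    rw [LinearMap.comp_apply, LinearMap.comp_apply] at h1 h2
    refine mem_coradicalFiltration_succ.2 ⟨?_, ?_⟩
    · rw [← h1]
      exact DGSpace.proj_mem_tensorSub C.toDGSpace C.toDGSpace ih ih _ _
        (mem_coradicalFiltration_succ.1 hx).1
    · rw [← h2]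
      exact DGSpace.proj_mem_tensorSub C.toDGSpace C.toDGSpace ih ih _ _
        (mem_coradicalFiltration_succ.1 hx).2

/-- A filtration exhibiting `C` as coproartinian need not be stable under a new differential. The
coradical filtration is defined by the operations alone, hence is stable under every coderivation
killing `e`, and so it serves for the coalgebra with changed differential. -/
theorem IsCoderivation.mem_coradicalFiltration (hC : C.IsCoproartinian) {e : C}
    (he : C.IsGrouplike e) {n : ℤ} {Q : C →ₗ[k] C} (hQ : C.IsCoderivation n Q)
    (hQe : Q e = 0) (i : ℕ) :
    ∀ x ∈ C.coradicalFiltration e i, Q x ∈ C.coradicalFiltration e i := by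
  induction i with
  | zero =>
    intro x hx
    obtain ⟨c, rfl⟩ := Submodule.mem_span_singleton.1 hx
    rw [map_smul, hQe, smul_zero]
    exact Submodule.zero_mem _
  | succ i ih =>
    intro x hx
    have hsq : ∀ t ∈ C.square (C.coradicalFiltration e i),
        (TensorProduct.map Q LinearMap.id + TensorProduct.map (C.sgn n) Q :
          C ⊗[k] C →ₗ[k] C ⊗[k] C) t ∈ C.square (C.coradicalFiltration e i) := fun t ht => by
      refine C.square_le (P := (C.square (C.coradicalFiltration e i)).comap
        (TensorProduct.map Q LinearMap.id + TensorProduct.map (C.sgn n) Q)) (fun y hy z hz => ?_) ht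
      exact Submodule.add_mem _ (C.tmul_mem_square (ih y hy) hz)
        (C.tmul_mem_square (DGSpace.sgn_mem C.toDGSpace (proj_mem_coradicalFiltration hC he i) n hy)
          (ih z hz))
    have h1 : C.reducedComul e (Q x) =
        (TensorProduct.map Q LinearMap.id + TensorProduct.map (C.sgn n) Q :
          C ⊗[k] C →ₗ[k] C ⊗[k] C) (C.reducedComul e x) := by
      have h2 := LinearMap.congr_fun hQ.comul_comp x
      have h3 : C.sgn n e = e := by
        rw [C.sgn_apply' n (hC.grouplike_mem_gr he), mul_zero, koszulSign_zero, one_smul]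
      rw [LinearMap.comp_apply, LinearMap.comp_apply] at h2
      rw [reducedComul_apply, reducedComul_apply, h2, map_sub, map_sub]
      simp only [LinearMap.add_apply, TensorProduct.map_tmul, hQe, h3, LinearMap.id_apply,
        TensorProduct.zero_tmul, TensorProduct.tmul_zero, zero_add, add_zero]
    have h2 := LinearMap.congr_fun hQ.cobracket_comp x
    rw [LinearMap.comp_apply] at h2
    refine mem_coradicalFiltration_succ.2 ⟨?_, ?_⟩
    · rw [h1]
      exact hsq _ (mem_coradicalFiltration_succ.1 hx).1
    · rw [h2]
      exact Submodule.smul_mem _ _ (hsq _ (mem_coradicalFiltration_succ.1 hx).2)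

theorem IsCoproartinian.withD (hC : C.IsCoproartinian) {e : C} (he : C.IsGrouplike e)
    {Q : C →ₗ[k] C} (hQ : C.IsCoderivation 1 Q) (hQe : Q e = 0)
    (hQQ : Q ∘ₗ Q = 0) : (C.withD Q hQ.hasDegree hQQ).IsCoproartinian :=
  ⟨hC.isDCoalgebra.withD hQ hQQ, C.coradicalFiltration e, e,
    (hC.isDCoalgebra.withD hQ hQQ).isCoartFiltration (coradicalFiltration_mono hC he)
      (coradicalFiltration_exhaustive hC he) (proj_mem_coradicalFiltration hC he)
      (IsCoderivation.mem_coradicalFiltration hC he hQ hQe) rfl he.2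
      (fun _ _ hx => (mem_coradicalFiltration_succ.1 hx).1)
      fun _ _ hx => (mem_coradicalFiltration_succ.1 hx).2⟩

/-- `C` is the cofree graded coproartinian `d`-coalgebra cogenerated by `M[d]`, with projection `p`
onto cogenerators. -/
structure IsCofree (C : DCoalgebraOps k d) (M : DGSpace k) (p : C →ₗ[k] M) : Prop where
  coart : C.IsCoproartinian
  isCogenerator : IsCogenerator C M p
  existsUnique : ∀ W : DCoalgebraOps k d, W.IsCoproartinian → ∀ f : W →ₗ[k] M,
    IsCogenerator W M f → ∃! F : W →ₗ[k] C, W.IsGradedHom C F ∧ p ∘ₗ F = f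

theorem exists_isCofree (d : ℤ) (M : DGSpace k) :
    ∃ (C : DCoalgebraOps k d) (p : C →ₗ[k] M), C.IsCofree M p := by
  obtain ⟨C, p, hC, ⟨hD, hp⟩, huniv⟩ := (isLocal_isCogenerator d M).exists_universal
  refine ⟨C, p, hC, hp, fun W hW f hf => ?_⟩
  obtain ⟨e, he⟩ := hW.exists_isGrouplike
  -- Replace the differential of `W` by zero; this does not change its graded morphisms, and the
  -- universal property among objects of zero differential applies.
  have hW' := hW.withD he (IsCoderivation.zero W 1) rfl (LinearMap.comp_zero _)
  obtain ⟨F, ⟨hF, hpF⟩, huniq⟩ := huniv _ hW' f ⟨rfl, hf.map_mem, hf.map_grouplike⟩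
  refine ⟨F, ⟨⟨hF.map_mem, hF.map_counit, hF.map_comul, hF.map_cobracket⟩, hpF⟩,
    fun G ⟨hG, hpG⟩ => huniq G ⟨⟨⟨hG.map_mem, hG.map_counit, hG.map_comul, hG.map_cobracket⟩,
      fun x => ?_⟩, hpG⟩⟩
  rw [hD]
  exact map_zero G

namespace IsCofree

variable {p : C →ₗ[k] M}

theorem hom_ext (h : C.IsCofree M p) {W : DCoalgebraOps k d} (hW : W.IsCoproartinian)
    {F G : W →ₗ[k] C} (hF : W.IsGradedHom C F) (hG : W.IsGradedHom C G) (hFG : p ∘ₗ F = p ∘ₗ G) :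
    F = G :=
  (h.existsUnique W hW _ (h.isCogenerator.comp hG)).unique ⟨hF, hFG⟩ ⟨hG, rfl⟩

/-- Apply cofreeness to the dual numbers tensored with `C` and the map `1 ⊗ x ↦ p x`, `η ⊗ x ↦ q x`.
The resulting morphism `G` is the identity on `1 ⊗ C`, and its restriction to `η ⊗ C` is the
coderivation. -/
theorem exists_isCoderivation (h : C.IsCofree M p) {n : ℤ} {q : C →ₗ[k] M}
    (hq : DGSpace.HasDegree C.toDGSpace M (d + n) q) {e : C} (he : C.IsGrouplike e)
    (hqe : q e = 0) : ∃ Q, C.IsCoderivation n Q ∧ p ∘ₗ Q = q ∧ Q e = 0 := by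
  have hK := dualNumbers_isCoproartinian k d n
  have h1 := dualOne_isGrouplike k d n
  have hKC := hK.tensor h.coart
  have hcog : IsCogenerator ((dualNumbers k d n).tensor C) M (dualMap n p q) := by
    refine ⟨?_, fun e' he' => ?_⟩
    · refine DGSpace.hasDegree_iff_proj_comp.2 fun m =>
        dual_tensor_hom_ext (LinearMap.congr_fun (C.hom_ext fun i x hx => ?_ :
          (M.proj (m + d) ∘ₗ dualMap n p q) ∘ₗ TensorProduct.mk k _ C (dualOne k d n) =
          (dualMap n p q ∘ₗ ((dualNumbers k d n).tensor C).proj m) ∘ₗ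
            TensorProduct.mk k _ C (dualOne k d n)))
          (LinearMap.congr_fun (C.hom_ext fun i x hx => ?_ :
          (M.proj (m + d) ∘ₗ dualMap n p q) ∘ₗ TensorProduct.mk k _ C (dualEta k d n) =
          (dualMap n p q ∘ₗ ((dualNumbers k d n).tensor C).proj m) ∘ₗ
            TensorProduct.mk k _ C (dualEta k d n)))
      · have h3 := DGSpace.tmul_mem _ C.toDGSpace (dualOne_mem k d n) hx
        have h4 := h.isCogenerator.map_mem i x hx
        simp only [LinearMap.comp_apply, TensorProduct.mk_apply]
        rw [zero_add] at h3
        rw [dualMap_one]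
        rcases eq_or_ne i m with rfl | hi
        · rw [DGSpace.proj_of_mem _ h3, dualMap_one, M.proj_of_mem h4]
        · rw [DGSpace.proj_of_mem_ne _ h3 hi, map_zero, M.proj_of_mem_ne h4 (by omega)]
      · have h3 := DGSpace.tmul_mem _ C.toDGSpace (dualEta_mem k d n) hx
        have h4 := hq i x hx
        simp only [LinearMap.comp_apply, TensorProduct.mk_apply]
        rw [show i + (d + n) = n + i + d by ring] at h4
        rw [dualMap_eta]
        rcases eq_or_ne (n + i) m with rfl | hi
        · rw [DGSpace.proj_of_mem _ h3, dualMap_eta, M.proj_of_mem h4]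
        · rw [DGSpace.proj_of_mem_ne _ h3 hi, map_zero, M.proj_of_mem_ne h4 (by omega)]
    · rw [hKC.grouplike_unique he' (hK.isGrouplike_tmul h1 he), dualMap_one]
      exact h.isCogenerator.map_grouplike e he
  obtain ⟨G, ⟨hG, hpG⟩, -⟩ := h.existsUnique _ hKC _ hcog
  have hpη : ∀ x, p (G (dualEta k d n ⊗ₜ x)) = q x := fun x => by
    rw [← dualMap_eta p q x, ← hpG]
    rfl
  have hp1 : ∀ x, p (G (dualOne k d n ⊗ₜ x)) = p x := fun x => by
    rw [← dualMap_one p q x, ← hpG]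
    rfl
  have hG1 : G ∘ₗ TensorProduct.mk k (dualNumbers k d n) C (dualOne k d n) = LinearMap.id :=
    h.hom_ext h.coart (hG.comp (isHom_unit_tmul hK h1 C).toIsGradedHom) (IsGradedHom.id C)
      (LinearMap.ext hp1)
  -- On the line of `e` the map `G` is a morphism from the dual numbers; `q e = 0` makes it agree on
  -- cogenerators with the constant morphism at `e`, so `G (η ⊗ e) = 0`.
  have hGe : G ∘ₗ (TensorProduct.mk k (dualNumbers k d n) C).flip e =
      (dualNumbers k d n).counit.smulRight e := by
    refine h.hom_ext hK (hG.comp (isHom_tmul_unit h.coart he _).toIsGradedHom)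
      (isHom_smulRight_grouplike hK.isDCoalgebra he (h.coart.grouplike_mem_gr he)
        (h.coart.D_grouplike he) (h.coart.cobracket_grouplike he)).toIsGradedHom
      (dualNumbers_hom_ext ?_ ?_)
    · simp only [LinearMap.comp_apply, LinearMap.flip_apply, TensorProduct.mk_apply,
        LinearMap.smulRight_apply, counit_dualOne, one_smul]
      exact hp1 e
    · simp only [LinearMap.comp_apply, LinearMap.flip_apply, TensorProduct.mk_apply,
        LinearMap.smulRight_apply, counit_dualEta, zero_smul, map_zero]
      rw [hpη, hqe]
  refine ⟨G ∘ₗ TensorProduct.mk k (dualNumbers k d n) C (dualEta k d n),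
    (isCoderivation_iff (LinearMap.congr_fun hG1) fun _ => rfl).2 hG, LinearMap.ext hpη, ?_⟩
  have h2 := LinearMap.congr_fun hGe (dualEta k d n)
  rw [LinearMap.smulRight_apply, counit_dualEta, zero_smul] at h2
  exact h2

/-- The morphisms from the dual numbers tensored with `C` attached to `Q` and to `0` have the same
corestriction, hence coincide. -/
theorem isCoderivation_eq_zero (h : C.IsCofree M p) {n : ℤ} {Q : C →ₗ[k] C}
    (hQ : C.IsCoderivation n Q) (hpQ : p ∘ₗ Q = 0) : Q = 0 := by
  have h1 := (isCoderivation_iff (dualMap_one (n := n) LinearMap.id Q) (dualMap_eta _ Q)).1 hQ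
  have h2 := (isCoderivation_iff (dualMap_one (n := n) LinearMap.id 0) (dualMap_eta _ 0)).1
    (IsCoderivation.zero C n)
  have h3 := h.hom_ext ((dualNumbers_isCoproartinian k d n).tensor h.coart) h1 h2
    (dual_tensor_hom_ext (fun x => by
      simp only [LinearMap.comp_apply]
      rw [dualMap_one, dualMap_one]) fun x => by
      simp only [LinearMap.comp_apply]
      rw [dualMap_eta, dualMap_eta]
      exact (LinearMap.congr_fun hpQ x).trans (map_zero p).symm)
  refine LinearMap.ext fun x => ?_
  rw [← dualMap_eta (n := n) (d := d) LinearMap.id Q x, h3, dualMap_eta]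

end IsCofree

end DCoalgebraOps

end Cofree

/-! ### The bar coalgebra -/

section Bar

namespace DCoalgebraOps

variable {k : Type u} [Field k] {d : ℤ} {C : DCoalgebraOps k d} {V : DAlgebra k d}
  {p : C →ₗ[k] V.carrier}

theorem barLinear_smul (p r : C →ₗ[k] V.carrier) (c : k) :
    barLinear V p (c • r) = c • barLinear V p r := by
  simp only [barLinear, LinearMap.smul_comp, TensorProduct.map_smul_left, LinearMap.comp_smul,
    smul_add]

/-- By the coderivation rule `Q` acts on one of the two factors, and the swap identities show both
contributions to be equal. The minus sign arises from moving `Q` past the sign operator in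
`barBracket`, and past the cobracket in the product term. -/
theorem barQuadratic_comp_coderivation (hC : C.IsDCoalgebra)
    (hp : DGSpace.HasDegree C.toDGSpace V.toDGSpace d p) {Q : C →ₗ[k] C}
    (hQ : C.IsCoderivation 1 Q) :
    barQuadratic V p ∘ₗ Q = (-2 : k) • barLinear V p (p ∘ₗ Q) := by
  have hr : DGSpace.HasDegree C.toDGSpace V.toDGSpace (d + 1) (p ∘ₗ Q) :=
    hp.comp hQ.hasDegree (add_comm 1 d)
  have hb : barBracket V p ∘ₗ
      (TensorProduct.map Q LinearMap.id + TensorProduct.map (C.sgn 1) Q) =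
      TensorProduct.lift V.bracket ∘ₗ TensorProduct.map p (p ∘ₗ Q) -
        TensorProduct.lift V.bracket ∘ₗ TensorProduct.map ((p ∘ₗ Q) ∘ₗ C.sgn 1) p := by
    rw [barBracket, LinearMap.comp_add, LinearMap.comp_assoc, LinearMap.comp_assoc,
      ← TensorProduct.map_comp, ← TensorProduct.map_comp, LinearMap.comp_assoc,
      LinearMap.comp_assoc, C.sgn_sgn, hQ.hasDegree.sgn_comp, mul_one, koszulSign_one,
      LinearMap.comp_smul, TensorProduct.map_smul_left, LinearMap.comp_smul, LinearMap.comp_id,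
      LinearMap.comp_assoc]
    module
  have hm : barMul V p ∘ₗ
      (TensorProduct.map Q LinearMap.id + TensorProduct.map (C.sgn 1) Q) =
      koszulSign k d • (TensorProduct.lift V.mul ∘ₗ
          TensorProduct.map ((p ∘ₗ Q) ∘ₗ C.sgn d) p) +
        TensorProduct.lift V.mul ∘ₗ TensorProduct.map (p ∘ₗ C.sgn d ∘ₗ C.sgn 1) (p ∘ₗ Q) := by
    rw [barMul, LinearMap.comp_add, LinearMap.comp_assoc, LinearMap.comp_assoc,
      ← TensorProduct.map_comp, ← TensorProduct.map_comp, LinearMap.comp_assoc,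
      LinearMap.comp_assoc, hQ.hasDegree.sgn_comp, mul_one,
      LinearMap.comp_smul, TensorProduct.map_smul_left, LinearMap.comp_smul, LinearMap.comp_id,
      LinearMap.comp_assoc]
  have hs : koszulSign k (1 * (1 - d)) = -koszulSign k d := by
    rw [← neg_one_mul, ← koszulSign_one, ← koszulSign_add]
    exact koszulSign_congr (by push_cast; grind)
  have hsw := lift_swap_cobracket hC hp hr
  have hdd := koszulSign_mul_self (k := k) d
  rw [barQuadratic, LinearMap.add_comp, LinearMap.comp_assoc, LinearMap.comp_assoc, hQ.comul_comp,
    hQ.cobracket_comp, LinearMap.comp_smul, ← LinearMap.comp_assoc, ← LinearMap.comp_assoc, hb, hm,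
    hs, LinearMap.sub_comp, LinearMap.add_comp, LinearMap.smul_comp]
  generalize p ∘ₗ Q = r at hr hsw ⊢
  rw [LinearMap.comp_assoc, LinearMap.comp_assoc, LinearMap.comp_assoc, LinearMap.comp_assoc,
    lift_swap_comul hC hp hr, barLinear, smul_add, smul_smul, neg_mul, hdd,
    neg_smul (koszulSign k d), hsw]
  module

/-- A coderivation of degree `1` whose corestriction is the bar differential squares to zero on
cogenerators. -/
theorem proj_comp_coderivation_comp_self [CharZero k] (hC : C.IsDCoalgebra)
    (hp : DGSpace.HasDegree C.toDGSpace V.toDGSpace d p) {Q : C →ₗ[k] C}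
    (hQ : C.IsCoderivation 1 Q)
    (hpQ : p ∘ₗ Q = koszulSign k d • (V.D ∘ₗ p + (2⁻¹ : k) • barQuadratic V p)) :
    p ∘ₗ Q ∘ₗ Q = 0 := by
  have h2 : (2 : k) ≠ 0 := two_ne_zero
  have hDD : V.D ∘ₗ V.D = 0 := LinearMap.ext V.D_D
  -- In the notation `L` for `barLinear` and `B` for `barQuadratic`: up to the common sign, the
  -- differential of `½ B` contributes `L(d p)`, while `½ B Q = -L(p Q)` contributes `-L(d p) - ½
  -- L(B)`, and `L(B) = 0`.
  rw [← LinearMap.comp_assoc, hpQ, LinearMap.smul_comp, LinearMap.add_comp, LinearMap.smul_comp,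
    barQuadratic_comp_coderivation hC hp hQ, LinearMap.comp_assoc, hpQ, barLinear_smul,
    barLinear_add_smul, barLinear_barQuadratic hC hp, LinearMap.comp_smul, LinearMap.comp_add,
    LinearMap.comp_smul, D_barQuadratic hC hp, ← LinearMap.comp_assoc, hDD, LinearMap.zero_comp]
  simp only [smul_smul, zero_add, smul_zero, add_zero, smul_add]
  rw [← add_smul]
  convert zero_smul k _ using 2
  field_simp
  ring

end DCoalgebraOps

open DCoalgebraOps

variable {k : Type u} [Field k] [CharZero k] {d : ℤ}

/-- On the cofree coalgebra take the coderivation of degree `1` with the prescribed corestriction.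
Its square is a coderivation with zero corestriction, hence zero, so it may serve as a new
differential without affecting graded cofreeness. -/
theorem nonempty_barCoalgebra (V : DAlgebra k d) : Nonempty (BarCoalgebra V) := by
  obtain ⟨C, p, h⟩ := exists_isCofree d V.toDGSpace
  have hC := h.coart.isDCoalgebra
  have hp : DGSpace.HasDegree C.toDGSpace V.toDGSpace d p := h.isCogenerator.map_mem
  obtain ⟨e, he⟩ := h.coart.exists_isGrouplike
  have hpe : p e = 0 := h.isCogenerator.map_grouplike e he
  -- The prescribed corestriction must vanish on the grouplike element for the coderivation to exist
  -- and to kill that element.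
  have hBe : barQuadratic V p e = 0 := by
    have h0 : C.sgn 1 e = e := by
      rw [C.sgn_apply' 1 (h.coart.grouplike_mem_gr he), mul_zero, koszulSign_zero, one_smul]
    simp only [barQuadratic, barBracket, LinearMap.add_apply, LinearMap.comp_apply, he.1,
      h.coart.cobracket_grouplike he, TensorProduct.map_tmul, h0, hpe, TensorProduct.zero_tmul,
      map_zero, add_zero]
  have hq : DGSpace.HasDegree C.toDGSpace V.toDGSpace (d + 1)
      (koszulSign k d • (V.D ∘ₗ p + (2⁻¹ : k) • barQuadratic V p)) := fun n x hx =>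
    Submodule.smul_mem _ _ (Submodule.add_mem _ (V.hasDegree_D.comp hp rfl n x hx)
      (Submodule.smul_mem _ _ (barQuadratic_hasDegree hC hp n x hx)))
  obtain ⟨Q, hQ, hpQ, hQe⟩ := h.exists_isCoderivation hq he (by
    simp only [LinearMap.smul_apply, LinearMap.add_apply, LinearMap.comp_apply, hpe, hBe, map_zero,
      smul_zero, add_zero])
  have hQQ : Q ∘ₗ Q = 0 := h.isCoderivation_eq_zero hQ.comp_self
    (proj_comp_coderivation_comp_self hC hp hQ hpQ)
  refine ⟨⟨C.withD Q hQ.hasDegree hQQ, h.coart.withD he hQ hQe hQQ, p,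
    ⟨h.isCogenerator.map_mem, h.isCogenerator.map_grouplike⟩, fun W hW f hf => ?_, ?_⟩⟩
  · obtain ⟨F, ⟨hF, hpF⟩, huniq⟩ := h.existsUnique W hW f hf
    exact ⟨F, ⟨⟨hF.map_mem, hF.map_counit, hF.map_comul, hF.map_cobracket⟩, hpF⟩,
      fun G ⟨hG, hpG⟩ => huniq G ⟨⟨hG.map_mem, hG.map_counit, hG.map_comul, hG.map_cobracket⟩, hpG⟩⟩
  · have h1 : d.negOnePow • (p ∘ₗ Q) = V.D ∘ₗ p + (2⁻¹ : k) • barQuadratic V p := by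
      rw [negOnePow_smul_eq (k := k), hpQ, smul_smul, koszulSign_mul_self, one_smul]
    exact h1

end Bar

end

/-! ### The theorem -/

theorem mainTheorem3 {k : Type u} [Field k] [CharZero k] (d : ℤ) :
    -- every `d`-algebra `V` has a coalgebra `V^∨`, and the functors `F^φ` are representable
    (∀ V : DAlgebra k d, Nonempty (BarCoalgebra V)) ∧
    (∀ (U V : DAlgebra k d) (X : BarCoalgebra U) (Y : BarCoalgebra V)
      (φ : X.coalg →ₗ[k] Y.coalg), X.coalg.IsHom Y.coalg φ → Nonempty (InternalHom φ)) ∧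
    -- the composition map exists, is unique, and is natural
    (∀ (U V W : DAlgebra k d) (X : BarCoalgebra U) (Y : BarCoalgebra V) (Z : BarCoalgebra W)
      (φ : X.coalg →ₗ[k] Y.coalg) (ψ : Y.coalg →ₗ[k] Z.coalg),
      X.coalg.IsHom Y.coalg φ → Y.coalg.IsHom Z.coalg ψ →
      ∀ (H₁ : InternalHom φ) (H₂ : InternalHom ψ) (H₃ : InternalHom (ψ ∘ₗ φ)),
        (H₁.obj.tensor H₂.obj).IsCoproartinian ∧
        ∃ c : H₁.obj ⊗[k] H₂.obj →ₗ[k] H₃.obj, IsComposition H₁ H₂ H₃ c ∧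
          (∀ c', IsComposition H₁ H₂ H₃ c' → c' = c) ∧
          ∀ (S T : DCoalgebraOps k d), S.IsCoproartinian → T.IsCoproartinian →
            ∀ (f : S →ₗ[k] H₁.obj) (g : T →ₗ[k] H₂.obj), S.IsHom H₁.obj f → T.IsHom H₂.obj g →
              (S.tensor T).IsHom H₃.obj (c ∘ₗ TensorProduct.map f g) ∧
              H₃.ev ∘ₗ TensorProduct.map LinearMap.id (c ∘ₗ TensorProduct.map f g) =
                compFamily (H₁.ev ∘ₗ TensorProduct.map LinearMap.id f)
                  (H₂.ev ∘ₗ TensorProduct.map LinearMap.id g)) ∧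
    -- the composition map is associative
    (∀ (U V W A : DAlgebra k d) (X : BarCoalgebra U) (Y : BarCoalgebra V) (Z : BarCoalgebra W)
      (B : BarCoalgebra A) (φ : X.coalg →ₗ[k] Y.coalg) (ψ : Y.coalg →ₗ[k] Z.coalg)
      (χ : Z.coalg →ₗ[k] B.coalg),
      X.coalg.IsHom Y.coalg φ → Y.coalg.IsHom Z.coalg ψ → Z.coalg.IsHom B.coalg χ →
      ∀ (H₁ : InternalHom φ) (H₂ : InternalHom ψ) (H₃ : InternalHom χ)
        (H₁₂ : InternalHom (ψ ∘ₗ φ)) (H₂₃ : InternalHom (χ ∘ₗ ψ))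
        (H₁₂₃ : InternalHom (χ ∘ₗ ψ ∘ₗ φ))
        (c₁₂ : H₁.obj ⊗[k] H₂.obj →ₗ[k] H₁₂.obj) (c₂₃ : H₂.obj ⊗[k] H₃.obj →ₗ[k] H₂₃.obj)
        (c_left : H₁₂.obj ⊗[k] H₃.obj →ₗ[k] H₁₂₃.obj)
        (c_right : H₁.obj ⊗[k] H₂₃.obj →ₗ[k] H₁₂₃.obj),
        IsComposition H₁ H₂ H₁₂ c₁₂ → IsComposition H₂ H₃ H₂₃ c₂₃ →
        IsComposition H₁₂ H₃ H₁₂₃ c_left → IsComposition H₁ H₂₃ H₁₂₃ c_right →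
        c_left ∘ₗ TensorProduct.map c₁₂ LinearMap.id =
          c_right ∘ₗ TensorProduct.map LinearMap.id c₂₃ ∘ₗ
            (TensorProduct.assoc k H₁.obj H₂.obj H₃.obj).toLinearMap) ∧
    -- the composition map makes `hom^Id(V, V)` a coproartinian `d`-bialgebra
    (∀ (V : DAlgebra k d) (X : BarCoalgebra V)
      (H : InternalHom (LinearMap.id : X.coalg →ₗ[k] X.coalg)),
        ∃ m : H.obj ⊗[k] H.obj →ₗ[k] H.obj, IsComposition H H H m ∧ IsDBialgebra H.obj m) := by
  refine ⟨nonempty_barCoalgebra, fun U V X Y φ hφ => nonempty_internalHom hφ,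
    fun U V W X Y Z φ ψ hφ hψ H₁ H₂ H₃ => ⟨H₁.coart.tensor H₂.coart, ?_⟩,
    fun U V W A X Y Z B φ ψ χ hφ hψ hχ H₁ H₂ H₃ H₁₂ H₂₃ H₁₂₃ c₁₂ c₂₃ l r h₁₂ h₂₃ hl hr =>
      h₁₂.assoc h₂₃ hl hr, fun V X H => ?_⟩
  · obtain ⟨c, hc⟩ := exists_isComposition rfl H₁ H₂ H₃
    exact ⟨c, hc, fun c' hc' => hc'.unique hc, fun S T hS hT f g hf hg =>
      ⟨hc.isHom.comp (hf.tensor hg), hc.classifies_comp f g⟩⟩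
  · obtain ⟨m, hm⟩ := exists_isComposition (LinearMap.id_comp _).symm H H H
    exact ⟨m, hm, hm.isDBialgebra⟩
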